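/- **Setting.** Let $K$ be a field of characteristic $0$, complete with respect to an absolute value (possibly the trivial one), and let $q,t\in K$ be algebraically independent over $\mathbb{Q}$ (for example $K=\mathbb{Q}(q,t)$ with the trivial absolute value). Let $\Lambda=K[p_1,p_2,\dots]$ be the ring of symmetric functions over $K$, with $p_n$ the power sums, with monomial symmetric functions $m_\lambda$ and Macdonald's scalar product $\langle p_\lambda,p_\mu\rangle=\delta_{\lambda\mu}\prod_{n\ge1}n^{k_n}k_n!\left(\frac{1-q^n}{1-t^n}\right)^{k_n}$, where $k_n$ is the number of parts of $\lambda$ equal to $n$. The Macdonald polynomials $P_\lambda=P_\lambda(\,\cdot\,;q,t)$ are the unique family in $\Lambda$ with $P_\lambda\in m_\lambda+\sum_{\mu<\lambda}K\,m_\mu$ (dominance order) and $\langle P_\lambda,P_\mu\rangle=0$ for $\lambda\ne\mu$. Put $$b_\lambda=\prod_{s\in\lambda}\frac{1-q^{a_\lambda(s)}t^{l_\lambda(s)+1}}{1-q^{a_\lambda(s)+1}t^{l_\lambda(s)}},\qquad Q_\lambda=b_\lambda P_\lambda,\qquad P_\mu P_\nu=\sum_\lambda f^\lambda_{\mu\nu}P_\lambda,$$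 with $a_\lambda(s)$, $l_\lambda(s)$ the arm and leg lengths, and define the skew Macdonald polynomials by $$Q_{\lambda/\mu}=\sum_\nu f^\lambda_{\mu\nu}Q_\nu,\qquad P_{\lambda/\mu}=\frac{b_\mu}{b_\lambda}\,Q_{\lambda/\mu}.$$ Let $A$, $X=\{x_i\}_{i\in I}$, $Y=\{y_j\}_{j\in J}$ be indeterminates, where $I,J$ are arbitrary (finite or infinite) sets. All identities hold in the formal power series ring $K[[A,X,Y]]$ with the topology of coefficientwise convergence. A symmetric function is evaluated at an alphabet $Z$ through its power sums $p_n(Z)$, with $p_n(A^kZ)=A^{kn}p_n(Z)$ and, for the plethystic substitution, $p_n\!\left(\frac{Z}{1-t}\right)=\frac{p_n(Z)}{1-t^n}$. The Macdonald Cauchy kernel is $$\Pi_{q,t}(Z,W)=\exp\Big(\sum_{n>0}\frac1n\,\frac{1-t^n}{1-q^n}\,p_n(Z)\,p_n(W)\Big).$$ **Statement.** 1. The sum and the product below converge (the sum unconditionally), and $$\sum_{\lambda,\mu}A^{|\lambda|}\,Q_{\mu/\lambda}(X;q,t)\,P_{\mu/\lambda}(Y;q,t)=\prod_{k=0}^{\infty}\frac{1}{1-A^{k+1}}\,\Pi_{q,t}(A^kX,Y),$$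 the sum being over all pairs of partitions. 2. Likewise, after the plethystic substitutions $X\to\frac{X}{1-t}$, $Y\to\frac{Y}{1-t}$, $$\sum_{\lambda,\mu}A^{|\lambda|}\,Q_{\mu/\lambda}\!\Big(\frac{X}{1-t};q,t\Big)P_{\mu/\lambda}\!\Big(\frac{Y}{1-t};q,t\Big)=\prod_{k=0}^{\infty}\frac{1}{1-A^{k+1}}\,\Pi_{q,t}\!\Big(\frac{A^kX}{1-t},\frac{Y}{1-t}\Big).$$ 3. The kernels in these identities are convergent infinite products: for every $k\ge0$, if $|q|<1$, $$\Pi_{q,t}(A^kX,Y)=\prod_{i,j}\prod_{n\ge0}\frac{1-tq^nA^kx_iy_j}{1-q^nA^kx_iy_j},$$ and, if $|q|<1$ and $|t|<1$, $$\Pi_{q,t}\!\Big(\frac{A^kX}{1-t},\frac{Y}{1-t}\Big)=\prod_{i,j}\prod_{l,m\ge0}\frac{1}{1-q^lt^mA^kx_iy_j}.$$ -/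

import Mathlib

open scoped MvPowerSeries.WithPiTopology

noncomputable section

namespace Macdonald

/-! ### Partitions (as Young diagrams, rows and columns numbered from `0`) -/

/-- Dominance order on partitions of the same size: `μ ≤ ν` iff `|μ| = |ν|` and
`μ₁ + ⋯ + μₖ ≤ ν₁ + ⋯ + νₖ` for all `k`. -/
def DominanceLE (μ ν : YoungDiagram) : Prop :=
  μ.card = ν.card ∧
    ∀ k : ℕ, ∑ i ∈ Finset.range k, μ.rowLen i ≤ ∑ i ∈ Finset.range k, ν.rowLen i

/-- Number of boxes of `ν` strictly to the right of the box `s` in its row. -/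
def arm (ν : YoungDiagram) (s : ℕ × ℕ) : ℕ := ν.rowLen s.1 - (s.2 + 1)

/-- Number of boxes of `ν` strictly below the box `s` in its column. -/
def leg (ν : YoungDiagram) (s : ℕ × ℕ) : ℕ := ν.colLen s.2 - (s.1 + 1)

/-! ### Symmetric functions -/

/-- The power sum `∑ i, z_i ^ n` in the variables `z_i = X (v i)`, where `v : ι → σ` is an
injective labelling of some of the variables of a formal power series ring (`ι` may be infinite);
`n` is positive, so the coefficient of every `z_i ^ n` is `1` and all the others are `0`. -/
def powerSum (K : Type*) [Field K] {ι σ : Type*} (v : ι → σ) (n : ℕ+) : MvPowerSeries σ K :=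
  open Classical in
  fun α => if ∃ i, α = Finsupp.single (v i) (n : ℕ) then 1 else 0

/-- The ring of symmetric functions over a field `K` of characteristic `0`: the polynomial ring
in the power sums, the variable `X n` standing for `p_n`. -/
abbrev SymFun (K : Type*) [Field K] : Type _ := MvPolynomial ℕ+ K

/-- A symmetric function as a formal power series in the variables `x₀, x₁, x₂, …`. -/
def toSeries {K : Type*} [Field K] (f : SymFun K) : MvPowerSeries ℕ K :=
  MvPolynomial.aeval (powerSum K (id : ℕ → ℕ)) f

/-- The monomial symmetric function `m_ν`, as a formal power series in `x₀, x₁, x₂, …`: the sum of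
all monomials whose nonzero exponents are, up to order, the parts of `ν`. -/
def monomialSymm (K : Type*) [Field K] (ν : YoungDiagram) : MvPowerSeries ℕ K :=
  open Classical in
  fun α => if α.support.val.map α = (ν.rowLens : Multiset ℕ) then 1 else 0

/-- The norm `⟨p_α, p_α⟩` of a product of power sums `p_α = ∏ n, p_n ^ α n`, that is
`z_α ∏ n, ((1 - q ^ n) / (1 - t ^ n)) ^ α n` with `z_α = ∏ n, n ^ α n * (α n)!`. -/
def powerSumNorm {K : Type*} [Field K] (q t : K) (α : ℕ+ →₀ ℕ) : K :=
  α.prod fun n k =>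
    ((n : ℕ) : K) ^ k * (k.factorial : K) * ((1 - q ^ (n : ℕ)) / (1 - t ^ (n : ℕ))) ^ k

/-- Macdonald's scalar product: bilinear, with the products of power sums as an orthogonal
basis. -/
def scalarProduct {K : Type*} [Field K] (q t : K) (f g : SymFun K) : K :=
  ∑ α ∈ f.support, f.coeff α * g.coeff α * powerSumNorm q t α

/-! ### Macdonald polynomials -/

/-- The two characteristic properties of the family of Macdonald polynomials: `P_ν` is `m_ν` plus a
linear combination of `m_μ` with `μ < ν` in dominance order, and `P_ν`, `P_μ` are orthogonal
whenever `ν ≠ μ`. -/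
structure IsMacdonaldFamily {K : Type*} [Field K] (q t : K) (P : YoungDiagram → SymFun K) :
    Prop where
  triangular : ∀ ν, ∃ u : YoungDiagram →₀ K,
    (∀ μ ∈ u.support, DominanceLE μ ν ∧ μ ≠ ν) ∧
      toSeries (P ν) = monomialSymm K ν + u.sum fun μ a => a • monomialSymm K μ
  orthogonal : ∀ ν μ, ν ≠ μ → scalarProduct q t (P ν) (P μ) = 0

/-- The Macdonald polynomials `P_ν(q,t)`. -/
def macP {K : Type*} [Field K] (q t : K) : YoungDiagram → SymFun K :=
  Classical.epsilon (IsMacdonaldFamily q t)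

/-- `b_ν(q,t) = ∏ s ∈ ν, (1 - q ^ a(s) t ^ (l(s) + 1)) / (1 - q ^ (a(s) + 1) t ^ l(s))`. -/
def macb {K : Type*} [Field K] (q t : K) (ν : YoungDiagram) : K :=
  (∏ s ∈ ν.cells, (1 - q ^ arm ν s * t ^ (leg ν s + 1))) /
    ∏ s ∈ ν.cells, (1 - q ^ (arm ν s + 1) * t ^ leg ν s)

/-- `Q_ν = b_ν P_ν`. -/
def macQ {K : Type*} [Field K] (q t : K) (ν : YoungDiagram) : SymFun K :=
  macb q t ν • macP q t ν

/-- The structure constants: `macf q t μ ν ρ` is the coefficient `f^ρ_{μν}` in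
`P_μ P_ν = ∑ ρ, f^ρ_{μν} P_ρ`. -/
def macf {K : Type*} [Field K] (q t : K) (μ ν : YoungDiagram) : YoungDiagram →₀ K :=
  Classical.epsilon fun f : YoungDiagram →₀ K =>
    macP q t μ * macP q t ν = f.sum fun ρ a => a • macP q t ρ

/-- The skew Macdonald polynomial `Q_{ρ/μ} = ∑ ν, f^ρ_{μν} Q_ν` (only the finitely many `ν` with
`|ν| = |ρ| - |μ|` contribute, and it vanishes unless `μ ⊆ ρ`). -/
def skewQ {K : Type*} [Field K] (q t : K) (ρ μ : YoungDiagram) : SymFun K :=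
  ∑ᶠ ν : YoungDiagram, macf q t μ ν ρ • macQ q t ν

/-- The skew Macdonald polynomial `P_{ρ/μ} = (b_μ / b_ρ) Q_{ρ/μ}`. -/
def skewP {K : Type*} [Field K] (q t : K) (ρ μ : YoungDiagram) : SymFun K :=
  (macb q t μ / macb q t ρ) • skewQ q t ρ μ

/-! ### Alphabets in the power series ring `K⟦A, x_i, y_j⟧` -/

/-- The variables: the parameter `A`, the `x_i` (`i : ι`) and the `y_j` (`j : κ`). -/
inductive Var (ι κ : Type*) where
  | A : Var ι κ
  | x (i : ι) : Var ι κ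
  | y (j : κ) : Var ι κ

/-- The formal power series ring `K⟦A, x_i, y_j⟧`. -/
abbrev Ser (K ι κ : Type*) [Field K] : Type _ := MvPowerSeries (Var ι κ) K

section

variable (K : Type*) [Field K] (ι κ : Type*)

/-- The parameter `A`. -/
def serA : Ser K ι κ := MvPowerSeries.X Var.A

/-- The power sums of the alphabet `X = {x_i}`. -/
def alphX : ℕ+ → Ser K ι κ := powerSum K Var.x

/-- The power sums of the alphabet `Y = {y_j}`. -/
def alphY : ℕ+ → Ser K ι κ := powerSum K Var.y

end

section

variable {K : Type*} [Field K] {ι κ : Type*}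

/-- The alphabet `A ^ k Z`: `p_n(A ^ k Z) = A ^ (k n) p_n(Z)`. -/
def scale (k : ℕ) (Z : ℕ+ → Ser K ι κ) : ℕ+ → Ser K ι κ :=
  fun n => (serA K ι κ ^ k) ^ (n : ℕ) * Z n

/-- The plethystic substitution `Z / (1 - t)`: `p_n ↦ p_n(Z) / (1 - t ^ n)`. -/
def pleth (t : K) (Z : ℕ+ → Ser K ι κ) : ℕ+ → Ser K ι κ :=
  fun n => (1 - t ^ (n : ℕ))⁻¹ • Z n

/-- The value `f(Z)` of a symmetric function at an alphabet given by its power sums. -/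
def evalAt (Z : ℕ+ → Ser K ι κ) (f : SymFun K) : Ser K ι κ := MvPolynomial.aeval Z f

/-- The Cauchy kernel
`Π_{q,t}(Z, W) = exp (∑ n > 0, (1 / n) (1 - t ^ n) / (1 - q ^ n) p_n(Z) p_n(W))`. -/
def cauchyKernel [CharZero K] [TopologicalSpace K] (q t : K) (Z W : ℕ+ → Ser K ι κ) : Ser K ι κ :=
  (PowerSeries.exp K).subst
    (∑' n : ℕ+, (1 / ((n : ℕ) : K) * ((1 - t ^ (n : ℕ)) / (1 - q ^ (n : ℕ)))) • (Z n * W n))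

/-- The general term `A ^ |ν| Q_{μ/ν}(Z) P_{μ/ν}(W)` of the sum over pairs `(ν, μ)`. -/
def cauchyTerm (q t : K) (Z W : ℕ+ → Ser K ι κ) (p : YoungDiagram × YoungDiagram) : Ser K ι κ :=
  serA K ι κ ^ p.1.card * evalAt Z (skewQ q t p.2 p.1) * evalAt W (skewP q t p.2 p.1)

/-- The factor `(1 - A ^ (k + 1))⁻¹ Π_{q,t}(A ^ k Z, W)` of the product over `k`. -/
def cauchyFactor [CharZero K] [TopologicalSpace K] (q t : K) (Z W : ℕ+ → Ser K ι κ) (k : ℕ) :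
    Ser K ι κ :=
  (1 - serA K ι κ ^ (k + 1))⁻¹ * cauchyKernel q t (scale k Z) W

/-- The monomial `c A ^ k x_i y_j`. -/
def monAXY (c : K) (k : ℕ) (i : ι) (j : κ) : Ser K ι κ :=
  c • (serA K ι κ ^ k * MvPowerSeries.X (Var.x i) * MvPowerSeries.X (Var.y j))

end

end Macdonald

end

/-! The identity is a trace computation. Write `z_α` for the norm `powerSumNorm` of the power sum
product `p_α`. Once the `P_λ` are known to be orthogonal with `b_λ ⟨P_λ, P_λ⟩ = 1`, the coefficient
of `p_α` in `Q_{ρ/μ}` is `b_ρ ⟨P_μ p_α, P_ρ⟩ / z_α` (`coeff_skewQ`). Summing over `|μ| = d` and `|ρ|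
= d + e` therefore produces, for each pair `(α, β)` of weight `e`, the trace in degree `d` of
multiplication by `p_α` followed by the adjoint of multiplication by `p_β`. A trace may be taken in
any basis; in the power sums it vanishes for `α ≠ β` and equals `∑ z_{γ+α} / z_γ` for `α = β`
(`sum_macb_mul_scalarProduct`).

The ratios `z_{γ+α} / (z_γ z_α)` are products of binomial coefficients, so by Pascal's rule their
generating function in `A` is `∏_k (1 - A^k)^(-1-α_k)` (`genA_mul_expTerm_traceTerm`). Summing over
`α` leaves `∏_k (1 - A^k)⁻¹` times the exponential of the kernel exponent with its `n`-th term
divided by `1 - A^n`; expanding `1 / (1 - A^n)` geometrically turns this into the product of the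
kernels at `A^k X` (`hasSum_cauchyTerm`, `hasProd_cauchyFactor`). Only the grading of the two
alphabets matters, so the plethystic form is another instance of the same statement.

What has to be supplied is Macdonald's theory: existence and uniqueness of the `P_λ`, since `macP`
is only a choice, and the norm formula `⟨P_λ, P_λ⟩ = b_λ⁻¹` for the arm-leg product. In `n`
variables `macOp` is the Vandermonde determinant times Macdonald's generating function `D(X)` of
`q`-difference operators. It is triangular on monomial symmetric polynomials (`macOp_mono_sub_mem`),
and a suitable `X` separates its eigenvalues in a given degree. On the Cauchy kernel it acts through
the determinant of `kerMat`, and `kerMat_det_swap` says that the result is symmetric in the two sets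
of variables: `D(X)` is self-adjoint. Hence its triangular eigenvectors diagonalise the kernel,
which is equivalent to orthogonality, and a triangular orthogonal family is unique.

For the norms, `kerMat_neg_one_det` compares `D(-1)` and `D(-t)` on the kernel. In `n` variables
multiplication by `x_1 ⋯ x_n` sends `P_μ` to `P_{μ+(1^n)}`, so this comparison is a recursion for
the inverse norms when a full column is added. The arm-leg product obeys the same recursion, and
columns are removed one by one (`IsKernelFamily.eq_macb`).

The product formulas follow by taking logarithms: each factor is the exponential of an explicit
series in one monomial `A^k x_i y_j`, and the scalar coefficients are summed as geometric series. -/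

open scoped MvPowerSeries.WithPiTopology

noncomputable section

namespace Macdonald

/-! ### Two determinantal identities -/

section Determinants

/-- The matrix `x_i ^ j (∏ k, (1 - u t x_i y_k) + X t ^ j ∏ k, (1 - u x_i y_k))`. -/
def kerMat {R : Type*} [CommRing R] {n : ℕ} (u t X : R) (x y : Fin n → R) :
    Matrix (Fin n) (Fin n) R :=
  Matrix.of fun i j => x i ^ (j : ℕ) *
    (∏ k, (1 - u * (t * x i) * y k) + X * t ^ (j : ℕ) * ∏ k, (1 - u * x i * y k))

theorem map_kerMat {R S : Type*} [CommRing R] [CommRing S] {n : ℕ} (f : R →+* S) (u t X : R)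
    (x y : Fin n → R) :
    (kerMat u t X x y).map f = kerMat (f u) (f t) (f X) (fun i => f (x i)) (fun i => f (y i)) := by
  ext i j
  simp [kerMat, map_prod]

/-- The permutation acts on columns here, so that the summands match those of `macOp` one by one. -/
theorem det_kerMat_eq {R : Type*} [CommRing R] {n : ℕ} (u t X : R) (x y : Fin n → R) :
    (kerMat u t X x y).det = ∑ w : Equiv.Perm (Fin n), ((Equiv.Perm.sign w : ℤ) : R) *
      ∏ i, (x i ^ (w i : ℕ) *
        (∏ k, (1 - u * (t * x i) * y k) + X * t ^ (w i : ℕ) * ∏ k, (1 - u * x i * y k))) := by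
  rw [← Matrix.det_transpose, Matrix.det_apply']
  rfl

section Field

variable {F : Type*} [Field F] {n : ℕ}

/-- The polynomial `∏ l ≠ k, (1 - u y_l z)` in `z`. -/
def omitPoly (u : F) (y : Fin n → F) (k : Fin n) : Polynomial F :=
  ∏ l ∈ Finset.univ.erase k, (1 - Polynomial.C (u * y l) * Polynomial.X)

/-- The matrix of the coefficients of the polynomials `omitPoly u y k`. -/
def omitMat (u : F) (y : Fin n → F) : Matrix (Fin n) (Fin n) F :=
  Matrix.of fun m k => (omitPoly u y k).coeff m

theorem eval_omitPoly (u z : F) (y : Fin n → F) (k : Fin n) :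
    (omitPoly u y k).eval z = ∏ l ∈ Finset.univ.erase k, (1 - u * z * y l) := by
  rw [omitPoly, Polynomial.eval_prod]
  refine Finset.prod_congr rfl fun l _ => ?_
  simp; ring

theorem natDegree_omitPoly_lt (u : F) (y : Fin n → F) (k : Fin n) :
    (omitPoly u y k).natDegree < n := by
  have h1 : (omitPoly u y k).natDegree ≤ ∑ l ∈ Finset.univ.erase k, 1 := by
    refine (Polynomial.natDegree_prod_le _ _).trans (Finset.sum_le_sum fun l _ => ?_)
    refine (Polynomial.natDegree_sub_le _ _).trans ?_
    simpa using Polynomial.natDegree_C_mul_le (u * y l) Polynomial.X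
  have h2 : (∑ l ∈ Finset.univ.erase k, 1) = n - 1 := by
    simp [Finset.card_erase_of_mem]
  have : 0 < n := k.pos
  omega

theorem sum_pow_mul_omitMat (u z : F) (y : Fin n → F) (k : Fin n) :
    ∑ m : Fin n, z ^ (m : ℕ) * omitMat u y m k = ∏ l ∈ Finset.univ.erase k, (1 - u * z * y l) := by
  rw [← eval_omitPoly, Polynomial.eval_eq_sum_range' (natDegree_omitPoly_lt u y k),
    Finset.sum_range]
  exact Finset.sum_congr rfl fun m _ => mul_comm _ _

/-- Evaluating the polynomials `omitPoly u y k` at the points `1 / (u y_i)` gives a diagonal matrix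
with nonzero diagonal, because the `i`-th point is a root of all of them except the one with `k =
i`. -/
theorem det_omitMat_ne_zero (u : F) (y : Fin n → F) (hu : u ≠ 0) (hy : ∀ i, y i ≠ 0)
    (hinj : Function.Injective y) : (omitMat u y).det ≠ 0 := by
  intro h
  have h1 : Matrix.of (fun i m : Fin n => ((u * y i)⁻¹) ^ (m : ℕ)) * omitMat u y =
      Matrix.diagonal fun k => ∏ l ∈ Finset.univ.erase k, (1 - u * (u * y k)⁻¹ * y l) := by
    ext i k
    rw [Matrix.mul_apply]
    simp only [Matrix.of_apply]
    rw [sum_pow_mul_omitMat, Matrix.diagonal_apply]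
    split_ifs with hik
    · rw [hik]
    · refine Finset.prod_eq_zero (i := i) (by simp [hik]) ?_
      have := hy i
      field_simp
      simp
  have h2 := congrArg Matrix.det h1
  rw [Matrix.det_mul, h, mul_zero, Matrix.det_diagonal, eq_comm, Finset.prod_eq_zero_iff] at h2
  obtain ⟨k, -, hk⟩ := h2
  rw [Finset.prod_eq_zero_iff] at hk
  obtain ⟨l, hl, hkl⟩ := hk
  have hyk := hy k
  have : y k = y l := by
    field_simp at hkl
    linear_combination hkl
  exact (Finset.mem_erase.1 hl).1 (hinj this.symm)

/-- `∏ i k, (1 - u x_i y_k) (1 - u t x_i y_k)`. -/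
def kerDenom (u t : F) (x y : Fin n → F) : F :=
  ∏ i, ∏ k, ((1 - u * x i * y k) * (1 - u * (t * x i) * y k))

/-- The matrix `1 / (1 - u x_i y_k) + X / (1 - u t x_i y_k)`. -/
def cauchyMat (u t X : F) (x y : Fin n → F) : Matrix (Fin n) (Fin n) F :=
  Matrix.of fun i k => (1 - u * x i * y k)⁻¹ + X * (1 - u * (t * x i) * y k)⁻¹

/-- With `G(z) = ∏ l, (1 - u z y_l)`, multiplication by `omitMat` replaces the powers of `z` by
`G(z) / (1 - u z y_k)`, for `z = x_i` and for `z = t x_i`. The factor `G(x_i) G(t x_i)` then comes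
out of row `i` and a Cauchy-type entry remains. -/
theorem kerMat_det_mul_omitMat_det (u t X : F) (x y : Fin n → F)
    (h1 : ∀ i k, 1 - u * x i * y k ≠ 0) (h2 : ∀ i k, 1 - u * (t * x i) * y k ≠ 0) :
    (kerMat u t X x y).det * (omitMat u y).det =
      kerDenom u t x y * (cauchyMat u t X x y).det := by
  rw [← Matrix.det_mul, kerDenom, ← Matrix.det_diagonal, ← Matrix.det_mul]
  congr 1
  ext i k
  rw [Matrix.mul_apply, Matrix.diagonal_mul]
  have e1 : ∏ l, (1 - u * x i * y l) =
      (1 - u * x i * y k) * ∏ l ∈ Finset.univ.erase k, (1 - u * x i * y l) :=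
    (Finset.mul_prod_erase _ _ (Finset.mem_univ k)).symm
  have e2 : ∏ l, (1 - u * (t * x i) * y l) =
      (1 - u * (t * x i) * y k) * ∏ l ∈ Finset.univ.erase k, (1 - u * (t * x i) * y l) :=
    (Finset.mul_prod_erase _ _ (Finset.mem_univ k)).symm
  have e3 : ∑ j, kerMat u t X x y i j * omitMat u y j k =
      (∏ l, (1 - u * (t * x i) * y l)) * ∑ m : Fin n, x i ^ (m : ℕ) * omitMat u y m k +
      X * (∏ l, (1 - u * x i * y l)) * ∑ m : Fin n, (t * x i) ^ (m : ℕ) * omitMat u y m k := by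
    rw [Finset.mul_sum, Finset.mul_sum, ← Finset.sum_add_distrib]
    refine Finset.sum_congr rfl fun m _ => ?_
    simp only [kerMat, Matrix.of_apply, mul_pow]
    ring
  rw [e3, sum_pow_mul_omitMat, sum_pow_mul_omitMat, Finset.prod_mul_distrib, e1, e2]
  simp only [cauchyMat, Matrix.of_apply]
  have a1 := h1 i k
  have a2 := h2 i k
  generalize 1 - u * x i * y k = a at a1 ⊢
  generalize 1 - u * (t * x i) * y k = b at a2 ⊢
  field_simp

theorem kerDenom_swap (u t : F) (x y : Fin n → F) : kerDenom u t x y = kerDenom u t y x := by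
  rw [kerDenom, kerDenom, Finset.prod_comm]
  refine Finset.prod_congr rfl fun i _ => Finset.prod_congr rfl fun k _ => ?_
  ring

theorem cauchyMat_det_swap (u t X : F) (x y : Fin n → F) :
    (cauchyMat u t X x y).det = (cauchyMat u t X y x).det := by
  rw [← Matrix.det_transpose]
  congr 1
  ext i k
  simp only [cauchyMat, Matrix.of_apply, Matrix.transpose_apply]
  congr 2
  · ring
  · congr 1; ring

theorem kerMat_zero_det (u t : F) (x y : Fin n → F) :
    (kerMat u t 0 x y).det =
      (∏ i, ∏ k, (1 - u * (t * x i) * y k)) * (Matrix.vandermonde x).det := by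
  rw [← Matrix.det_diagonal, ← Matrix.det_mul]
  congr 1
  ext i k
  simp [kerMat, Matrix.diagonal_mul, Matrix.vandermonde_apply, mul_comm]

/-- After multiplication by `omitMat` both sides become the visibly symmetric expression `kerDenom *
det cauchyMat`. The case `X = 0`, where the determinant is a Vandermonde times a symmetric product,
allows `omitMat` to be traded for Vandermonde determinants. -/
theorem kerMat_det_swap_field (u t X : F) (x y : Fin n → F) (hu : u ≠ 0)
    (h1 : ∀ i k, 1 - u * x i * y k ≠ 0) (h2 : ∀ i k, 1 - u * (t * x i) * y k ≠ 0)
    (hy : ∀ i, y i ≠ 0) (hinj : Function.Injective y) :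
    (kerMat u t X x y).det * (Matrix.vandermonde y).det =
      (kerMat u t X y x).det * (Matrix.vandermonde x).det := by
  have h1' : ∀ i k, 1 - u * y i * x k ≠ 0 := fun i k => by convert h1 k i using 1; ring
  have h2' : ∀ i k, 1 - u * (t * y i) * x k ≠ 0 := fun i k => by convert h2 k i using 1; ring
  have key : ∀ X, (kerMat u t X x y).det * (omitMat u y).det =
      (kerMat u t X y x).det * (omitMat u x).det := fun X => by
    rw [kerMat_det_mul_omitMat_det u t X x y h1 h2, kerMat_det_mul_omitMat_det u t X y x h1' h2',
      kerDenom_swap, cauchyMat_det_swap]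
  have k0 := key 0
  have hG : (∏ i, ∏ k, (1 - u * (t * x i) * y k)) = ∏ i, ∏ k, (1 - u * (t * y i) * x k) := by
    rw [Finset.prod_comm]
    refine Finset.prod_congr rfl fun i _ => Finset.prod_congr rfl fun k _ => ?_
    ring
  have hG0 : (∏ i, ∏ k, (1 - u * (t * y i) * x k)) ≠ 0 :=
    Finset.prod_ne_zero_iff.2 fun i _ => Finset.prod_ne_zero_iff.2 fun k _ => h2' i k
  rw [kerMat_zero_det, kerMat_zero_det, hG, mul_assoc, mul_assoc] at k0
  have k0 := mul_left_cancel₀ hG0 k0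
  refine mul_right_cancel₀ (det_omitMat_ne_zero u y hu hy hinj) ?_
  linear_combination (Matrix.vandermonde y).det * key X - (kerMat u t X y x).det * k0

end Field

variable {R : Type*} [CommRing R] [IsDomain R] {n : ℕ}

theorem kerMat_det_swap (u t X : R) (x y : Fin n → R) (hu : u ≠ 0)
    (h1 : ∀ i k, 1 - u * x i * y k ≠ 0) (h2 : ∀ i k, 1 - u * (t * x i) * y k ≠ 0)
    (hy : ∀ i, y i ≠ 0) (hinj : Function.Injective y) :
    (kerMat u t X x y).det * (Matrix.vandermonde y).det =
      (kerMat u t X y x).det * (Matrix.vandermonde x).det := by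
  let f : R →+* FractionRing R := algebraMap R (FractionRing R)
  have hf : Function.Injective f := IsFractionRing.injective R (FractionRing R)
  have hf0 : ∀ a : R, a ≠ 0 → f a ≠ 0 := fun a ha => by rwa [Ne, map_eq_zero_iff f hf]
  apply hf
  have hV : ∀ x : Fin n → R, f.mapMatrix (Matrix.vandermonde x) =
      Matrix.vandermonde fun i => f (x i) := fun x => by
    ext i j; simp [Matrix.vandermonde_apply]
  rw [map_mul, map_mul, RingHom.map_det, RingHom.map_det, RingHom.map_det, RingHom.map_det,
    hV, hV, RingHom.mapMatrix_apply, RingHom.mapMatrix_apply, map_kerMat, map_kerMat]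
  refine kerMat_det_swap_field (f u) (f t) (f X) _ _ (hf0 _ hu) (fun i k => ?_) (fun i k => ?_)
    (fun i => hf0 _ (hy i)) (fun i j hij => hinj (hf hij))
  · simpa using hf0 _ (h1 i k)
  · simpa using hf0 _ (h2 i k)

/-- For `X = -1` consider the columns `v_m = x^m (G(t x) - t^m G(x))`, `0 ≤ m ≤ n`, with `G(z) = ∏
l, (1 - u z y_l) = ∑ c_m z^m`. They satisfy `∑ c_m v_m = G(x) G(t x) - G(t x) G(x) = 0` and `c_0 =
1`, so `v_0` is a combination of `v_1, …, v_n`. The latter are the columns for `X = -t`, each row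
multiplied by `x_i`. -/
theorem kerMat_neg_one_det {R : Type*} [CommRing R] {n : ℕ} (u t : R) (x y : Fin n → R) :
    (kerMat u t (-1) x y).det =
      u ^ n * (∏ i, x i) * (∏ i, y i) * (kerMat u t (-t) x y).det := by
  obtain _ | k := n
  · simp
  let G : Polynomial R := ∏ l, (1 - Polynomial.C (u * y l) * Polynomial.X)
  have hG : ∀ z, G.eval z = ∏ l, (1 - u * z * y l) := fun z => by
    rw [Polynomial.eval_prod]
    refine Finset.prod_congr rfl fun l _ => ?_
    simp; ring
  have hdeg1 : ∀ l, (1 - Polynomial.C (u * y l) * Polynomial.X).natDegree ≤ 1 := fun l => by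
    refine (Polynomial.natDegree_sub_le _ _).trans ?_
    simpa using (Polynomial.natDegree_C_mul_le (u * y l) Polynomial.X).trans
      Polynomial.natDegree_X_le
  have hdeg : G.natDegree < k + 2 := by
    have h1 : G.natDegree ≤ ∑ l : Fin (k + 1), 1 :=
      (Polynomial.natDegree_prod_le _ _).trans (Finset.sum_le_sum fun l _ => hdeg1 l)
    simp at h1
    omega
  have hc0 : G.coeff 0 = 1 := by
    rw [Polynomial.coeff_zero_eq_eval_zero, hG]; simp
  have hcn : G.coeff (k + 1) = (-u) ^ (k + 1) * ∏ i, y i := by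
    have := Polynomial.coeff_prod_of_natDegree_le (s := (Finset.univ : Finset (Fin (k + 1))))
      (fun l => 1 - Polynomial.C (u * y l) * Polynomial.X) 1 (fun l _ => hdeg1 l)
    simp only [Finset.card_univ, Fintype.card_fin, mul_one] at this
    rw [show G.coeff (k + 1) = _ from this]
    have h2 : ∀ l, (1 - Polynomial.C (u * y l) * Polynomial.X).coeff 1 = -u * y l := fun l => by
      simp [Polynomial.coeff_one]
    simp only [h2, Finset.prod_mul_distrib, Finset.prod_const, Finset.card_univ, Fintype.card_fin]
  let A : Matrix (Fin (k + 1)) (Fin (k + 1)) R := Matrix.of fun i m =>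
    x i ^ ((m : ℕ) + 1) * (G.eval (t * x i) - t ^ ((m : ℕ) + 1) * G.eval (x i))
  -- A companion matrix: column `0` encodes the relation `v_0 = -∑ c_m v_m`, the other columns shift
  -- the index.
  let B : Matrix (Fin (k + 1)) (Fin (k + 1)) R := Matrix.of fun m j =>
    if j = 0 then -G.coeff ((m : ℕ) + 1) else if (m : ℕ) + 1 = j then 1 else 0
  have hA : A.det = (∏ i, x i) * (kerMat u t (-t) x y).det := by
    rw [← Matrix.det_diagonal, ← Matrix.det_mul]
    congr 1
    ext i m
    rw [Matrix.diagonal_mul]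
    simp only [A, kerMat, Matrix.of_apply, hG, pow_succ]
    ring
  have hB : B.det = u ^ (k + 1) * ∏ i, y i := by
    -- The last row is zero outside column `0`, where it holds minus the top coefficient of `G`; the
    -- complementary minor is the identity matrix.
    rw [Matrix.det_succ_row B (Fin.last k), Finset.sum_eq_single 0]
    · have h1 : B.submatrix (Fin.last k).succAbove (Fin.succAbove 0) = 1 := by
        ext m j
        simp only [B, Matrix.submatrix_apply, Matrix.of_apply, Fin.zero_succAbove,
          Fin.succAbove_last, Fin.val_castSucc, Fin.val_succ, add_left_inj, Matrix.one_apply,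
          Fin.ext_iff]
        rw [if_neg (by simp)]
      rw [h1, Matrix.det_one]
      simp only [B, Matrix.of_apply, if_true, Fin.val_last, hcn, Fin.val_zero, add_zero, mul_one]
      rw [neg_pow u (k + 1), pow_succ (-1 : R) k]
      have : ((-1 : R) ^ k) * (-1) ^ k = 1 := by rw [← mul_pow]; simp
      linear_combination (u ^ (k + 1) * ∏ i, y i) * this
    · intro j _ hj
      have : (k : ℕ) + 1 ≠ (j : ℕ) := by omega
      simp [B, hj, this]
    · simp
  have hAB : kerMat u t (-1) x y = A * B := by
    ext i j
    rw [Matrix.mul_apply]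
    by_cases hj : j = 0
    · subst hj
      have e1 := Polynomial.eval_eq_sum_range' hdeg (x i)
      have e2 := Polynomial.eval_eq_sum_range' hdeg (t * x i)
      rw [Finset.sum_range_succ', hc0, Finset.sum_range] at e1 e2
      simp only [pow_zero, mul_one] at e1 e2
      have e3 : ∑ m, A i m * B m 0 =
          -(G.eval (t * x i) * ∑ m : Fin (k + 1), G.coeff ((m : ℕ) + 1) * x i ^ ((m : ℕ) + 1)) +
          G.eval (x i) * ∑ m : Fin (k + 1), G.coeff ((m : ℕ) + 1) * (t * x i) ^ ((m : ℕ) + 1) := by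
        rw [Finset.mul_sum, Finset.mul_sum, ← Finset.sum_neg_distrib, ← Finset.sum_add_distrib]
        refine Finset.sum_congr rfl fun m _ => ?_
        simp only [A, B, Matrix.of_apply, if_true, mul_pow]
        ring
      rw [e3]
      simp only [kerMat, Matrix.of_apply, ← hG, Fin.val_zero, pow_zero]
      linear_combination (-G.eval (t * x i)) * e1 + G.eval (x i) * e2
    · obtain ⟨j', rfl⟩ := Fin.exists_succ_eq.2 hj
      rw [Finset.sum_eq_single j'.castSucc]
      · simp only [A, B, kerMat, Matrix.of_apply, hj, hG, if_false, Fin.val_succ,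
          Fin.val_castSucc, if_true]
        ring
      · intro m _ hm
        have : (m : ℕ) ≠ j' := fun h => hm (Fin.ext h)
        simp [B, this]
      · simp
  rw [hAB, Matrix.det_mul, hA, hB]
  ring

end Determinants

/-! ### Partitions and dominance order -/

section Partitions

theorem youngDiagram_ext {μ ν : YoungDiagram} (h : ∀ i, μ.rowLen i = ν.rowLen i) : μ = ν := by
  refine SetLike.ext fun ⟨i, j⟩ => ?_
  rw [YoungDiagram.mem_iff_lt_rowLen, YoungDiagram.mem_iff_lt_rowLen, h]

theorem rowLen_eq_zero_iff {μ : YoungDiagram} {i : ℕ} : μ.rowLen i = 0 ↔ μ.colLen 0 ≤ i := by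
  rw [← not_iff_not, not_le, ← YoungDiagram.mem_iff_lt_colLen, YoungDiagram.mem_iff_lt_rowLen]
  omega

theorem card_eq_sum_rowLen (μ : YoungDiagram) {k : ℕ} (hk : μ.colLen 0 ≤ k) :
    μ.card = ∑ i ∈ Finset.range k, μ.rowLen i := by
  have h : ∀ c ∈ μ.cells, c.1 ∈ Finset.range k := fun ⟨i, j⟩ hc => by
    rw [YoungDiagram.mem_cells] at hc
    have := YoungDiagram.mem_iff_lt_colLen.1 (μ.up_left_mem le_rfl (Nat.zero_le j) hc)
    exact Finset.mem_range.2 (this.trans_le hk)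
  rw [YoungDiagram.card, Finset.card_eq_sum_card_fiberwise h]
  refine Finset.sum_congr rfl fun i _ => ?_
  rw [YoungDiagram.rowLen_eq_card]
  rfl

theorem sum_rowLen_le_card (μ : YoungDiagram) (k : ℕ) :
    ∑ i ∈ Finset.range k, μ.rowLen i ≤ μ.card := by
  rw [card_eq_sum_rowLen μ (le_max_left (μ.colLen 0) k)]
  exact Finset.sum_le_sum_of_subset (Finset.range_subset_range.2 (le_max_right _ _))

theorem colLen_zero_le_card (μ : YoungDiagram) : μ.colLen 0 ≤ μ.card := by
  rw [card_eq_sum_rowLen μ le_rfl]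
  calc μ.colLen 0 = ∑ i ∈ Finset.range (μ.colLen 0), 1 := by simp
    _ ≤ _ := Finset.sum_le_sum fun i hi => by
      have := (rowLen_eq_zero_iff (μ := μ) (i := i)).not.2 (by simpa using hi)
      omega

theorem dominanceLE_refl (μ : YoungDiagram) : DominanceLE μ μ := ⟨rfl, fun _ => le_rfl⟩

theorem DominanceLE.trans {μ ν ρ : YoungDiagram} (h : DominanceLE μ ν) (h' : DominanceLE ν ρ) :
    DominanceLE μ ρ :=
  ⟨h.1.trans h'.1, fun k => (h.2 k).trans (h'.2 k)⟩

theorem eq_of_sum_rowLen_eq {μ ν : YoungDiagram}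
    (h : ∀ k, ∑ i ∈ Finset.range k, μ.rowLen i = ∑ i ∈ Finset.range k, ν.rowLen i) : μ = ν := by
  refine youngDiagram_ext fun i => ?_
  have h1 := h i
  have h2 := h (i + 1)
  rw [Finset.sum_range_succ, Finset.sum_range_succ] at h2
  omega

theorem DominanceLE.antisymm {μ ν : YoungDiagram} (h : DominanceLE μ ν) (h' : DominanceLE ν μ) :
    μ = ν :=
  eq_of_sum_rowLen_eq fun k => le_antisymm (h.2 k) (h'.2 k)

/-- A numerical statistic that is strictly increasing for the dominance order. -/
def dominanceRank (μ : YoungDiagram) : ℕ :=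
  ∑ k ∈ Finset.range (μ.card + 1), ∑ i ∈ Finset.range k, μ.rowLen i

theorem dominanceRank_lt {μ ν : YoungDiagram} (h : DominanceLE μ ν) (hne : μ ≠ ν) :
    dominanceRank μ < dominanceRank ν := by
  rw [dominanceRank, dominanceRank, h.1]
  refine Finset.sum_lt_sum (fun k _ => h.2 k) ?_
  by_contra! hcon
  refine hne (eq_of_sum_rowLen_eq fun k => le_antisymm (h.2 k) ?_)
  by_cases hk : k < ν.card + 1
  · exact hcon k (Finset.mem_range.2 hk)
  · refine (sum_rowLen_le_card ν k).trans ?_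
    rw [← h.1, ← card_eq_sum_rowLen μ ((colLen_zero_le_card μ).trans (by have := h.1; omega))]

theorem finite_card_eq (d : ℕ) : {μ : YoungDiagram | μ.card = d}.Finite := by
  refine Set.Finite.of_finite_image (f := YoungDiagram.cells) ?_
    (fun μ _ ν _ h => YoungDiagram.ext h)
  refine (Finset.finite_toSet (Finset.range d ×ˢ Finset.range d).powerset).subset ?_
  rintro _ ⟨μ, hμ, rfl⟩
  rw [Finset.mem_coe, Finset.mem_powerset]
  rintro ⟨i, j⟩ hc
  rw [YoungDiagram.mem_cells] at hc
  have h1 := YoungDiagram.mem_iff_lt_colLen.1 (μ.up_left_mem le_rfl (Nat.zero_le j) hc)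
  have h2 := YoungDiagram.mem_iff_lt_rowLen.1 hc
  have h3 := colLen_zero_le_card μ
  have h4 := sum_rowLen_le_card μ (i + 1)
  rw [Finset.sum_range_succ] at h4
  simp only [Set.mem_ofPred_eq] at hμ
  simp only [Finset.mem_product, Finset.mem_range]
  omega

/-- The partitions of `d`. -/
def partitionsOf (d : ℕ) : Finset YoungDiagram := (finite_card_eq d).toFinset

@[simp]
theorem mem_partitionsOf {d : ℕ} {μ : YoungDiagram} : μ ∈ partitionsOf d ↔ μ.card = d := by
  simp [partitionsOf]

/-- The partitions of `d` with at most `n` parts. -/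
def partitionsLE (n d : ℕ) : Finset YoungDiagram := {μ ∈ partitionsOf d | μ.colLen 0 ≤ n}

@[simp]
theorem mem_partitionsLE {n d : ℕ} {μ : YoungDiagram} :
    μ ∈ partitionsLE n d ↔ μ.card = d ∧ μ.colLen 0 ≤ n := by
  simp [partitionsLE]

/-- The partition whose parts are the nonzero values of `α`. -/
def shape {σ : Type*} (α : σ →₀ ℕ) : YoungDiagram :=
  YoungDiagram.ofRowLens ((α.support.val.map α).sort (· ≥ ·))
    (Multiset.pairwise_sort _ _).sortedGE

theorem rowLens_shape {σ : Type*} (α : σ →₀ ℕ) :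
    (shape α).rowLens = (α.support.val.map α).sort (· ≥ ·) := by
  refine YoungDiagram.rowLens_ofRowLens_eq_self fun x hx => ?_
  rw [Multiset.mem_sort, Multiset.mem_map] at hx
  obtain ⟨i, hi, rfl⟩ := hx
  exact Nat.pos_of_ne_zero (Finsupp.mem_support_iff.1 hi)

theorem coe_rowLens_shape {σ : Type*} (α : σ →₀ ℕ) :
    ((shape α).rowLens : Multiset ℕ) = α.support.val.map α := by
  rw [rowLens_shape, Multiset.sort_eq]

theorem rowLens_injective {μ ν : YoungDiagram}
    (h : (μ.rowLens : Multiset ℕ) = (ν.rowLens : Multiset ℕ)) : μ = ν := by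
  have h1 : μ.rowLens = ν.rowLens :=
    (Multiset.coe_eq_coe.1 h).eq_of_pairwise' μ.rowLens_sorted.pairwise ν.rowLens_sorted.pairwise
  exact YoungDiagram.equivListRowLens.injective (Subtype.ext h1)

theorem shape_eq_iff {σ : Type*} (α : σ →₀ ℕ) (μ : YoungDiagram) :
    α.support.val.map α = (μ.rowLens : Multiset ℕ) ↔ shape α = μ := by
  rw [← coe_rowLens_shape]
  exact ⟨rowLens_injective, fun h => by rw [h]⟩

theorem colLen_shape {σ : Type*} (α : σ →₀ ℕ) : (shape α).colLen 0 = α.support.card := by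
  rw [← YoungDiagram.length_rowLens, ← Multiset.coe_card, coe_rowLens_shape, Multiset.card_map]
  rfl

theorem card_eq_sum_rowLens (μ : YoungDiagram) : μ.card = μ.rowLens.sum := by
  rw [card_eq_sum_rowLen μ le_rfl, YoungDiagram.rowLens, Finset.sum_range, ← List.sum_ofFn,
    List.ofFn_eq_map, ← List.map_coe_finRange_eq_range, List.map_map]
  rfl

theorem card_shape {σ : Type*} (α : σ →₀ ℕ) : (shape α).card = α.degree := by
  rw [card_eq_sum_rowLens, ← Multiset.sum_coe, coe_rowLens_shape]
  rfl

theorem shape_embDomain {σ τ : Type*} (e : σ ↪ τ) (α : σ →₀ ℕ) :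
    shape (α.embDomain e) = shape α := by
  rw [← shape_eq_iff, coe_rowLens_shape, Finsupp.support_embDomain, Finset.map_val,
    Multiset.map_map]
  simp

/-! ### Exponent vectors in finitely many variables -/

variable {n : ℕ}

/-- The parts of `μ` as a weakly increasing sequence of length `n`. -/
def expo (n : ℕ) (μ : YoungDiagram) : Fin n →₀ ℕ :=
  Finsupp.equivFunOnFinite.symm fun i => μ.rowLen (i.rev : ℕ)

@[simp]
theorem expo_apply (μ : YoungDiagram) (i : Fin n) : expo n μ i = μ.rowLen (i.rev : ℕ) := rfl

theorem monotone_expo (n : ℕ) (μ : YoungDiagram) : Monotone (expo n μ) := fun _ _ h =>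
  μ.rowLen_anti _ _ (Fin.rev_le_rev.2 h)

theorem map_support_eq_filter (α : Fin n →₀ ℕ) :
    α.support.val.map α = (Finset.univ.val.map α).filter (· ≠ 0) := by
  rw [Multiset.filter_map]
  congr 1
  have : α.support = Finset.univ.filter fun i => α i ≠ 0 := by ext i; simp
  rw [this]
  rfl

theorem map_expo (μ : YoungDiagram) :
    (Finset.univ.val.map (expo n μ)) = (Multiset.range n).map μ.rowLen := by
  have h1 : (Finset.univ : Finset (Fin n)).val.map (fun i : Fin n => (i.rev : ℕ)) =
      Multiset.range n := by
    have h2 : (Finset.univ : Finset (Fin n)).val.map (Fin.rev : Fin n → Fin n) =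
        (Finset.univ : Finset (Fin n)).val :=
      congrArg Finset.val (Finset.map_univ_equiv (Fin.revPerm : Equiv.Perm (Fin n)))
    have h3 : (Finset.univ : Finset (Fin n)).val.map (fun i : Fin n => (i : ℕ)) =
        Multiset.range n := by
      refine (congrArg Finset.val (Fin.map_valEmbedding_univ (n := n))).trans ?_
      rw [Nat.Iio_eq_range, Finset.range_val]
    rw [← h3]
    conv_rhs => rw [← h2]
    rw [Multiset.map_map]
    rfl
  rw [← h1, Multiset.map_map]
  rfl

theorem shape_expo {μ : YoungDiagram} (h : μ.colLen 0 ≤ n) : shape (expo n μ) = μ := by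
  rw [← shape_eq_iff, map_support_eq_filter, map_expo, Multiset.filter_map]
  have : (Multiset.range n).filter ((fun x => x ≠ 0) ∘ μ.rowLen) = Multiset.range (μ.colLen 0) := by
    refine (Multiset.Nodup.ext ((Multiset.nodup_range n).filter _) (Multiset.nodup_range _)).2
      fun i => ?_
    rw [Multiset.mem_filter, Multiset.mem_range, Multiset.mem_range, Function.comp_apply, Ne,
      rowLen_eq_zero_iff]
    omega
  rw [this, YoungDiagram.rowLens]
  rfl

/-- The shape forgets only the zero exponents, and their number is recovered from `n`. -/
theorem map_univ_eq_of_shape_eq {α β : Fin n →₀ ℕ} (h : shape α = shape β) :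
    Finset.univ.val.map α = Finset.univ.val.map β := by
  have h1 : α.support.val.map α = β.support.val.map β := by
    rw [← coe_rowLens_shape, h, coe_rowLens_shape]
  rw [map_support_eq_filter, map_support_eq_filter] at h1
  have h0 : ∀ α : Fin n →₀ ℕ, (Finset.univ.val.map α).filter (fun x => ¬ x ≠ 0) =
      Multiset.replicate (n - ((Finset.univ.val.map α).filter (· ≠ 0)).card) 0 := fun α => by
    rw [Multiset.eq_replicate]
    constructor
    · have := congrArg Multiset.card
        (Multiset.filter_add_not (fun x => x ≠ 0) (Finset.univ.val.map α))
      rw [Multiset.card_add] at this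
      simp only [Multiset.card_map, Finset.card_val, Finset.card_univ, Fintype.card_fin] at this
      omega
    · intro b hb
      simpa using (Multiset.mem_filter.1 hb).2
  rw [← Multiset.filter_add_not (fun x => x ≠ 0) (Finset.univ.val.map α), h0, h1, ← h0,
    Multiset.filter_add_not]

theorem eq_of_monotone_of_shape_eq {α β : Fin n →₀ ℕ} (hα : Monotone α) (hβ : Monotone β)
    (h : shape α = shape β) : α = β := by
  have h1 := map_univ_eq_of_shape_eq h
  rw [Fin.univ_val_map, Fin.univ_val_map, Multiset.coe_eq_coe] at h1
  have h2 := h1.eq_of_pairwise' hα.sortedLE_ofFn.pairwise hβ.sortedLE_ofFn.pairwise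
  exact DFunLike.coe_injective (List.ofFn_injective h2)

/-- The exponent vector `i ↦ α (w i)`. -/
def permExpo (w : Equiv.Perm (Fin n)) (α : Fin n →₀ ℕ) : Fin n →₀ ℕ :=
  Finsupp.equivFunOnFinite.symm fun i => α (w i)

@[simp]
theorem permExpo_apply (w : Equiv.Perm (Fin n)) (α : Fin n →₀ ℕ) (i : Fin n) :
    permExpo w α i = α (w i) := rfl

theorem shape_permExpo (w : Equiv.Perm (Fin n)) (α : Fin n →₀ ℕ) :
    shape (permExpo w α) = shape α := by
  have h : permExpo w α = α.embDomain w.symm.toEmbedding := by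
    ext i
    have := Finsupp.embDomain_apply_self w.symm.toEmbedding α (w i)
    simpa using this.symm
  rw [h, shape_embDomain]

theorem expo_shape_of_monotone {α : Fin n →₀ ℕ} (hα : Monotone α) : expo n (shape α) = α := by
  refine eq_of_monotone_of_shape_eq (monotone_expo n _) hα (shape_expo ?_)
  rw [colLen_shape]
  exact α.support.card_le_univ.trans (by simp)

theorem colLen_shape_le (α : Fin n →₀ ℕ) : (shape α).colLen 0 ≤ n := by
  rw [colLen_shape]
  exact α.support.card_le_univ.trans (by simp)

theorem exists_permExpo_eq_expo (α : Fin n →₀ ℕ) :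
    ∃ w : Equiv.Perm (Fin n), permExpo w α = expo n (shape α) := by
  refine ⟨Tuple.sort α, ?_⟩
  rw [← shape_permExpo (Tuple.sort α) α]
  exact (expo_shape_of_monotone (Tuple.monotone_sort α)).symm

theorem sum_le_sum_range_of_antitone {f : ℕ → ℕ} (hf : Antitone f) (S : Finset ℕ) :
    ∑ i ∈ S, f i ≤ ∑ i ∈ Finset.range S.card, f i := by
  induction S using Finset.induction_on_max with
  | empty => simp
  | insert a S ha ih =>
    have ha' : a ∉ S := fun h => lt_irrefl _ (ha a h)
    rw [Finset.sum_insert ha', Finset.card_insert_of_notMem ha', Finset.sum_range_succ, add_comm]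
    refine add_le_add ih (hf ?_)
    have : S ⊆ Finset.range a := fun x hx => Finset.mem_range.2 (ha x hx)
    simpa using Finset.card_le_card this

theorem sum_comp_rev_perm_le {f : ℕ → ℕ} (hf : Antitone f) (w : Equiv.Perm (Fin n))
    (S : Finset (Fin n)) :
    ∑ i ∈ S, f ((w i).rev : ℕ) ≤ ∑ j ∈ Finset.range S.card, f j := by
  have hinj : Set.InjOn (fun i : Fin n => ((w i).rev : ℕ)) S := fun i _ j _ h =>
    w.injective (Fin.rev_injective (Fin.ext h))
  have := sum_le_sum_range_of_antitone hf (S.image fun i => ((w i).rev : ℕ))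
  rwa [Finset.sum_image hinj, Finset.card_image_of_injOn hinj] at this

/-- The last `k` elements of `Fin n`. -/
def lastSet (n k : ℕ) : Finset (Fin n) := Finset.univ.filter fun i => n ≤ i + k

theorem sum_lastSet {k : ℕ} (hk : k ≤ n) (f : ℕ → ℕ) :
    ∑ i ∈ lastSet n k, f (i.rev : ℕ) = ∑ j ∈ Finset.range k, f j := by
  refine Finset.sum_bij (fun i _ => (i.rev : ℕ)) (fun i hi => ?_) (fun i _ j _ h => ?_)
    (fun j hj => ?_) (fun _ _ => rfl)
  · simp only [lastSet, Finset.mem_filter, Finset.mem_univ, true_and] at hi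
    rw [Finset.mem_range, Fin.val_rev]
    omega
  · exact Fin.rev_injective (Fin.ext h)
  · rw [Finset.mem_range] at hj
    refine ⟨⟨n - (j + 1), by omega⟩, ?_, ?_⟩
    · simp only [lastSet, Finset.mem_filter, Finset.mem_univ, true_and]
      omega
    · rw [Fin.val_rev]
      simp only
      omega

theorem card_lastSet {k : ℕ} (hk : k ≤ n) : (lastSet n k).card = k := by
  simpa using sum_lastSet hk fun _ => 1

theorem sum_le_sum_rowLen_shape (α : Fin n →₀ ℕ) (S : Finset (Fin n)) :
    ∑ i ∈ S, α i ≤ ∑ j ∈ Finset.range S.card, (shape α).rowLen j := by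
  obtain ⟨w, hw⟩ := exists_permExpo_eq_expo α
  have h : ∀ i, α i = (shape α).rowLen ((w.symm i).rev : ℕ) := fun i => by
    have := DFunLike.congr_fun hw (w.symm i)
    simpa using this
  rw [Finset.sum_congr rfl fun i _ => h i]
  exact sum_comp_rev_perm_le (fun i j hij => (shape α).rowLen_anti i j hij) w.symm S

theorem sum_perm_lastSet_le (w : Equiv.Perm (Fin n)) {k : ℕ} (hk : k ≤ n) :
    ∑ i ∈ lastSet n k, (w i : ℕ) ≤ ∑ i ∈ lastSet n k, (i : ℕ) := by
  have hanti : Antitone fun j : ℕ => n - (j + 1) := fun i j h => by simp only; omega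
  have h1 := sum_comp_rev_perm_le hanti w (lastSet n k)
  have h2 := sum_lastSet hk fun j : ℕ => n - (j + 1)
  have h3 : ∀ i : Fin n, n - ((i.rev : ℕ) + 1) = i := fun i => by rw [Fin.val_rev]; omega
  rw [card_lastSet hk, ← h2] at h1
  simpa only [h3] using h1

/-- The identity maximises every tail sum of `w`, so the hypothesis forces equality in all of them;
two consecutive tails differ by the single index `i`, and subtraction gives `w i = i`. -/
theorem eq_one_of_sum_lastSet {w : Equiv.Perm (Fin n)}
    (h : ∀ k ≤ n, ∑ i ∈ lastSet n k, (i : ℕ) ≤ ∑ i ∈ lastSet n k, (w i : ℕ)) : w = 1 := by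
  refine Equiv.ext fun i => Fin.ext ?_
  have heq : ∀ k ≤ n, ∑ i ∈ lastSet n k, (w i : ℕ) = ∑ i ∈ lastSet n k, (i : ℕ) := fun k hk =>
    le_antisymm (sum_perm_lastSet_le w hk) (h k hk)
  have hins : lastSet n (n - i) = insert i (lastSet n (n - i - 1)) := by
    ext j
    simp only [lastSet, Finset.mem_filter, Finset.mem_univ, true_and, Finset.mem_insert,
      Fin.ext_iff]
    omega
  have hnot : i ∉ lastSet n (n - i - 1) := by
    simp only [lastSet, Finset.mem_filter, Finset.mem_univ, true_and]
    omega
  have h1 := heq (n - i) (by omega)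
  have h2 := heq (n - i - 1) (by omega)
  rw [hins, Finset.sum_insert hnot, Finset.sum_insert hnot, h2] at h1
  simpa using h1

theorem degree_expo {μ : YoungDiagram} (hμ : μ.colLen 0 ≤ n) : (expo n μ).degree = μ.card := by
  rw [← card_shape, shape_expo hμ]

/-- The combinatorial core of the triangularity of Macdonald's operators. -/
theorem dominanceLE_of_add_perm_eq {μ : YoungDiagram} (hμ : μ.colLen 0 ≤ n) {α : Fin n →₀ ℕ}
    {w : Equiv.Perm (Fin n)} (h : ∀ i, α i + w i = expo n μ i + i) :
    DominanceLE μ (shape α) ∧ (μ = shape α → w = 1) := by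
  -- On the last `k` positions `w` sums to at most what the identity does, so the first `k` parts of
  -- `μ` sum to at most the corresponding `α_i`, hence to at most the first `k` parts of `shape α`.
  -- If `μ = shape α`, all these inequalities are equalities and `w = 1`.
  have hsum : ∀ k, ∑ i ∈ lastSet n k, α i + ∑ i ∈ lastSet n k, (w i : ℕ) =
      ∑ i ∈ lastSet n k, expo n μ i + ∑ i ∈ lastSet n k, (i : ℕ) := fun k => by
    rw [← Finset.sum_add_distrib, ← Finset.sum_add_distrib]
    exact Finset.sum_congr rfl fun i _ => h i
  have hexpo : ∀ k ≤ n, ∑ i ∈ lastSet n k, expo n μ i = ∑ j ∈ Finset.range k, μ.rowLen j :=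
    fun k hk => sum_lastSet hk μ.rowLen
  have hα : ∀ k ≤ n, ∑ i ∈ lastSet n k, α i ≤ ∑ j ∈ Finset.range k, (shape α).rowLen j :=
    fun k hk => by simpa [card_lastSet hk] using sum_le_sum_rowLen_shape α (lastSet n k)
  have hcard : μ.card = (shape α).card := by
    rw [card_shape, ← degree_expo hμ, Finsupp.degree_eq_sum, Finsupp.degree_eq_sum]
    have h1 : ∑ i, α i + ∑ i, (w i : ℕ) = ∑ i, expo n μ i + ∑ i : Fin n, (i : ℕ) := by
      rw [← Finset.sum_add_distrib, ← Finset.sum_add_distrib]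
      exact Finset.sum_congr rfl fun i _ => h i
    have h2 : ∑ i, (w i : ℕ) = ∑ i : Fin n, (i : ℕ) := Equiv.sum_comp w fun i => (i : ℕ)
    omega
  refine ⟨⟨hcard, fun k => ?_⟩, fun hμα => eq_one_of_sum_lastSet fun k hk => ?_⟩
  · by_cases hk : k ≤ n
    · have h1 := hsum k
      have h2 := hexpo k hk
      have h3 := hα k hk
      have h4 := sum_perm_lastSet_le w hk
      omega
    · have hk' : n ≤ k := by omega
      rw [← card_eq_sum_rowLen μ (hμ.trans hk'), hcard,
        ← card_eq_sum_rowLen _ ((colLen_shape_le α).trans hk')]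
  · have h1 := hsum k
    have h2 := hexpo k hk
    have h3 := hα k hk
    rw [← hμα] at h3
    omega

/-- A strictly increasing exponent vector is of the form `expo n μ + (0, 1, …, n - 1)`. -/
theorem exists_expo_add_of_strictMono {γ : Fin n → ℕ} (hγ : StrictMono γ) :
    ∃ μ : YoungDiagram, μ.colLen 0 ≤ n ∧ ∀ i, γ i = expo n μ i + i := by
  have hle : ∀ i : Fin n, (i : ℕ) ≤ γ i := fun i => by
    obtain ⟨i, hi⟩ := i
    induction i with
    | zero => simp
    | succ i ih =>
      have h1 := ih (by omega)
      have h2 : γ ⟨i, by omega⟩ < γ ⟨i + 1, hi⟩ := hγ (by simp)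
      simp only at h1 ⊢
      omega
  let β : Fin n →₀ ℕ := Finsupp.equivFunOnFinite.symm fun i => γ i - i
  have hβ : Monotone β := by
    have key : ∀ d : ℕ, ∀ i j : Fin n, (j : ℕ) = i + d → γ i + d ≤ γ j := by
      intro d
      induction d with
      | zero => intro i j hij; rw [Fin.ext (a := j) (b := i) (by omega)]; simp
      | succ d ih =>
        intro i j hij
        have h1 := ih i ⟨i + d, by omega⟩ rfl
        have h2 : γ ⟨i + d, by omega⟩ < γ j := hγ (by rw [Fin.lt_def]; simp only; omega)
        omega
    intro i j hij
    have hij' : (i : ℕ) ≤ j := hij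
    have := key (j - i) i j (by omega)
    have := hle i
    change γ i - i ≤ γ j - j
    omega
  refine ⟨shape β, colLen_shape_le β, fun i => ?_⟩
  rw [expo_shape_of_monotone hβ]
  change γ i = γ i - i + i
  have := hle i
  omega

end Partitions

/-! ### Triangular families -/

section Triangular

variable {K V Y ι : Type*} [Field K] [AddCommGroup V] [Module K V] [AddCommGroup Y] [Module K Y]

/-- The span of the vectors `m j` with `j` strictly below `i`. -/
def lowSpan (K : Type*) [Field K] [Module K V] (lt : ι → ι → Prop) (m : ι → V) (i : ι) :
    Submodule K V :=
  Submodule.span K (m '' {j | lt j i})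

theorem mem_lowSpan {lt : ι → ι → Prop} {m : ι → V} {i j : ι} (h : lt j i) :
    m j ∈ lowSpan K lt m i :=
  Submodule.subset_span ⟨j, h, rfl⟩

theorem lowSpan_le {lt : ι → ι → Prop} {m : ι → V} {i : ι} {S : Submodule K V}
    (h : ∀ j, lt j i → m j ∈ S) : lowSpan K lt m i ≤ S :=
  Submodule.span_le.2 (by rintro _ ⟨j, hj, rfl⟩; exact h j hj)

theorem lowSpan_mono {lt : ι → ι → Prop} (htrans : ∀ i j k, lt i j → lt j k → lt i k) {m : ι → V}
    {i j : ι} (h : lt j i) : lowSpan K lt m j ≤ lowSpan K lt m i :=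
  lowSpan_le fun k hk => mem_lowSpan (htrans k j i hk h)

/-- The inverse of a unitriangular change of basis is unitriangular, by induction on the rank `r`.
-/
theorem sub_mem_lowSpan_symm {lt : ι → ι → Prop} (htrans : ∀ i j k, lt i j → lt j k → lt i k)
    {r : ι → ℕ} (hr : ∀ i j, lt i j → r i < r j) {m P : ι → V}
    (hP : ∀ i, P i - m i ∈ lowSpan K lt m i) (i : ι) : m i - P i ∈ lowSpan K lt P i := by
  induction hi : r i using Nat.strong_induction_on generalizing i with
  | _ k ih =>
    subst hi
    rw [← neg_sub]
    refine Submodule.neg_mem _ (lowSpan_le (fun j hj => ?_) (hP i))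
    have h1 := lowSpan_mono htrans hj (ih (r j) (hr j i hj) j rfl)
    have h2 := Submodule.add_mem _ h1 (mem_lowSpan (K := K) (m := P) hj)
    rwa [sub_add_cancel] at h2

theorem lowSpan_eq {lt : ι → ι → Prop} (htrans : ∀ i j k, lt i j → lt j k → lt i k)
    {r : ι → ℕ} (hr : ∀ i j, lt i j → r i < r j) {m P : ι → V}
    (hP : ∀ i, P i - m i ∈ lowSpan K lt m i) (i : ι) : lowSpan K lt P i = lowSpan K lt m i := by
  refine le_antisymm (lowSpan_le fun j hj => ?_) (lowSpan_le fun j hj => ?_)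
  · have := Submodule.add_mem _ (lowSpan_mono htrans hj (hP j)) (mem_lowSpan (m := m) hj)
    rwa [sub_add_cancel] at this
  · have := Submodule.add_mem _ (lowSpan_mono htrans hj (sub_mem_lowSpan_symm htrans hr hP j))
      (mem_lowSpan (m := P) hj)
    rwa [sub_add_cancel] at this

/-- A triangular pencil of operators with separated diagonal entries has a unitriangular family
of generalised eigenvectors. -/
theorem exists_eigenvector {lt : ι → ι → Prop} (htrans : ∀ i j k, lt i j → lt j k → lt i k)
    {r : ι → ℕ} (hr : ∀ i j, lt i j → r i < r j) {m : ι → V} {J D : V →ₗ[K] Y} {e : ι → K}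
    (hD : ∀ i, D (m i) - e i • J (m i) ∈ (lowSpan K lt m i).map J) (i : ι)
    (he : ∀ j, lt j i → e j ≠ e i) :
    ∃ p, p - m i ∈ lowSpan K lt m i ∧ D p = e i • J p := by
  -- On the span of the vectors below `i` the operator `D - e i • J` is triangular with nonzero
  -- diagonal entries `e j - e i`, so its image contains all of `J (lowSpan)`. The correction to `m
  -- i` is then obtained by solving one such equation.
  have key : ∀ j, lt j i → ∃ h ∈ lowSpan K lt m i, D h - e i • J h = J (m j) := by
    intro j
    induction hj : r j using Nat.strong_induction_on generalizing j with
    | _ k ih =>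
      subst hj
      intro hji
      have hle : lowSpan K lt m j ≤
          ((lowSpan K lt m i).map (D - e i • J)).comap J := lowSpan_le fun k hk => by
        obtain ⟨h, hh, hh'⟩ := ih (r k) (hr k j hk) k rfl (htrans k j i hk hji)
        exact ⟨h, hh, by simpa using hh'⟩
      obtain ⟨f, hf, hf'⟩ := hD j
      obtain ⟨h, hh, hh'⟩ := hle hf
      have hne : e j - e i ≠ 0 := sub_ne_zero.2 (he j hji)
      refine ⟨(e j - e i)⁻¹ • (m j - h), Submodule.smul_mem _ _
        (Submodule.sub_mem _ (mem_lowSpan hji) hh), ?_⟩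
      have h1 : D (m j) = e j • J (m j) + J f := by rw [hf']; abel
      have h2 : D h = e i • J h + J f := by
        rw [← hh']; simp
      rw [map_smul, map_smul, map_sub, map_sub, h1, h2, smul_comm (e i), ← smul_sub]
      rw [show e j • J (m j) + J f - (e i • J h + J f) - e i • (J (m j) - J h) =
        (e j - e i) • J (m j) by module, smul_smul, inv_mul_cancel₀ hne, one_smul]
  have hle : lowSpan K lt m i ≤ ((lowSpan K lt m i).map (D - e i • J)).comap J :=
    lowSpan_le fun j hj => by
      obtain ⟨h, hh, hh'⟩ := key j hj
      exact ⟨h, hh, by simpa using hh'⟩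
  obtain ⟨f, hf, hf'⟩ := hD i
  obtain ⟨h, hh, hh'⟩ := hle hf
  refine ⟨m i - h, by simpa using hh, ?_⟩
  have h1 : D (m i) = e i • J (m i) + J f := by rw [hf']; abel
  have h2 : D h = e i • J h + J f := by rw [← hh']; simp
  rw [map_sub, map_sub, h1, h2]
  module

/-- In a linear relation choose an index of maximal rank with nonzero coefficient; the coordinate
functional of `m` at that index annihilates all the other terms. -/
theorem linearIndependent_of_triangular {lt : ι → ι → Prop} {r : ι → ℕ}
    (hr : ∀ i j, lt i j → r i < r j) {m P : ι → V} (hm : LinearIndependent K m)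
    (hP : ∀ i, P i - m i ∈ lowSpan K lt m i) : LinearIndependent K P := by
  classical
  obtain ⟨φ, hφ⟩ : ∃ φ : ι → (V →ₗ[K] K), ∀ i j, φ i (m j) = if i = j then 1 else 0 := by
    obtain ⟨g, hg⟩ := hm.repr.exists_extend
    refine ⟨fun i => (Finsupp.lapply i).comp g, fun i j => ?_⟩
    have h1 : g (m j) = hm.repr ⟨m j, Submodule.subset_span ⟨j, rfl⟩⟩ := by
      rw [← hg]; rfl
    rw [LinearMap.comp_apply, h1, hm.repr_eq_single j _ rfl, Finsupp.lapply_apply,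
      Finsupp.single_apply]
    simp [eq_comm]
  have hφP : ∀ i j, ¬ lt i j → φ i (P j) = if i = j then 1 else 0 := fun i j hij => by
    rw [← hφ i j, ← sub_eq_zero, ← map_sub]
    have : lowSpan K lt m j ≤ LinearMap.ker (φ i) := lowSpan_le fun k hk => by
      rw [LinearMap.mem_ker, hφ, if_neg]
      rintro rfl
      exact hij hk
    exact this (hP j)
  rw [linearIndependent_iff']
  intro s c hc
  by_contra! hcon
  obtain ⟨i₀, hi₀, hci₀⟩ := hcon
  obtain ⟨i, hi, hmax⟩ := Finset.exists_max_image (s.filter fun i => c i ≠ 0) r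
    ⟨i₀, Finset.mem_filter.2 ⟨hi₀, hci₀⟩⟩
  rw [Finset.mem_filter] at hi
  have h := congrArg (φ i) hc
  rw [map_sum, map_zero, Finset.sum_eq_single i] at h
  · rw [map_smul, hφP i i fun h => lt_irrefl _ (hr i i h)] at h
    simp at h
    exact hi.2 h
  · intro j hj hji
    rw [map_smul]
    by_cases hcj : c j = 0
    · simp [hcj]
    · rw [hφP i j, if_neg (Ne.symm hji), smul_zero]
      intro hlt
      have := hmax j (Finset.mem_filter.2 ⟨hj, hcj⟩)
      have := hr i j hlt
      omega
  · exact fun h => absurd hi.1 h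

end Triangular

/-! ### Symmetric and alternating polynomials, and Macdonald's operators -/

section Operators

open MvPolynomial

variable {K : Type*} [Field K] {n : ℕ}

theorem finite_shape_eq (n : ℕ) (μ : YoungDiagram) : {α : Fin n →₀ ℕ | shape α = μ}.Finite := by
  refine (Set.finite_range fun w : Equiv.Perm (Fin n) => permExpo w (expo n μ)).subset ?_
  rintro α rfl
  obtain ⟨w, hw⟩ := exists_permExpo_eq_expo α
  exact ⟨w⁻¹, by ext i; simp [← hw]⟩

/-- The monomial symmetric polynomial `m_μ` in `n` variables. -/
def mono (K : Type*) [Field K] (n : ℕ) (μ : YoungDiagram) : MvPolynomial (Fin n) K :=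
  ∑ α ∈ (finite_shape_eq n μ).toFinset, monomial α 1

open Classical in
theorem coeff_mono (α : Fin n →₀ ℕ) (μ : YoungDiagram) :
    (mono K n μ).coeff α = if shape α = μ then 1 else 0 := by
  rw [mono, coeff_sum]
  simp only [coeff_monomial]
  rw [Finset.sum_ite_eq']
  simp

theorem coeff_expo_mono {μ ν : YoungDiagram} (hμ : μ.colLen 0 ≤ n) [Decidable (μ = ν)] :
    (mono K n ν).coeff (expo n μ) = if μ = ν then 1 else 0 := by
  rw [coeff_mono, shape_expo hμ]
  congr

theorem mono_eq_zero {μ : YoungDiagram} (h : n < μ.colLen 0) : mono K n μ = 0 := by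
  ext α
  rw [coeff_mono, if_neg, coeff_zero]
  rintro rfl
  exact absurd (colLen_shape_le α) (not_le.2 h)

/-- Invariance of the coefficients under permutations of the variables. -/
def CoeffSymm (f : MvPolynomial (Fin n) K) : Prop :=
  ∀ (w : Equiv.Perm (Fin n)) (α : Fin n →₀ ℕ), f.coeff (permExpo w α) = f.coeff α

/-- Skew-invariance of the coefficients under permutations of the variables. -/
def CoeffAlt (f : MvPolynomial (Fin n) K) : Prop :=
  ∀ (w : Equiv.Perm (Fin n)) (α : Fin n →₀ ℕ),
    f.coeff (permExpo w α) = ((Equiv.Perm.sign w : ℤ) : K) * f.coeff α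

theorem coeffSymm_mono (μ : YoungDiagram) : CoeffSymm (mono K n μ) := fun w α => by
  classical
  rw [coeff_mono, coeff_mono, shape_permExpo]

theorem coeffSymm_of_isSymmetric {f : MvPolynomial (Fin n) K} (hf : f.IsSymmetric) :
    CoeffSymm f := fun w α => by
  have h : permExpo w α = Finsupp.mapDomain w.symm α := by
    ext i
    simp
  rw [h]
  conv_lhs => rw [← hf w.symm]
  rw [coeff_rename_mapDomain _ w.symm.injective]

theorem isSymmetric_of_coeffSymm {f : MvPolynomial (Fin n) K} (hf : CoeffSymm f) :
    f.IsSymmetric := fun w => by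
  ext α
  have h : α = Finsupp.mapDomain w (permExpo w α) := by
    ext i
    simp
  conv_lhs => rw [h]
  rw [coeff_rename_mapDomain _ w.injective, hf]

theorem CoeffSymm.coeff_eq {f : MvPolynomial (Fin n) K} (hf : CoeffSymm f) (α : Fin n →₀ ℕ) :
    f.coeff α = f.coeff (expo n (shape α)) := by
  obtain ⟨w, hw⟩ := exists_permExpo_eq_expo α
  rw [← hw, hf]

theorem CoeffSymm.eq_sum_mono {f : MvPolynomial (Fin n) K} (hf : CoeffSymm f) {d : ℕ}
    (hd : f.IsHomogeneous d) :
    f = ∑ μ ∈ partitionsLE n d, f.coeff (expo n μ) • mono K n μ := by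
  classical
  ext α
  rw [coeff_sum]
  simp only [coeff_smul, coeff_mono, smul_eq_mul, mul_ite, mul_one, mul_zero]
  rw [Finset.sum_ite_eq, hf.coeff_eq α]
  split_ifs with h
  · rfl
  · rw [← hf.coeff_eq α]
    by_contra hne
    refine h (mem_partitionsLE.2 ⟨?_, colLen_shape_le α⟩)
    rw [card_shape]
    by_contra hdeg
    exact hne (hd.coeff_eq_zero hdeg)

theorem CoeffAlt.sub {f g : MvPolynomial (Fin n) K} (hf : CoeffAlt f) (hg : CoeffAlt g) :
    CoeffAlt (f - g) := fun w α => by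
  rw [coeff_sub, coeff_sub, hf, hg, mul_sub]

theorem CoeffAlt.smul {f : MvPolynomial (Fin n) K} (hf : CoeffAlt f) (c : K) :
    CoeffAlt (c • f) := fun w α => by
  rw [coeff_smul, coeff_smul, hf, smul_eq_mul, smul_eq_mul, mul_left_comm]

theorem CoeffAlt.sum {ι : Type*} {s : Finset ι} {f : ι → MvPolynomial (Fin n) K}
    (hf : ∀ i ∈ s, CoeffAlt (f i)) : CoeffAlt (∑ i ∈ s, f i) := fun w α => by
  rw [coeff_sum, coeff_sum, Finset.mul_sum]
  exact Finset.sum_congr rfl fun i hi => hf i hi w α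

/-- The exponent vector `i ↦ w i` of a permutation `w`. -/
def delta (w : Equiv.Perm (Fin n)) : Fin n →₀ ℕ :=
  Finsupp.equivFunOnFinite.symm fun i => (w i : ℕ)

@[simp]
theorem delta_apply (w : Equiv.Perm (Fin n)) (i : Fin n) : delta w i = (w i : ℕ) := rfl

/-- Exponents with a repeated entry have zero coefficient, by a transposition; distinct exponents
can be sorted, and strictly increasing ones are exactly the vectors `μ + (0, 1, …, n - 1)`. -/
theorem CoeffAlt.eq_zero [CharZero K] {f : MvPolynomial (Fin n) K} (hf : CoeffAlt f)
    (h : ∀ μ : YoungDiagram, μ.colLen 0 ≤ n → f.coeff (expo n μ + delta 1) = 0) : f = 0 := by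
  ext γ
  rw [coeff_zero]
  by_cases hinj : Function.Injective γ
  · have hsm : StrictMono (γ ∘ Tuple.sort γ) :=
      (Tuple.monotone_sort γ).strictMono_of_injective (hinj.comp (Equiv.injective _))
    obtain ⟨μ, hμ, hγ⟩ := exists_expo_add_of_strictMono hsm
    have h1 : permExpo (Tuple.sort γ) γ = expo n μ + delta 1 := by
      ext i
      exact hγ i
    have h2 := hf (Tuple.sort γ) γ
    rw [h1, h μ hμ, eq_comm, mul_eq_zero] at h2
    refine h2.resolve_left ?_
    rcases Int.units_eq_one_or (Equiv.Perm.sign (Tuple.sort γ)) with h | h <;> simp [h]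
  · simp only [Function.Injective, not_forall] at hinj
    obtain ⟨i, j, hij, hne⟩ := hinj
    have h1 := hf (Equiv.swap i j) γ
    have h2 : permExpo (Equiv.swap i j) γ = γ := by
      ext k
      rw [permExpo_apply]
      rcases eq_or_ne k i with rfl | hki
      · rw [Equiv.swap_apply_left, hij]
      · rcases eq_or_ne k j with rfl | hkj
        · rw [Equiv.swap_apply_right, hij]
        · rw [Equiv.swap_apply_of_ne_of_ne hki hkj]
    rw [h2, Equiv.Perm.sign_swap hne] at h1
    simp only [Units.val_neg, Units.val_one, Int.cast_neg, Int.cast_one, neg_mul, one_mul] at h1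
    exact self_eq_neg.1 h1

/-- The substitution `z_s ↦ c_s z_s`. -/
def scaleHom {σ : Type*} (c : σ → K) : MvPolynomial σ K →ₐ[K] MvPolynomial σ K :=
  aeval fun s => C (c s) * X s

theorem scaleHom_monomial {σ : Type*} (c : σ → K) (α : σ →₀ ℕ) (a : K) :
    scaleHom c (monomial α a) = monomial α ((α.prod fun s k => c s ^ k) * a) := by
  rw [scaleHom, aeval_monomial, monomial_eq (a := _ * a)]
  simp only [mul_pow, Finsupp.prod_mul, ← C_pow]
  rw [algebraMap_eq, C_mul, Finsupp.prod, Finsupp.prod, Finsupp.prod, map_prod]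
  ring

theorem coeff_scaleHom {σ : Type*} (c : σ → K) (α : σ →₀ ℕ) (f : MvPolynomial σ K) :
    (scaleHom c f).coeff α = (α.prod fun s k => c s ^ k) * f.coeff α := by
  classical
  induction f using MvPolynomial.induction_on' with
  | monomial β a =>
    rw [scaleHom_monomial, coeff_monomial, coeff_monomial]
    split_ifs with h
    · rw [h]
    · rw [mul_zero]
  | add f g hf hg => rw [map_add, coeff_add, coeff_add, hf, hg, mul_add]

open Classical in
/-- The simultaneous `q`-shift of the variables `z_{x i}`, `i ∈ I`. -/
def shiftHom {σ : Type*} (q : K) (x : Fin n → σ) (I : Finset (Fin n)) :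
    MvPolynomial σ K →ₐ[K] MvPolynomial σ K :=
  scaleHom fun s => if ∃ i ∈ I, x i = s then q else 1

/-- Macdonald's operator `∑ w, ε(w) ∏ i, x_i ^ w(i) (1 + X t ^ w(i) T_{q,x_i})`, that is the
product of the Vandermonde determinant and of the generating function of Macdonald's
`q`-difference operators. -/
def macOp {σ : Type*} (q t X : K) (x : Fin n → σ) : MvPolynomial σ K →ₗ[K] MvPolynomial σ K :=
  ∑ w : Equiv.Perm (Fin n), ((Equiv.Perm.sign w : ℤ) : K) •
    (LinearMap.mulLeft K (∏ i, MvPolynomial.X (x i) ^ (w i : ℕ))).comp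
      (∑ I : Finset (Fin n), (X ^ I.card * t ^ (∑ i ∈ I, (w i : ℕ))) • (shiftHom q x I).toLinearMap)

theorem macOp_apply {σ : Type*} (q t X : K) (x : Fin n → σ) (f : MvPolynomial σ K) :
    macOp q t X x f = ∑ w : Equiv.Perm (Fin n), ((Equiv.Perm.sign w : ℤ) : K) •
      ((∏ i, MvPolynomial.X (x i) ^ (w i : ℕ)) * ∑ I : Finset (Fin n),
        (X ^ I.card * t ^ (∑ i ∈ I, (w i : ℕ))) • shiftHom q x I f) := by
  simp only [macOp, LinearMap.sum_apply, LinearMap.smul_apply, LinearMap.comp_apply,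
    LinearMap.mulLeft_apply, AlgHom.toLinearMap_apply]

/-- The factor by which the operator multiplies the coefficient of `x ^ α` before the
multiplication by `x ^ w`. -/
def opFactor (q t X : K) (w : Equiv.Perm (Fin n)) (α : Fin n →₀ ℕ) : K :=
  ∏ i, (1 + X * t ^ (w i : ℕ) * q ^ α i)

/-- The `q`-shifts are diagonal on monomials, so the sum over subsets `I` is the expansion of a
product over the variables. -/
theorem coeff_sum_shiftHom (q t X : K) (w : Equiv.Perm (Fin n)) (α : Fin n →₀ ℕ)
    (f : MvPolynomial (Fin n) K) :
    (∑ I : Finset (Fin n), (X ^ I.card * t ^ (∑ i ∈ I, (w i : ℕ))) • shiftHom q id I f).coeff α =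
      opFactor q t X w α * f.coeff α := by
  classical
  rw [coeff_sum, opFactor, Finset.prod_one_add, Finset.powerset_univ, Finset.sum_mul]
  refine Finset.sum_congr rfl fun I _ => ?_
  rw [coeff_smul, shiftHom, coeff_scaleHom, smul_eq_mul, ← mul_assoc]
  congr 1
  rw [Finsupp.prod_fintype _ _ (fun i => pow_zero _), Finset.prod_mul_distrib,
    Finset.prod_mul_distrib, Finset.prod_const, Finset.prod_pow_eq_pow_sum]
  congr 1
  simp [ite_pow, Finset.prod_ite_mem]

theorem prod_X_pow_eq (w : Equiv.Perm (Fin n)) :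
    (∏ i, MvPolynomial.X (id i) ^ (w i : ℕ) : MvPolynomial (Fin n) K) = monomial (delta w) 1 := by
  rw [monomial_eq, C_1, one_mul, Finsupp.prod_fintype _ _ (fun i => pow_zero _)]
  rfl

open Classical in
theorem coeff_macOp (q t X : K) (f : MvPolynomial (Fin n) K) (γ : Fin n →₀ ℕ) :
    (macOp q t X id f).coeff γ = ∑ w : Equiv.Perm (Fin n), ((Equiv.Perm.sign w : ℤ) : K) *
      (if delta w ≤ γ then opFactor q t X w (γ - delta w) * f.coeff (γ - delta w) else 0) := by
  rw [macOp_apply, coeff_sum]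
  refine Finset.sum_congr rfl fun w _ => ?_
  rw [coeff_smul, smul_eq_mul, prod_X_pow_eq, coeff_monomial_mul', coeff_sum_shiftHom, one_mul]

/-- Permuting the variables by `v` amounts to the reindexing `w ↦ w * v` of the sum, which costs the
sign of `v`. -/
theorem coeffAlt_macOp (q t X : K) {f : MvPolynomial (Fin n) K} (hf : CoeffSymm f) :
    CoeffAlt (macOp q t X id f) := fun v γ => by
  classical
  rw [coeff_macOp, coeff_macOp, Finset.mul_sum]
  refine (Fintype.sum_equiv (Equiv.mulRight v) _ _ fun w => ?_).symm
  have h1 : delta (w * v) = permExpo v (delta w) := by ext i; simp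
  have h2 : delta (w * v) ≤ permExpo v γ ↔ delta w ≤ γ := by
    rw [h1]
    refine ⟨fun h i => ?_, fun h i => h (v i)⟩
    simpa using h (v⁻¹ i)
  have h3 : permExpo v γ - delta (w * v) = permExpo v (γ - delta w) := by
    rw [h1]; ext i; simp
  have h4 : opFactor q t X (w * v) (permExpo v (γ - delta w)) =
      opFactor q t X w (γ - delta w) := by
    rw [opFactor, opFactor]
    exact Equiv.prod_comp v fun i => 1 + X * t ^ (w i : ℕ) * q ^ (γ - delta w) i
  rw [show (Equiv.mulRight v) w = w * v from rfl, h3, h4, hf, Equiv.Perm.sign_mul]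
  simp only [h2]
  push_cast
  ring

/-- The eigenvalue `∏ i, (1 + X t ^ (n - 1 - i) q ^ μ_i)` of Macdonald's operator. -/
def eigenval (q t X : K) (n : ℕ) (μ : YoungDiagram) : K :=
  ∏ i : Fin n, (1 + X * t ^ (i : ℕ) * q ^ expo n μ i)

theorem dominanceLE_of_coeff_macOp_ne_zero {q t X : K} {f : MvPolynomial (Fin n) K}
    {ν μ : YoungDiagram} (hf : ∀ α, f.coeff α ≠ 0 → DominanceLE (shape α) ν)
    (hμ : μ.colLen 0 ≤ n) (h : (macOp q t X id f).coeff (expo n μ + delta 1) ≠ 0) :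
    DominanceLE μ ν := by
  classical
  rw [coeff_macOp] at h
  obtain ⟨w, -, hw⟩ := Finset.exists_ne_zero_of_sum_ne_zero h
  have hle : delta w ≤ expo n μ + delta 1 := by
    by_contra hle
    simp [hle] at hw
  rw [if_pos hle] at hw
  refine (dominanceLE_of_add_perm_eq hμ (w := w) fun i => ?_).1.trans
    (hf _ (right_ne_zero_of_mul (right_ne_zero_of_mul hw)))
  have := hle i
  simp only [Finsupp.coe_add, Pi.add_apply, delta_apply, Equiv.Perm.one_apply] at this
  simp only [Finsupp.coe_tsub, Finsupp.coe_add, Pi.sub_apply, Pi.add_apply, delta_apply,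
    Equiv.Perm.one_apply]
  omega

/-- By the equality case of `dominanceLE_of_add_perm_eq` only the identity permutation reaches the
top exponent; this is the diagonal entry of the triangular operator. -/
theorem coeff_macOp_expo {q t X : K} {f : MvPolynomial (Fin n) K}
    {μ : YoungDiagram} (hf : ∀ α, f.coeff α ≠ 0 → DominanceLE (shape α) μ)
    (hμ : μ.colLen 0 ≤ n) :
    (macOp q t X id f).coeff (expo n μ + delta 1) = eigenval q t X n μ * f.coeff (expo n μ) := by
  classical
  rw [coeff_macOp, Finset.sum_eq_single 1]
  · rw [if_pos (by simp), add_tsub_cancel_right]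
    simp [opFactor, eigenval]
  · intro w _ hw
    split_ifs with hle
    · rw [mul_eq_zero, mul_eq_zero]
      right; right
      by_contra hne
      have key : ∀ i, (expo n μ + delta 1 - delta w : Fin n →₀ ℕ) i + w i = expo n μ i + i :=
          fun i => by
        have := hle i
        simp only [Finsupp.coe_add, Pi.add_apply, delta_apply, Equiv.Perm.one_apply] at this
        simp only [Finsupp.coe_tsub, Finsupp.coe_add, Pi.sub_apply, Pi.add_apply, delta_apply,
          Equiv.Perm.one_apply]
        omega
      have h := dominanceLE_of_add_perm_eq hμ key
      exact hw (h.2 (h.1.antisymm (hf _ hne)))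
    · simp
  · simp

/-- The partitions with at most `n` parts. -/
abbrev PartLE (n : ℕ) : Type := {μ : YoungDiagram // μ.colLen 0 ≤ n}

/-- Strict dominance order. -/
def DomLT (n : ℕ) (μ ν : PartLE n) : Prop := DominanceLE μ.1 ν.1 ∧ μ.1 ≠ ν.1

theorem DomLT.rank_lt (i j : PartLE n) (h : DomLT n i j) :
    dominanceRank i.1 < dominanceRank j.1 :=
  dominanceRank_lt h.1 h.2

/-- The monomial symmetric polynomials in `n` variables, as a family indexed by the partitions
with at most `n` parts. -/
def monoFam (K : Type*) [Field K] (n : ℕ) (μ : PartLE n) : MvPolynomial (Fin n) K := mono K n μ.1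

theorem linearIndependent_monoFam : LinearIndependent K (monoFam K n) := by
  classical
  rw [linearIndependent_iff']
  intro s c hc μ hμ
  have h := congrArg (coeff (expo n μ.1)) hc
  rw [coeff_sum, coeff_zero] at h
  simp only [monoFam, coeff_smul, coeff_expo_mono μ.2, smul_eq_mul, mul_ite, mul_one, mul_zero,
    ← Subtype.ext_iff] at h
  simpa [hμ] using h

/-- Multiplication by the Vandermonde determinant. -/
def vanderOp {σ : Type*} (K : Type*) [Field K] (x : Fin n → σ) :
    MvPolynomial σ K →ₗ[K] MvPolynomial σ K :=
  LinearMap.mulLeft K (Matrix.vandermonde fun i => (MvPolynomial.X (x i) : MvPolynomial σ K)).det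

/-- Only `I = ∅` survives at `X = 0`. Every fact about `macOp` thus specialises to multiplication by
the Vandermonde determinant, with diagonal entries `1`. -/
theorem macOp_zero {σ : Type*} (q t : K) (x : Fin n → σ) : macOp q t 0 x = vanderOp K x := by
  classical
  refine LinearMap.ext fun f => ?_
  rw [macOp_apply, vanderOp, LinearMap.mulLeft_apply, ← Matrix.det_transpose, Matrix.det_apply',
    Finset.sum_mul]
  refine Finset.sum_congr rfl fun w _ => ?_
  rw [Finset.sum_eq_single ∅]
  · have : shiftHom q x ∅ f = f := by
      ext α
      rw [shiftHom, coeff_scaleHom]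
      simp
    rw [this]
    simp [Algebra.smul_def, Matrix.vandermonde_apply, mul_assoc]
  · intro I _ hI
    rw [zero_pow (Finset.card_ne_zero.2 (Finset.nonempty_iff_ne_empty.2 hI))]
    simp
  · simp

theorem coeff_mono_ne_zero {α : Fin n →₀ ℕ} {μ : YoungDiagram} (h : (mono K n μ).coeff α ≠ 0) :
    DominanceLE (shape α) μ := by
  classical
  rw [coeff_mono] at h
  have : shape α = μ := by
    by_contra hne
    simp [hne] at h
  rw [this]
  exact dominanceLE_refl μ

/-- An alternating polynomial is the product of the Vandermonde determinant and of a combination of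
monomial symmetric polynomials, triangularly. -/
theorem CoeffAlt.mem_map_vanderOp [CharZero K] {ν : PartLE n} {g : MvPolynomial (Fin n) K}
    (hg : CoeffAlt g) (h : ∀ μ : PartLE n, g.coeff (expo n μ.1 + delta 1) ≠ 0 → DomLT n μ ν) :
    g ∈ (lowSpan K (DomLT n) (monoFam K n) ν).map (vanderOp K id) := by
  classical
  suffices H : ∀ N, ∀ g : MvPolynomial (Fin n) K, CoeffAlt g →
      (∀ μ : PartLE n, g.coeff (expo n μ.1 + delta 1) ≠ 0 →
        DomLT n μ ν ∧ dominanceRank μ.1 < N) →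
      g ∈ (lowSpan K (DomLT n) (monoFam K n) ν).map (vanderOp K id) from
    H (dominanceRank ν.1) g hg fun μ hμ => ⟨h μ hμ, (h μ hμ).rank_lt⟩
  intro N
  induction N with
  | zero =>
    intro g hg h
    rw [hg.eq_zero fun μ hμ => by_contra fun hne => by simpa using (h ⟨μ, hμ⟩ hne).2]
    exact Submodule.zero_mem _
  | succ N ih =>
    intro g hg h
    -- The coefficients of top rank `N` are removed by subtracting Vandermonde multiples of monomial
    -- symmetric polynomials; the remainder is alternating of smaller rank.
    let s : Finset YoungDiagram :=
      {μ ∈ partitionsLE n ν.1.card | dominanceRank μ = N ∧ DominanceLE μ ν.1 ∧ μ ≠ ν.1}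
    have hs : ∀ μ ∈ s, μ.colLen 0 ≤ n ∧ dominanceRank μ = N ∧ DominanceLE μ ν.1 ∧ μ ≠ ν.1 :=
      fun μ hμ => by
        simp only [s, Finset.mem_filter, mem_partitionsLE] at hμ
        exact ⟨hμ.1.2, hμ.2⟩
    let g₁ := ∑ μ ∈ s, g.coeff (expo n μ + delta 1) • macOp 0 0 0 id (mono K n μ)
    have hg₁ : g₁ ∈ (lowSpan K (DomLT n) (monoFam K n) ν).map (vanderOp K id) := by
      refine Submodule.sum_mem _ fun μ hμ => Submodule.smul_mem _ _ ?_
      rw [macOp_zero]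
      exact Submodule.mem_map_of_mem
        (mem_lowSpan (m := monoFam K n) (j := ⟨μ, (hs μ hμ).1⟩) (hs μ hμ).2.2)
    have hg₁' : CoeffAlt g₁ :=
      CoeffAlt.sum fun μ _ => (coeffAlt_macOp 0 0 0 (coeffSymm_mono μ)).smul _
    have hcoeff : ∀ κ : PartLE n, N ≤ dominanceRank κ.1 →
        g₁.coeff (expo n κ.1 + delta 1) =
          if κ.1 ∈ s then g.coeff (expo n κ.1 + delta 1) else 0 := by
      intro κ hκ
      have hterm : ∀ μ ∈ s, (g.coeff (expo n μ + delta 1) •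
          macOp 0 0 0 id (mono K n μ)).coeff (expo n κ.1 + delta 1) =
          if κ.1 = μ then g.coeff (expo n μ + delta 1) else 0 := by
        intro μ hμ
        rw [coeff_smul, smul_eq_mul]
        split_ifs with hκμ
        · rw [hκμ, coeff_macOp_expo (fun α => coeff_mono_ne_zero) (hs μ hμ).1,
            coeff_expo_mono (hs μ hμ).1]
          simp [eigenval]
        · rw [mul_eq_zero]
          right
          by_contra hne
          have h1 := dominanceLE_of_coeff_macOp_ne_zero (fun α => coeff_mono_ne_zero) κ.2 hne
          have h2 := dominanceRank_lt h1 hκμ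
          have h3 := (hs μ hμ).2.1
          omega
      rw [show g₁ = _ from rfl, coeff_sum, Finset.sum_congr rfl hterm, Finset.sum_ite_eq]
    rw [← sub_add_cancel g g₁]
    refine Submodule.add_mem _ (ih _ (hg.sub hg₁') fun κ hκ => ?_) hg₁
    rw [coeff_sub] at hκ
    by_cases hN : N ≤ dominanceRank κ.1
    · exfalso
      rw [hcoeff κ hN] at hκ
      split_ifs at hκ with hmem
      · simp at hκ
      · rw [sub_zero] at hκ
        obtain ⟨h1, h2⟩ := h κ hκ
        refine hmem ?_
        simp only [s, Finset.mem_filter, mem_partitionsLE]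
        exact ⟨⟨h1.1.1, κ.2⟩, by omega, h1⟩
    · refine ⟨?_, by omega⟩
      by_cases h0 : g.coeff (expo n κ.1 + delta 1) = 0
      · rw [h0, zero_sub, neg_ne_zero, show g₁ = _ from rfl, coeff_sum] at hκ
        obtain ⟨μ, hμ, hne⟩ := Finset.exists_ne_zero_of_sum_ne_zero hκ
        rw [coeff_smul, smul_eq_mul] at hne
        have h1 := dominanceLE_of_coeff_macOp_ne_zero (fun α => coeff_mono_ne_zero) κ.2
          (right_ne_zero_of_mul hne)
        refine ⟨h1.trans (hs μ hμ).2.2.1, fun he => ?_⟩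
        exact (hs μ hμ).2.2.2 ((hs μ hμ).2.2.1.antisymm (he ▸ h1))
      · exact (h κ h0).1

/-- Triangularity of Macdonald's operators. -/
theorem macOp_mono_sub_mem [CharZero K] (q t X : K) (ν : PartLE n) :
    macOp q t X id (monoFam K n ν) - eigenval q t X n ν.1 • vanderOp K id (monoFam K n ν) ∈
      (lowSpan K (DomLT n) (monoFam K n) ν).map (vanderOp K id) := by
  classical
  have hv : vanderOp K id (monoFam K n ν) = macOp 0 0 0 id (monoFam K n ν) := by rw [macOp_zero]
  rw [hv]
  have hs : CoeffSymm (monoFam K n ν) := coeffSymm_mono ν.1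
  refine CoeffAlt.mem_map_vanderOp ((coeffAlt_macOp q t X hs).sub
    ((coeffAlt_macOp 0 0 0 hs).smul _)) fun μ hμ => ?_
  rw [coeff_sub, coeff_smul, smul_eq_mul] at hμ
  have hne : μ.1 ≠ ν.1 := by
    intro he
    rw [he, monoFam, coeff_macOp_expo (fun α => coeff_mono_ne_zero) ν.2,
      coeff_macOp_expo (fun α => coeff_mono_ne_zero) ν.2] at hμ
    simp [eigenval] at hμ
  refine ⟨?_, hne⟩
  by_cases h0 : (macOp q t X id (monoFam K n ν)).coeff (expo n μ.1 + delta 1) = 0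
  · rw [h0, zero_sub, neg_ne_zero] at hμ
    have h1 := right_ne_zero_of_mul hμ
    exact dominanceLE_of_coeff_macOp_ne_zero (fun α => coeff_mono_ne_zero) μ.2 h1
  · exact dominanceLE_of_coeff_macOp_ne_zero (fun α => coeff_mono_ne_zero) μ.2 h0

end Operators

/-! ### Power sums -/

section PowerSums

open MvPolynomial

/-- The kernels of the powers of `f` stabilise, say at `k`. An element of `ker f` is `f ^ k` of some
`b`; then `b` lies in the kernel of `f ^ (k + 1)`, hence in that of `f ^ k`. -/
theorem injective_of_surjective_of_isNoetherianRing {R : Type*} [CommRing R] [IsNoetherianRing R]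
    (f : R →+* R) (hf : Function.Surjective f) : Function.Injective f := by
  let F : ℕ →o Ideal R :=
    ⟨fun k => RingHom.ker (f ^ k), monotone_nat_of_le_succ fun k a ha => by
      rw [RingHom.mem_ker] at ha ⊢
      rw [pow_succ', RingHom.mul_def, RingHom.comp_apply, ha, map_zero]⟩
  obtain ⟨k, hk⟩ := monotone_stabilizes_iff_noetherian.2 ‹IsNoetherianRing R› F
  have hsurj : ∀ k : ℕ, Function.Surjective (f ^ k) := fun k => by
    induction k with
    | zero => exact fun a => ⟨a, by simp⟩
    | succ k ih => rw [pow_succ, RingHom.mul_def, RingHom.coe_comp]; exact ih.comp hf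
  rw [injective_iff_map_eq_zero]
  intro a ha
  obtain ⟨b, rfl⟩ := hsurj k a
  have hb : b ∈ F (k + 1) := by
    change (f ^ (k + 1)) b = 0
    rw [pow_succ', RingHom.mul_def, RingHom.comp_apply, ha]
  rw [← hk (k + 1) (Nat.le_succ k)] at hb
  exact hb

variable {K : Type*} [Field K]

/-- The weight on `SymFun K` for which `p_k` has degree `k`. -/
def pwt (k : ℕ+) : ℕ := k

/-- The value of a symmetric function in `n` variables. -/
def ev (K : Type*) [Field K] (n : ℕ) : SymFun K →ₐ[K] MvPolynomial (Fin n) K :=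
  aeval fun k : ℕ+ => psum (Fin n) K k

theorem isSymmetric_ev {n : ℕ} (f : SymFun K) : (ev K n f).IsSymmetric := by
  rw [← mem_symmetricSubalgebra]
  have : aeval (fun k : ℕ+ => (⟨psum (Fin n) K k, psum_isSymmetric _ _ _⟩ :
      symmetricSubalgebra (Fin n) K)) f ∈ (⊤ : Subalgebra K _) := trivial
  have h : ev K n = (symmetricSubalgebra (Fin n) K).val.comp
      (aeval fun k : ℕ+ => ⟨psum (Fin n) K k, psum_isSymmetric _ _ _⟩) := by
    refine algHom_ext fun k => ?_
    simp [ev]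
  rw [h]
  exact Subtype.coe_prop _

theorem coeffSymm_ev {n : ℕ} (f : SymFun K) : CoeffSymm (ev K n f) :=
  coeffSymm_of_isSymmetric (isSymmetric_ev f)

theorem isHomogeneous_psum (n k : ℕ) : (psum (Fin n) K k).IsHomogeneous k := by
  rw [psum]
  exact IsHomogeneous.sum _ _ _ fun i _ => isHomogeneous_X_pow _ _

theorem isHomogeneous_ev_monomial (n : ℕ) (α : ℕ+ →₀ ℕ) (a : K) :
    (ev K n (monomial α a)).IsHomogeneous (Finsupp.weight pwt α) := by
  rw [ev, aeval_monomial, Finsupp.weight_apply, ← zero_add (Finsupp.sum _ _)]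
  refine (isHomogeneous_C _ a).mul ?_
  refine IsHomogeneous.prod _ _ _ fun k _ => ?_
  change (psum (Fin n) K k ^ α k).IsHomogeneous (α k * k)
  rw [mul_comm]
  exact (isHomogeneous_psum n k).pow _

theorem ev_weightedHomogeneousComponent (n d : ℕ) (f : SymFun K) :
    ev K n (weightedHomogeneousComponent pwt d f) = homogeneousComponent d (ev K n f) := by
  induction f using MvPolynomial.induction_on' with
  | monomial α a =>
    rw [weightedHomogeneousComponent_of_mem
        ((mem_weightedHomogeneousSubmodule _ _ _ _).2 (isWeightedHomogeneous_monomial pwt α a rfl)),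
      homogeneousComponent_of_mem
        ((mem_homogeneousSubmodule _ _).2 (isHomogeneous_ev_monomial n α a))]
    split_ifs <;> simp
  | add f g hf hg => rw [map_add, map_add, map_add, map_add, hf, hg]

theorem isHomogeneous_ev {n d : ℕ} {f : SymFun K} (hf : IsWeightedHomogeneous pwt f d) :
    (ev K n f).IsHomogeneous d := by
  rw [← hf.weightedHomogeneousComponent_same, ev_weightedHomogeneousComponent]
  exact homogeneousComponent_isHomogeneous _ _

/-- The labels `1, …, n` of the first power sums. -/
def firstLabels (n : ℕ) (i : Fin n) : ℕ+ := ⟨(i : ℕ) + 1, Nat.succ_pos _⟩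

theorem firstLabels_injective (n : ℕ) : Function.Injective (firstLabels n) := fun i j h => by
  have := congrArg PNat.val h
  simp only [firstLabels, PNat.mk_coe] at this
  exact Fin.ext (by omega)

theorem mem_range_firstLabels {n : ℕ} {k : ℕ+} (h : (k : ℕ) ≤ n) :
    k ∈ Set.range (firstLabels n) := by
  have := k.pos
  exact ⟨⟨(k : ℕ) - 1, by omega⟩, PNat.eq (by simp [firstLabels]; omega)⟩

/-- Newton's identities express `k e_k` through power sums and smaller `e_j`, and `k` is invertible.
-/
theorem esymm_mem_range [CharZero K] (n k : ℕ) (hk : k ≤ n) :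
    esymm (Fin n) K k ∈ ((ev K n).comp (rename (firstLabels n))).range := by
  induction k using Nat.strong_induction_on with
  | _ k ih =>
    rcases Nat.eq_zero_or_pos k with rfl | hpos
    · rw [esymm_zero]; exact Subalgebra.one_mem _
    have hk0 : (k : K) ≠ 0 := by exact_mod_cast hpos.ne'
    have h := mul_esymm_eq_sum (Fin n) K k
    have h' : esymm (Fin n) K k =
        (k : K)⁻¹ • ((k : MvPolynomial (Fin n) K) * esymm (Fin n) K k) := by
      rw [smul_eq_C_mul, ← mul_assoc, ← map_natCast (C : K →+* MvPolynomial (Fin n) K), ← C_mul,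
        inv_mul_cancel₀ hk0, C_1, one_mul]
    rw [h', h]
    refine Subalgebra.smul_mem _ (Subalgebra.mul_mem _ ?_ (Subalgebra.sum_mem _ fun a ha => ?_)) _
    · exact Subalgebra.pow_mem _ (Subalgebra.neg_mem _ (Subalgebra.one_mem _)) _
    rw [Finset.mem_filter, Finset.HasAntidiagonal.mem_antidiagonal] at ha
    refine Subalgebra.mul_mem _ (Subalgebra.mul_mem _ ?_ (ih _ ha.2 (by omega))) ?_
    · exact Subalgebra.pow_mem _ (Subalgebra.neg_mem _ (Subalgebra.one_mem _)) _
    · refine ⟨X ⟨a.2 - 1, by omega⟩, ?_⟩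
      have : a.2 - 1 + 1 = a.2 := by omega
      change ev K n (rename (firstLabels n) (X _)) = _
      rw [rename_X, ev, aeval_X]
      simp [firstLabels, this]

theorem exists_ev_eq [CharZero K] {n : ℕ} {g : MvPolynomial (Fin n) K} (hg : g.IsSymmetric) :
    ∃ f : MvPolynomial (Fin n) K, ev K n (rename (firstLabels n) f) = g := by
  obtain ⟨h, hh⟩ := esymmAlgHom_surjective (σ := Fin n) K (n := n) (by simp) ⟨g, hg⟩
  have hle : ((symmetricSubalgebra (Fin n) K).val.comp (esymmAlgHom (Fin n) K n)).range ≤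
      ((ev K n).comp (rename (firstLabels n))).range := by
    rintro _ ⟨f, rfl⟩
    induction f using MvPolynomial.induction_on with
    | C a => exact ⟨C a, by simp⟩
    | add f g hf hg =>
      rw [map_add]
      exact Subalgebra.add_mem _ hf hg
    | mul_X f i hf =>
      rw [map_mul]
      refine Subalgebra.mul_mem _ hf ?_
      have : ((symmetricSubalgebra (Fin n) K).val.comp (esymmAlgHom (Fin n) K n)) (X i) =
          esymm (Fin n) K (i + 1) := by
        simp [esymmAlgHom]
      exact this ▸ esymm_mem_range n _ (by omega)
  obtain ⟨f, hf⟩ := hle ⟨h, rfl⟩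
  refine ⟨f, ?_⟩
  simpa [hh] using hf

/-- Algebraic independence of `p_1, …, p_n` in `n` variables. They generate the symmetric
polynomials, which form a polynomial ring in `e_1, …, e_n`, so they define a surjective endomorphism
of a Noetherian ring. -/
theorem ev_rename_injective [CharZero K] (n : ℕ) :
    Function.Injective ((ev K n).comp (rename (firstLabels n))) := by
  let φ : MvPolynomial (Fin n) K →ₐ[K] symmetricSubalgebra (Fin n) K :=
    ((ev K n).comp (rename (firstLabels n))).codRestrict _ fun f => isSymmetric_ev _
  have hφ : Function.Surjective φ := fun ⟨g, hg⟩ => by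
    obtain ⟨f, hf⟩ := exists_ev_eq hg
    exact ⟨f, Subtype.ext hf⟩
  let ψ : MvPolynomial (Fin n) K →ₐ[K] MvPolynomial (Fin n) K :=
    ((esymmAlgEquiv (Fin n) K (Fintype.card_fin n)).symm.toAlgHom).comp φ
  have hψ : Function.Surjective ψ :=
    (esymmAlgEquiv (Fin n) K (Fintype.card_fin n)).symm.surjective.comp hφ
  have hinj := injective_of_surjective_of_isNoetherianRing ψ.toRingHom hψ
  intro f g hfg
  refine hinj ?_
  have : φ f = φ g := Subtype.ext hfg
  change ψ f = ψ g
  simp only [ψ, AlgHom.comp_apply, this]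

theorem ev_eq_zero_of_vars [CharZero K] {n : ℕ} {f : SymFun K} (hf : ∀ k ∈ f.vars, (k : ℕ) ≤ n)
    (h : ev K n f = 0) : f = 0 := by
  obtain ⟨g, rfl⟩ := exists_rename_eq_of_vars_subset_range f (firstLabels n)
    (firstLabels_injective n) fun k hk => mem_range_firstLabels (hf k hk)
  have : g = 0 := ev_rename_injective n (by simpa using h)
  rw [this, map_zero]

theorem le_of_mem_vars {d : ℕ} {f : SymFun K} (hf : IsWeightedHomogeneous pwt f d) {k : ℕ+}
    (hk : k ∈ f.vars) : (k : ℕ) ≤ d := by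
  rw [mem_vars_iff_mem_support] at hk
  obtain ⟨α, hα, hkα⟩ := hk
  rw [← hf (mem_support_iff.1 hα)]
  exact Finsupp.le_weight_of_ne_zero' pwt (Finsupp.mem_support_iff.1 hkα)

theorem ev_eq_zero_of_homogeneous [CharZero K] {n d : ℕ} (hdn : d ≤ n) {f : SymFun K}
    (hf : IsWeightedHomogeneous pwt f d) (h : ev K n f = 0) : f = 0 :=
  ev_eq_zero_of_vars (fun _ hk => (le_of_mem_vars hf hk).trans hdn) h

theorem exists_homogeneous_ev_eq [CharZero K] {n d : ℕ} {g : MvPolynomial (Fin n) K}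
    (hg : g.IsSymmetric) (hd : g.IsHomogeneous d) :
    ∃ f : SymFun K, IsWeightedHomogeneous pwt f d ∧ ev K n f = g := by
  obtain ⟨f, hf⟩ := exists_ev_eq hg
  refine ⟨weightedHomogeneousComponent pwt d (rename (firstLabels n) f),
    weightedHomogeneousComponent_isWeightedHomogeneous d _, ?_⟩
  rw [ev_weightedHomogeneousComponent, hf, homogeneousComponent_of_mem
    ((mem_homogeneousSubmodule _ _).2 hd), if_pos rfl]

theorem killCompl_powerSum {n : ℕ} (e : Fin n ↪ ℕ) (k : ℕ+) :
    MvPowerSeries.killCompl e (powerSum K (id : ℕ → ℕ) k) =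
      (psum (Fin n) K k : MvPowerSeries (Fin n) K) := by
  classical
  ext α
  rw [MvPowerSeries.coeff_killCompl, coeff_coe, psum, coeff_sum]
  simp only [coeff_X_pow]
  change (if ∃ i, α.embDomain e = Finsupp.single (id i) (k : ℕ) then (1 : K) else 0) = _
  by_cases h : ∃ j, Finsupp.single j (k : ℕ) = α
  · obtain ⟨j, rfl⟩ := h
    rw [if_pos ⟨e j, by simp⟩, Finset.sum_eq_single j]
    · simp
    · intro i _ hij
      rw [if_neg]
      intro h
      exact hij ((Finsupp.single_left_inj k.ne_zero).1 h)
    · simp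
  · rw [if_neg, Finset.sum_eq_zero]
    · intro i _
      rw [if_neg fun hi => h ⟨i, hi⟩]
    · rintro ⟨i, hi⟩
      have hmem : i ∈ (α.embDomain e).support := by rw [hi]; simp
      rw [Finsupp.support_embDomain, Finset.mem_map] at hmem
      obtain ⟨j, -, rfl⟩ := hmem
      refine h ⟨j, ?_⟩
      apply Finsupp.embDomain_injective e
      rw [hi]
      simp

/-- Setting all variables outside the image of `e` to zero turns the infinite power sums into finite
ones. This carries every question about `toSeries` to finitely many variables. -/
theorem coeff_toSeries {n : ℕ} (e : Fin n ↪ ℕ) (f : SymFun K) (α : Fin n →₀ ℕ) :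
    MvPowerSeries.coeff (α.embDomain e) (toSeries f) = (ev K n f).coeff α := by
  have h : (MvPowerSeries.killCompl e).comp (aeval (powerSum K (id : ℕ → ℕ))) =
      (coeToMvPowerSeries.algHom K).comp (ev K n) := by
    refine algHom_ext fun k => ?_
    simp [ev, killCompl_powerSum]
  have h' := DFunLike.congr_fun h f
  have := congrArg (MvPowerSeries.coeff α) h'
  rw [AlgHom.comp_apply, MvPowerSeries.coeff_killCompl] at this
  rw [toSeries, this]
  simp

theorem exists_embDomain_eq {n : ℕ} (γ : ℕ →₀ ℕ) (hγ : γ.support.card ≤ n) :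
    ∃ (e : Fin n ↪ ℕ) (α : Fin n →₀ ℕ), γ = α.embDomain e := by
  obtain ⟨T, hT, hTn⟩ := Infinite.exists_superset_card_eq γ.support n hγ
  let e : Fin n ↪ ℕ := (T.orderEmbOfFin hTn).toEmbedding
  refine ⟨e, γ.comapDomain e e.injective.injOn, ?_⟩
  ext i
  by_cases hi : i ∈ Set.range e
  · obtain ⟨j, rfl⟩ := hi
    rw [Finsupp.embDomain_apply_self, Finsupp.comapDomain_apply]
  · rw [Finsupp.embDomain_of_notMem_range _ _ _ hi, ← Finsupp.notMem_support_iff]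
    intro h
    have := hT h
    rw [← Finset.mem_coe, ← T.range_orderEmbOfFin hTn] at this
    exact hi this

open Classical in
theorem coeff_monomialSymm (γ : ℕ →₀ ℕ) (μ : YoungDiagram) :
    MvPowerSeries.coeff γ (monomialSymm K μ) = if shape γ = μ then 1 else 0 := by
  have : MvPowerSeries.coeff γ (monomialSymm K μ) =
    if γ.support.val.map γ = (μ.rowLens : Multiset ℕ) then 1 else 0 := rfl
  rw [this]
  simp only [shape_eq_iff]

theorem toSeries_injective [CharZero K] : Function.Injective (toSeries (K := K)) := by
  intro f g hfg
  rw [← sub_eq_zero]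
  let n := (f - g).vars.sup fun k : ℕ+ => (k : ℕ)
  refine ev_eq_zero_of_vars (n := n) (fun k hk => Finset.le_sup (f := fun k : ℕ+ => (k : ℕ)) hk) ?_
  ext α
  rw [← coeff_toSeries Fin.valEmbedding]
  have : toSeries (f - g) = 0 := by
    rw [toSeries, map_sub]
    exact sub_eq_zero.2 hfg
  rw [this]
  simp

/-- A triangular expansion in infinitely many variables restricts to `n` variables. -/
theorem ev_eq_of_toSeries_eq {f : SymFun K} {ν : YoungDiagram} {u : YoungDiagram →₀ K}
    (h : toSeries f = monomialSymm K ν + u.sum fun μ a => a • monomialSymm K μ) (n : ℕ) :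
    ev K n f = mono K n ν + u.sum fun μ a => a • mono K n μ := by
  classical
  ext α
  rw [← coeff_toSeries Fin.valEmbedding, h, map_add, coeff_add, coeff_monomialSymm, coeff_mono,
    shape_embDomain, Finsupp.sum, Finsupp.sum, map_sum, coeff_sum]
  congr 1
  refine Finset.sum_congr rfl fun μ _ => ?_
  rw [coeff_smul, coeff_mono, ← shape_embDomain Fin.valEmbedding α, ← coeff_monomialSymm]
  rfl

/-- A monomial of degree `d` involves at most `d` variables, so a homogeneous identity of degree `d`
may be checked in `d` variables. -/
theorem toSeries_eq_of_ev_eq {f : SymFun K} {d : ℕ} (hf : IsWeightedHomogeneous pwt f d)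
    {ν : YoungDiagram} (hν : ν.card = d) {u : YoungDiagram →₀ K}
    (hu : ∀ μ ∈ u.support, μ.card = d)
    (h : ev K d f = mono K d ν + u.sum fun μ a => a • mono K d μ) :
    toSeries f = monomialSymm K ν + u.sum fun μ a => a • monomialSymm K μ := by
  classical
  have hval : ∀ (n : ℕ) (e : Fin n ↪ ℕ) (α : Fin n →₀ ℕ),
      MvPowerSeries.coeff (α.embDomain e)
        (monomialSymm K ν + u.sum fun μ a => a • monomialSymm K μ) =
      (mono K n ν + u.sum fun μ a => a • mono K n μ).coeff α := fun n e α => by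
    rw [map_add, coeff_add, coeff_monomialSymm, coeff_mono, shape_embDomain, Finsupp.sum,
      Finsupp.sum, map_sum, coeff_sum]
    congr 1
    refine Finset.sum_congr rfl fun μ _ => ?_
    rw [coeff_smul, coeff_mono, ← shape_embDomain e α, ← coeff_monomialSymm]
    rfl
  ext γ
  by_cases hγ : γ.degree = d
  · have hc : γ.support.card ≤ d := by
      rw [← hγ, ← colLen_shape, ← card_shape]
      exact colLen_zero_le_card _
    obtain ⟨e, α, rfl⟩ := exists_embDomain_eq γ hc
    rw [coeff_toSeries, h, hval]
  · obtain ⟨n, hn⟩ : ∃ n, γ.support.card ≤ n := ⟨_, le_rfl⟩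
    obtain ⟨e, α, rfl⟩ := exists_embDomain_eq γ hn
    rw [← card_shape, shape_embDomain, card_shape] at hγ
    rw [coeff_toSeries, (isHomogeneous_ev hf).coeff_eq_zero hγ, hval, coeff_add, coeff_mono,
      Finsupp.sum, coeff_sum, if_neg, Finset.sum_eq_zero, add_zero]
    · intro μ hμ
      rw [coeff_smul, coeff_mono, if_neg, smul_zero]
      rintro rfl
      exact hγ (by rw [← card_shape]; exact hu _ hμ)
    · rintro rfl
      exact hγ (by rw [← card_shape]; exact hν)

end PowerSums

/-! ### Exponential sums over exponent vectors -/

section ExpSums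

theorem finite_weight_eq (d : ℕ) : {α : ℕ+ →₀ ℕ | Finsupp.weight pwt α = d}.Finite := by
  classical
  refine (Finset.finite_toSet (Finset.finsupp ((Finset.range d).image Nat.succPNat)
    fun _ => Finset.range (d + 1))).subset ?_
  rintro α rfl
  rw [Finset.mem_coe, Finset.mem_finsupp_iff]
  have h : ∀ k ∈ α.support, (k : ℕ) ≤ Finsupp.weight pwt α := fun k hk =>
    Finsupp.le_weight_of_ne_zero' pwt (Finsupp.mem_support_iff.1 hk)
  refine ⟨fun k hk => Finset.mem_image.2 ⟨k.natPred, ?_, k.succPNat_natPred⟩, fun k _ => ?_⟩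
  · have := h k hk
    have := k.natPred_add_one
    rw [Finset.mem_range]
    omega
  · rw [Finset.mem_range, Nat.lt_succ_iff]
    exact Finsupp.le_weight pwt k.ne_zero α

/-- The exponent vectors of weight `d`. -/
def expsOf (d : ℕ) : Finset (ℕ+ →₀ ℕ) := (finite_weight_eq d).toFinset

@[simp]
theorem mem_expsOf {d : ℕ} {α : ℕ+ →₀ ℕ} : α ∈ expsOf d ↔ Finsupp.weight pwt α = d := by
  simp [expsOf]

variable {K S : Type*} [Field K] [CommRing S] [Algebra K S]

/-- The product `∏ k, w_k ^ α_k / α_k !`. -/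
def expTerm (K : Type*) {S : Type*} [Field K] [CommRing S] [Algebra K S] (w : ℕ+ → S)
    (α : ℕ+ →₀ ℕ) : S :=
  α.prod fun k a => ((a.factorial : K)⁻¹) • w k ^ a

/-- The part of weight `d` of `exp (∑ k, w_k)`. -/
def expCoeff (K : Type*) {S : Type*} [Field K] [CommRing S] [Algebra K S] (w : ℕ+ → S) (d : ℕ) :
    S :=
  ∑ α ∈ expsOf d, expTerm K w α

theorem expCoeff_zero (w : ℕ+ → S) : expCoeff K w 0 = 1 := by
  have : expsOf 0 = {0} := by
    ext α
    have : Finsupp.NonTorsionWeight ℕ pwt :=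
      Finsupp.nonTorsionWeight_of (R := ℕ) (w := pwt) fun k : ℕ+ => k.ne_zero
    rw [mem_expsOf, Finset.mem_singleton, Finsupp.weight_eq_zero_iff_eq_zero]
  rw [expCoeff, this, Finset.sum_singleton, expTerm, Finsupp.prod_zero_index]

theorem smul_expTerm_add_single [CharZero K] (w : ℕ+ → S) (β : ℕ+ →₀ ℕ) (k : ℕ+) :
    (((β k + 1 : ℕ) : K)) • expTerm K w (β + Finsupp.single k 1) = w k * expTerm K w β := by
  classical
  have h0 : ∀ k : ℕ+, (fun a : ℕ => ((a.factorial : K)⁻¹) • w k ^ a) 0 = 1 := fun k => by simp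
  have hsup : (β + Finsupp.single k 1).support ⊆ insert k β.support := by
    refine Finsupp.support_add.trans ?_
    intro j hj
    rw [Finset.mem_union] at hj
    rcases hj with hj | hj
    · exact Finset.mem_insert_of_mem hj
    · rw [Finset.mem_singleton.1 (Finsupp.support_single_subset hj)]
      exact Finset.mem_insert_self _ _
  rw [expTerm, expTerm, Finsupp.prod_of_support_subset _ hsup _ fun k _ => h0 k,
    Finsupp.prod_of_support_subset β (Finset.subset_insert k β.support) _ fun k _ => h0 k,
    ← Finset.mul_prod_erase _ _ (Finset.mem_insert_self k _),
    ← Finset.mul_prod_erase _ (fun i => ((β i).factorial : K)⁻¹ • w i ^ β i)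
      (Finset.mem_insert_self k _)]
  have hrest : ∏ j ∈ (insert k β.support).erase k,
      (((β + Finsupp.single k 1 : ℕ+ →₀ ℕ) j).factorial : K)⁻¹ •
        w j ^ (β + Finsupp.single k 1 : ℕ+ →₀ ℕ) j =
      ∏ j ∈ (insert k β.support).erase k, ((β j).factorial : K)⁻¹ • w j ^ β j := by
    refine Finset.prod_congr rfl fun j hj => ?_
    rw [Finsupp.add_apply, Finsupp.single_eq_of_ne (Finset.ne_of_mem_erase hj), add_zero]
  rw [hrest, Finsupp.add_apply, Finsupp.single_eq_same, Nat.factorial_succ, ← mul_assoc,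
    ← smul_mul_assoc]
  congr 1
  have h1 : ((β k + 1 : ℕ) : K) ≠ 0 := by exact_mod_cast Nat.succ_ne_zero (β k)
  rw [smul_smul, Nat.cast_mul, mul_inv, ← mul_assoc, mul_inv_cancel₀ h1, one_mul, pow_succ,
    mul_smul_comm, mul_comm]

theorem weight_add_single (β : ℕ+ →₀ ℕ) (k : ℕ+) :
    Finsupp.weight pwt (β + Finsupp.single k 1) = Finsupp.weight pwt β + k := by
  rw [map_add, Finsupp.weight_single, one_smul]
  rfl

/-- The coefficient form of `u F' = (∑ k w_k u^k) F` for `F = exp (∑ w_k u^k)`, proved by marking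
one part `k` of the exponent vector `α` and removing it. -/
theorem natCast_smul_expCoeff [CharZero K] (w : ℕ+ → S) (d : ℕ) :
    (d : K) • expCoeff K w d = ∑ p ∈ Finset.HasAntidiagonal.antidiagonal d,
      ((p.1 : K) • w p.1.toPNat') * expCoeff K w p.2 := by
  classical
  have h1 : (d : K) • expCoeff K w d = ∑ α ∈ expsOf d, ∑ k ∈ α.support,
      ((α k : K) * ((k : ℕ) : K)) • expTerm K w α := by
    rw [expCoeff, Finset.smul_sum]
    refine Finset.sum_congr rfl fun α hα => ?_
    rw [← Finset.sum_smul]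
    congr 1
    rw [← mem_expsOf.1 hα, Finsupp.weight_apply, Finsupp.sum]
    push_cast
    refine Finset.sum_congr rfl fun k _ => ?_
    simp [pwt]
  -- The term `p.1 = 0` uses the default value of `toPNat'` at `0`, but its scalar factor is `0`.
  have h2 : ∑ p ∈ Finset.HasAntidiagonal.antidiagonal d,
        ((p.1 : K) • w p.1.toPNat') * expCoeff K w p.2 =
      ∑ p ∈ Finset.HasAntidiagonal.antidiagonal d with p.1 ≠ 0,
        ∑ β ∈ expsOf p.2, ((p.1 : K) • w p.1.toPNat') * expTerm K w β := by
    rw [Finset.sum_filter]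
    refine Finset.sum_congr rfl fun p _ => ?_
    split_ifs with h
    · rw [expCoeff, Finset.mul_sum]
    · rw [not_not.1 h]
      simp
  rw [h1, h2, Finset.sum_sigma', Finset.sum_sigma']
  refine Finset.sum_nbij' (fun x => ⟨((x.2 : ℕ), d - x.2), x.1 - Finsupp.single x.2 1⟩)
    (fun y => ⟨y.2 + Finsupp.single y.1.1.toPNat' 1, y.1.1.toPNat'⟩) ?_ ?_ ?_ ?_ ?_
  · rintro ⟨α, k⟩ h
    simp only [Finset.mem_sigma, mem_expsOf] at h
    have hle : Finsupp.single k 1 ≤ α := by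
      rw [Finsupp.single_le_iff]
      have := Finsupp.mem_support_iff.1 h.2
      omega
    have hw := weight_add_single (α - Finsupp.single k 1) k
    rw [tsub_add_cancel_of_le hle, h.1] at hw
    simp only [Finset.mem_sigma, Finset.mem_filter, Finset.HasAntidiagonal.mem_antidiagonal,
      mem_expsOf]
    have := k.pos
    omega
  · rintro ⟨⟨i, j⟩, β⟩ h
    simp only [Finset.mem_sigma, Finset.mem_filter, Finset.HasAntidiagonal.mem_antidiagonal,
      mem_expsOf] at h
    simp only [Finset.mem_sigma, mem_expsOf, weight_add_single, Finsupp.mem_support_iff,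
      Nat.toPNat'_coe]
    rw [if_pos (Nat.pos_of_ne_zero h.1.2)]
    refine ⟨by omega, by simp⟩
  · rintro ⟨α, k⟩ h
    simp only [Finset.mem_sigma, mem_expsOf] at h
    have hle : Finsupp.single k 1 ≤ α := by
      rw [Finsupp.single_le_iff]
      have := Finsupp.mem_support_iff.1 h.2
      omega
    simp [tsub_add_cancel_of_le hle]
  · rintro ⟨⟨i, j⟩, β⟩ h
    simp only [Finset.mem_sigma, Finset.mem_filter, Finset.HasAntidiagonal.mem_antidiagonal,
      mem_expsOf] at h
    simp only [Nat.toPNat'_coe, add_tsub_cancel_right]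
    rw [if_pos (Nat.pos_of_ne_zero h.1.2), ← h.1.1, Nat.add_sub_cancel_left]
  · rintro ⟨α, k⟩ h
    simp only [Finset.mem_sigma, mem_expsOf] at h
    have hk : α k ≠ 0 := Finsupp.mem_support_iff.1 h.2
    have hle : Finsupp.single k 1 ≤ α := by
      rw [Finsupp.single_le_iff]
      omega
    have := smul_expTerm_add_single (K := K) w (α - Finsupp.single k 1) k
    rw [tsub_add_cancel_of_le hle, Finsupp.tsub_apply, Finsupp.single_eq_same,
      Nat.sub_add_cancel (by omega)] at this
    simp only [PNat.coe_toPNat']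
    rw [smul_mul_assoc, ← this, smul_smul, mul_comm]

end ExpSums

/-! ### Logarithmic derivatives of power series -/

section LogDeriv

open PowerSeries

variable {R : Type*} [CommRing R]

/-- `X F' = C F`. -/
def HasLogDeriv (F C : PowerSeries R) : Prop := X * d⁄dX R F = C * F

theorem HasLogDeriv.mul {F G C D : PowerSeries R} (hF : HasLogDeriv F C) (hG : HasLogDeriv G D) :
    HasLogDeriv (F * G) (C + D) := by
  rw [HasLogDeriv, Derivation.leibniz, smul_eq_mul, smul_eq_mul] at *
  linear_combination F * hG + G * hF

theorem hasLogDeriv_one : HasLogDeriv (1 : PowerSeries R) 0 := by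
  rw [HasLogDeriv]; simp

theorem HasLogDeriv.prod {ι : Type*} (s : Finset ι) {F C : ι → PowerSeries R}
    (h : ∀ i ∈ s, HasLogDeriv (F i) (C i)) : HasLogDeriv (∏ i ∈ s, F i) (∑ i ∈ s, C i) := by
  classical
  induction s using Finset.induction_on with
  | empty => simpa using hasLogDeriv_one
  | insert i s hi ih =>
    rw [Finset.prod_insert hi, Finset.sum_insert hi]
    exact (h i (Finset.mem_insert_self _ _)).mul
      (ih fun j hj => h j (Finset.mem_insert_of_mem hj))

/-- `- ∑ m > 0, z ^ m X ^ m`, the logarithmic derivative of `1 - z X`. -/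
def negGeom (z : R) : PowerSeries R := PowerSeries.mk fun m => if m = 0 then 0 else -z ^ m

theorem hasLogDeriv_one_sub (z : R) : HasLogDeriv (1 - X * C z : PowerSeries R) (negGeom z) := by
  rw [HasLogDeriv, map_sub, Derivation.leibniz, derivative_C, derivative_X, smul_zero,
    zero_add, smul_eq_mul, mul_one, ← map_one (C (R := R)), derivative_C, zero_sub, map_one]
  ext m
  rw [mul_sub, mul_one, map_sub, ← mul_assoc, mul_comm _ (X : PowerSeries R), mul_assoc,
    mul_neg, map_neg]
  rcases m with _ | m
  · simp [negGeom]
  · rw [coeff_succ_X_mul, coeff_succ_X_mul, coeff_mul_C, coeff_C]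
    simp only [negGeom, coeff_mk]
    rcases m with _ | m
    · simp
    · simp [pow_succ]

/-- Since `C` has no constant term, the equation determines `m` times the `m`-th coefficient from
the earlier ones. -/
theorem HasLogDeriv.unique [IsAddTorsionFree R] {F G C : PowerSeries R} (hF : HasLogDeriv F C)
    (hG : HasLogDeriv G C) (hC : constantCoeff C = 0) (h0 : constantCoeff F = constantCoeff G) :
    F = G := by
  ext m
  induction m using Nat.strong_induction_on with
  | _ m ih =>
    rcases m with _ | m
    · simpa using h0
    have hF' := congrArg (coeff (m + 1)) hF
    have hG' := congrArg (coeff (m + 1)) hG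
    rw [coeff_succ_X_mul, coeff_derivative, coeff_mul] at hF' hG'
    have : ∑ p ∈ Finset.HasAntidiagonal.antidiagonal (m + 1), coeff p.1 C * coeff p.2 F =
        ∑ p ∈ Finset.HasAntidiagonal.antidiagonal (m + 1), coeff p.1 C * coeff p.2 G := by
      refine Finset.sum_congr rfl fun p hp => ?_
      rw [Finset.HasAntidiagonal.mem_antidiagonal] at hp
      rcases Nat.eq_zero_or_pos p.1 with h | h
      · rw [h, coeff_zero_eq_constantCoeff_apply, hC, zero_mul, zero_mul]
      · rw [ih p.2 (by omega)]
    rw [this, ← hG', ← Nat.cast_succ, mul_comm, mul_comm _ ((m.succ : ℕ) : R), ← nsmul_eq_mul,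
      ← nsmul_eq_mul] at hF'
    exact (smul_right_inj (Nat.succ_ne_zero m)).1 hF'

theorem HasLogDeriv.map {S : Type*} [CommRing S] (f : R →+* S) {F C : PowerSeries R}
    (h : HasLogDeriv F C) : HasLogDeriv (PowerSeries.map f F) (PowerSeries.map f C) := by
  have h' := congrArg (PowerSeries.map f) h
  rw [map_mul, map_mul, map_X] at h'
  rw [HasLogDeriv, ← h']
  congr 1
  ext m
  simp [coeff_derivative]

theorem hasLogDeriv_expCoeff {K : Type*} [Field K] [CharZero K] [Algebra K R] (w : ℕ+ → R) :
    HasLogDeriv (PowerSeries.mk (expCoeff K w))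
      (PowerSeries.mk fun m => (m : K) • w m.toPNat') := by
  rw [HasLogDeriv]
  ext m
  conv_rhs => rw [coeff_mul]
  simp only [coeff_mk]
  rw [← natCast_smul_expCoeff]
  rcases m with _ | m
  · simp
  · rw [coeff_succ_X_mul, coeff_derivative, coeff_mk, Algebra.smul_def]
    simp [mul_comm]

end LogDeriv

/-! ### The Cauchy kernel in finitely many variables -/

section Kernel

open MvPolynomial

variable {K : Type*} [Field K] {n : ℕ}

theorem map_expCoeff {S S' : Type*} [CommRing S] [CommRing S'] [Algebra K S] [Algebra K S']
    (f : S →ₐ[K] S') (w : ℕ+ → S) (d : ℕ) :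
    f (expCoeff K w d) = expCoeff K (fun k => f (w k)) d := by
  simp only [expCoeff, expTerm, map_sum, Finsupp.prod, map_prod, map_smul, map_pow]

/-- The term `k⁻¹ (1 - t ^ k) / (1 - q ^ k) p_k(x) p_k(y)` of the logarithm of the kernel. -/
def kerWeight (q t : K) (n : ℕ) (k : ℕ+) : MvPolynomial (Fin n ⊕ Fin n) K :=
  ((((k : ℕ) : K))⁻¹ * ((1 - t ^ (k : ℕ)) / (1 - q ^ (k : ℕ)))) •
    (rename Sum.inl (psum (Fin n) K k) * rename Sum.inr (psum (Fin n) K k))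

/-- The part of bidegree `(d, d)` of the Cauchy kernel. -/
def kerDeg (q t : K) (n d : ℕ) : MvPolynomial (Fin n ⊕ Fin n) K :=
  expCoeff K (kerWeight q t n) d

/-- The Cauchy kernel, graded by an additional variable. -/
def kerSeries (q t : K) (n : ℕ) : PowerSeries (MvPolynomial (Fin n ⊕ Fin n) K) :=
  PowerSeries.mk (kerDeg q t n)

theorem constantCoeff_kerSeries (q t : K) : PowerSeries.constantCoeff (kerSeries q t n) = 1 := by
  rw [← PowerSeries.coeff_zero_eq_constantCoeff_apply, kerSeries, PowerSeries.coeff_mk, kerDeg,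
    expCoeff_zero]

theorem shiftHom_X_inl (q : K) (I : Finset (Fin n)) (i : Fin n) [Decidable (i ∈ I)] :
    shiftHom q (Sum.inl : Fin n → Fin n ⊕ Fin n) I (X (Sum.inl i)) =
      C (if i ∈ I then q else 1) * X (Sum.inl i) := by
  rw [shiftHom, scaleHom, aeval_X]
  congr 2
  simp

theorem shiftHom_X_inr (q : K) (I : Finset (Fin n)) (i : Fin n) :
    shiftHom q (Sum.inl : Fin n → Fin n ⊕ Fin n) I (X (Sum.inr i)) = X (Sum.inr i) := by
  rw [shiftHom, scaleHom, aeval_X]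
  simp

/-- The shift changes `p_k(x)` by `(1 - q^k) ∑ x_i^k` over `I`, which cancels the denominator `1 -
q^k` of the kernel. -/
theorem shiftHom_kerWeight [CharZero K] {q t : K} (I : Finset (Fin n)) (k : ℕ+)
    (hq : q ^ (k : ℕ) ≠ 1) :
    ((k : ℕ) : K) • shiftHom q (Sum.inl : Fin n → Fin n ⊕ Fin n) I (kerWeight q t n k) =
      ((k : ℕ) : K) • kerWeight q t n k - (1 - t ^ (k : ℕ)) •
        ∑ i ∈ I, ∑ j, (X (Sum.inl i) * X (Sum.inr j)) ^ (k : ℕ) := by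
  classical
  have hk : ((k : ℕ) : K) ≠ 0 := Nat.cast_ne_zero.2 k.ne_zero
  have h1 : 1 - q ^ (k : ℕ) ≠ 0 := sub_ne_zero.2 (Ne.symm hq)
  have hp : shiftHom q (Sum.inl : Fin n → Fin n ⊕ Fin n) I (rename Sum.inl (psum (Fin n) K k)) =
      rename Sum.inl (psum (Fin n) K k) - (1 - q ^ (k : ℕ)) • ∑ i ∈ I, X (Sum.inl i) ^ (k : ℕ) := by
    rw [psum, map_sum, map_sum, Finset.smul_sum, ← Finset.sum_filter_add_sum_filter_not _ (· ∈ I),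
      ← Finset.sum_filter_add_sum_filter_not Finset.univ (· ∈ I)
        (fun i => rename Sum.inl (X i ^ (k : ℕ) : MvPolynomial (Fin n) K))]
    have e1 : Finset.univ.filter (· ∈ I) = I := by ext; simp
    rw [e1, add_sub_right_comm, ← Finset.sum_sub_distrib]
    congr 1
    · refine Finset.sum_congr rfl fun i hi => ?_
      rw [map_pow, map_pow, rename_X, shiftHom_X_inl, if_pos hi, mul_pow, ← C_pow, smul_eq_C_mul]
      simp
      ring
    · refine Finset.sum_congr rfl fun i hi => ?_
      rw [map_pow, map_pow, rename_X, shiftHom_X_inl, if_neg (Finset.mem_filter.1 hi).2, C_1,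
        one_mul]
  have hp' : shiftHom q (Sum.inl : Fin n → Fin n ⊕ Fin n) I (rename Sum.inr (psum (Fin n) K k)) =
      rename Sum.inr (psum (Fin n) K k) := by
    rw [psum, map_sum, map_sum]
    refine Finset.sum_congr rfl fun i hi => ?_
    rw [map_pow, map_pow, rename_X, shiftHom_X_inr]
  have hs : ∑ i ∈ I, ∑ j, (X (Sum.inl i) * X (Sum.inr j) : MvPolynomial (Fin n ⊕ Fin n) K) ^
      (k : ℕ) = (∑ i ∈ I, X (Sum.inl i) ^ (k : ℕ)) * rename Sum.inr (psum (Fin n) K k) := by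
    rw [psum, map_sum, Finset.sum_mul_sum]
    simp [mul_pow]
  rw [kerWeight, map_smul, map_mul, hp, hp', hs, sub_mul, smul_sub, smul_sub, smul_mul_assoc,
    smul_smul, smul_smul, smul_smul, sub_right_inj]
  congr 1
  field_simp

/-- The factor `∏ k, (1 - u c x_i y_k)`. -/
def kerFactor (c : K) (i : Fin n) : PowerSeries (MvPolynomial (Fin n ⊕ Fin n) K) :=
  ∏ j, (1 - PowerSeries.X * PowerSeries.C (C c * X (Sum.inl i) * X (Sum.inr j)))

/-- This is `T_{q,x_i} Π / Π = ∏ j, (1 - u x_i y_j) / (1 - u t x_i y_j)` with the denominators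
cleared, the grading variable `u` being `PowerSeries.X`. Both sides have the same logarithmic
derivative and constant term `1`. -/
theorem prod_kerFactor_mul_map [CharZero K] {q : K} (hq : ∀ k : ℕ+, q ^ (k : ℕ) ≠ 1) (t : K)
    (I : Finset (Fin n)) :
    (∏ i ∈ I, kerFactor t i) *
        PowerSeries.map (shiftHom q Sum.inl I).toRingHom (kerSeries q t n) =
      (∏ i ∈ I, kerFactor 1 i) * kerSeries q t n := by
  have hfac : ∀ c : K, ∀ i : Fin n, HasLogDeriv (kerFactor c i)
      (∑ j, negGeom (C c * X (Sum.inl i) * X (Sum.inr j))) := fun c i =>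
    HasLogDeriv.prod _ fun j _ => hasLogDeriv_one_sub _
  have hcc : ∀ c : K, ∀ i : Fin n, PowerSeries.constantCoeff (kerFactor c i) = 1 := fun c i => by
    simp [kerFactor, map_prod]
  have hker := hasLogDeriv_expCoeff (K := K) (kerWeight q t n)
  have hcoe : ∀ f, (shiftHom q (Sum.inl : Fin n → Fin n ⊕ Fin n) I).toRingHom f =
    shiftHom q Sum.inl I f := fun f => rfl
  refine HasLogDeriv.unique ((HasLogDeriv.prod I fun i _ => hfac t i).mul
    (hker.map (shiftHom q Sum.inl I).toRingHom)) ?_ ?_ ?_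
  · have hrhs := (HasLogDeriv.prod I fun i _ => hfac 1 i).mul hker
    refine (congrArg (HasLogDeriv _) ?_).mpr hrhs
    ext1 m
    simp only [map_add, map_sum, negGeom, PowerSeries.coeff_mk, PowerSeries.coeff_map]
    rcases Nat.eq_zero_or_pos m with rfl | hm
    · simp
    · have h := shiftHom_kerWeight (t := t) I m.toPNat' (hq _)
      rw [Nat.toPNat'_coe, if_pos hm] at h
      rw [hcoe, map_smul, h]
      simp only [if_neg hm.ne', Finset.sum_neg_distrib]
      rw [C_1]
      simp only [one_mul, mul_pow, mul_assoc, ← Finset.mul_sum, ← C_pow, sub_smul, one_smul,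
        smul_eq_C_mul]
      ring
  · rw [← PowerSeries.coeff_zero_eq_constantCoeff_apply]
    simp [negGeom, -PowerSeries.coeff_zero_eq_constantCoeff]
  · rw [map_mul, map_mul, map_prod, map_prod, Finset.prod_congr rfl fun i _ => hcc t i,
      Finset.prod_congr rfl fun i _ => hcc 1 i, ← PowerSeries.coeff_zero_eq_constantCoeff_apply,
      PowerSeries.coeff_map, PowerSeries.coeff_zero_eq_constantCoeff_apply,
      constantCoeff_kerSeries, map_one]

/-- The image of the Cauchy kernel under Macdonald's operator in the first set of variables. -/
def opSeries (q t X : K) (n : ℕ) : PowerSeries (MvPolynomial (Fin n ⊕ Fin n) K) :=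
  PowerSeries.mk fun d => macOp q t X Sum.inl (kerDeg q t n d)

/-- The matrix `kerMat` in the variables of the kernel. -/
def kerDet (t X : K) (n : ℕ) : PowerSeries (MvPolynomial (Fin n ⊕ Fin n) K) :=
  (kerMat PowerSeries.X (PowerSeries.C (C t)) (PowerSeries.C (C X))
    (fun i : Fin n => PowerSeries.C (MvPolynomial.X (Sum.inl i)))
    (fun i : Fin n => PowerSeries.C (MvPolynomial.X (Sum.inr i)))).det

theorem mul_eq_mul_of_mul_eq {A : Type*} [CommRing A] {a b c d : A} (s p : A)
    (h : a * b = c * d) : a * (s * (p * b)) = c * (s * (p * d)) := by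
  linear_combination s * p * h

theorem opSeries_eq_sum (q t X : K) :
    opSeries q t X n = ∑ w : Equiv.Perm (Fin n), ((Equiv.Perm.sign w : ℤ) :
      PowerSeries (MvPolynomial (Fin n ⊕ Fin n) K)) *
      ((∏ i, PowerSeries.C (MvPolynomial.X (Sum.inl i)) ^ (w i : ℕ)) * ∑ I : Finset (Fin n),
        PowerSeries.C (C (X ^ I.card * t ^ (∑ i ∈ I, (w i : ℕ)))) *
          PowerSeries.map (shiftHom q Sum.inl I).toRingHom (kerSeries q t n)) := by
  ext1 d
  have h1 : ∀ w : Equiv.Perm (Fin n), ((Equiv.Perm.sign w : ℤ) :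
      PowerSeries (MvPolynomial (Fin n ⊕ Fin n) K)) =
      PowerSeries.C (C ((Equiv.Perm.sign w : ℤ) : K)) := fun w => by simp
  rw [opSeries, PowerSeries.coeff_mk, macOp_apply, map_sum]
  refine Finset.sum_congr rfl fun w _ => ?_
  have h2 : (∏ i, PowerSeries.C (MvPolynomial.X (Sum.inl i) : MvPolynomial (Fin n ⊕ Fin n) K) ^
      (w i : ℕ)) = PowerSeries.C (∏ i, MvPolynomial.X (Sum.inl i) ^ (w i : ℕ)) := by
    rw [map_prod]
    exact Finset.prod_congr rfl fun i _ => (map_pow _ _ _).symm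
  have h3 : ∀ I : Finset (Fin n), PowerSeries.coeff d (PowerSeries.C
      (C (X ^ I.card * t ^ (∑ i ∈ I, (w i : ℕ)))) *
          PowerSeries.map (shiftHom q Sum.inl I).toRingHom (kerSeries q t n)) =
      (X ^ I.card * t ^ (∑ i ∈ I, (w i : ℕ))) • shiftHom q Sum.inl I (kerDeg q t n d) := fun I => by
    rw [PowerSeries.coeff_C_mul, PowerSeries.coeff_map, kerSeries, PowerSeries.coeff_mk,
      smul_eq_C_mul]
    rfl
  rw [h1, h2, PowerSeries.coeff_C_mul, PowerSeries.coeff_C_mul, map_sum, smul_eq_C_mul,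
    Finset.sum_congr rfl fun I _ => h3 I]

theorem prod_kerFactor_mul_sum [CharZero K] {q : K} (hq : ∀ k : ℕ+, q ^ (k : ℕ) ≠ 1) (t X : K)
    (w : Equiv.Perm (Fin n)) :
    (∏ i, kerFactor t i) * ∑ I : Finset (Fin n),
        PowerSeries.C (C (X ^ I.card * t ^ (∑ i ∈ I, (w i : ℕ)))) *
          PowerSeries.map (shiftHom q Sum.inl I).toRingHom (kerSeries q t n) =
      kerSeries q t n * ∏ i, (kerFactor t i +
        PowerSeries.C (C X) * PowerSeries.C (C t) ^ (w i : ℕ) * kerFactor 1 i) := by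
  classical
  rw [Finset.prod_add]
  rw [Finset.powerset_univ, Finset.mul_sum, Finset.mul_sum]
  -- `Finset.prod_add` indexes its terms by the set where the first summand `kerFactor t i` is
  -- taken, the complement of the set of shifted variables.
  refine Finset.sum_bij' (fun I _ => Iᶜ) (fun I _ => Iᶜ) (by simp) (by simp) (by simp) (by simp)
    fun I _ => ?_
  rw [← Finset.compl_eq_univ_sdiff, compl_compl, Finset.prod_mul_distrib, Finset.prod_mul_distrib,
    Finset.prod_const, Finset.prod_pow_eq_pow_sum, ← Finset.prod_mul_prod_compl I (kerFactor t)]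
  have h := prod_kerFactor_mul_map hq t I
  rw [map_mul, map_mul, map_pow, map_pow, map_pow, map_pow]
  generalize PowerSeries.C (C X) ^ I.card = a at *
  generalize PowerSeries.C (C t) ^ (∑ i ∈ I, (w i : ℕ)) = b at *
  generalize PowerSeries.map (shiftHom q Sum.inl I).toRingHom (kerSeries q t n) = m at *
  generalize (∏ i ∈ Iᶜ, kerFactor t i) = c at *
  linear_combination c * a * b * h

/-- Macdonald's operator acts on the kernel as multiplication by the determinant of `kerMat`, up to
a factor that does not depend on `X`. -/
theorem prod_kerFactor_mul_opSeries [CharZero K] {q : K} (hq : ∀ k : ℕ+, q ^ (k : ℕ) ≠ 1)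
    (t X : K) :
    (∏ i, kerFactor t i) * opSeries q t X n = kerSeries q t n * kerDet t X n := by
  have hgt : ∀ i : Fin n, ∏ k, (1 - PowerSeries.X * (PowerSeries.C (C t) *
      PowerSeries.C (MvPolynomial.X (Sum.inl i))) * PowerSeries.C (MvPolynomial.X (Sum.inr k))) =
      kerFactor t i := fun i => by
    simp [kerFactor, mul_assoc]
  have hg : ∀ i : Fin n, ∏ k, (1 - PowerSeries.X *
      PowerSeries.C (MvPolynomial.X (Sum.inl i)) * PowerSeries.C (MvPolynomial.X (Sum.inr k))) =
      kerFactor (1 : K) i := fun i => by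
    simp [kerFactor, mul_assoc]
  rw [opSeries_eq_sum, kerDet, det_kerMat_eq, Finset.mul_sum, Finset.mul_sum]
  refine Finset.sum_congr rfl fun w _ => ?_
  rw [Finset.prod_mul_distrib]
  simp only [hgt, hg]
  exact mul_eq_mul_of_mul_eq _ _ (prod_kerFactor_mul_sum hq t X w)

theorem prod_kerFactor_ne_zero (t : K) : (∏ i : Fin n, kerFactor t i) ≠ 0 := by
  intro h
  have := congrArg PowerSeries.constantCoeff h
  simp [kerFactor, map_prod] at this

theorem rename_swap_kerDeg (q t : K) (d : ℕ) :
    rename Sum.swap (kerDeg q t n d) = kerDeg q t n d := by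
  rw [kerDeg, map_expCoeff]
  congr 1
  ext1 k
  rw [kerWeight, map_smul, map_mul, rename_rename, rename_rename]
  congr 1
  exact mul_comm _ _

theorem mul_map_eq {A : Type*} [CommRing A] [IsDomain A] {f : A →+* A} {g o k e v : A}
    (h : g * o = k * e) (hg : g ≠ 0) (hfg : f g = g) (hfk : f k = k)
    (he : f (e * v) = e * v) : f (o * v) = o * v := by
  refine mul_left_cancel₀ hg ?_
  calc g * f (o * v) = f (g * o * v) := by rw [mul_assoc, map_mul f g, hfg]
    _ = k * (e * v) := by rw [h, mul_assoc, map_mul, hfk, he]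
    _ = g * (o * v) := by rw [← mul_assoc, ← h, mul_assoc]

theorem map_kerDet_mul (t X : K) {ρ : MvPolynomial (Fin n ⊕ Fin n) K →+*
    MvPolynomial (Fin n ⊕ Fin n) K}
    (hρl : ∀ i : Fin n, ρ (MvPolynomial.X (Sum.inl i)) = MvPolynomial.X (Sum.inr i))
    (hρr : ∀ i : Fin n, ρ (MvPolynomial.X (Sum.inr i)) = MvPolynomial.X (Sum.inl i))
    (hρC : ∀ a : K, ρ (C a) = C a) :
    PowerSeries.map ρ (kerDet t X n * (Matrix.vandermonde fun i : Fin n =>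
      PowerSeries.C (MvPolynomial.X (Sum.inr i) : MvPolynomial (Fin n ⊕ Fin n) K)).det) =
    kerDet t X n * (Matrix.vandermonde fun i : Fin n =>
      PowerSeries.C (MvPolynomial.X (Sum.inr i) : MvPolynomial (Fin n ⊕ Fin n) K)).det := by
  have h := kerMat_det_swap PowerSeries.X (PowerSeries.C (C t)) (PowerSeries.C (C X))
    (fun i : Fin n => PowerSeries.C (MvPolynomial.X (Sum.inl i)))
    (fun i : Fin n => PowerSeries.C (MvPolynomial.X (Sum.inr i) :
      MvPolynomial (Fin n ⊕ Fin n) K)) PowerSeries.X_ne_zero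
    (fun i k h => by simpa using congrArg PowerSeries.constantCoeff h)
    (fun i k h => by simpa using congrArg PowerSeries.constantCoeff h)
    (fun i h => X_ne_zero _ (PowerSeries.C_injective (h.trans (map_zero _).symm)))
    (fun i j h => Sum.inr_injective (X_injective (PowerSeries.C_injective h)))
  have hv : (Matrix.vandermonde fun i : Fin n => PowerSeries.C (MvPolynomial.X (Sum.inl i) :
      MvPolynomial (Fin n ⊕ Fin n) K)).map (PowerSeries.map ρ) =
      Matrix.vandermonde fun i : Fin n => PowerSeries.C (MvPolynomial.X (Sum.inr i)) := by
    ext1 i j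
    rw [Matrix.map_apply, Matrix.vandermonde_apply, Matrix.vandermonde_apply, map_pow,
      PowerSeries.map_C, hρl]
  have hk : (kerMat PowerSeries.X (PowerSeries.C (C t)) (PowerSeries.C (C X))
      (fun i : Fin n => PowerSeries.C (MvPolynomial.X (Sum.inr i)))
      (fun i : Fin n => PowerSeries.C (MvPolynomial.X (Sum.inl i) :
        MvPolynomial (Fin n ⊕ Fin n) K))).map (PowerSeries.map ρ) =
      kerMat PowerSeries.X (PowerSeries.C (C t)) (PowerSeries.C (C X))
      (fun i : Fin n => PowerSeries.C (MvPolynomial.X (Sum.inl i)))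
      (fun i : Fin n => PowerSeries.C (MvPolynomial.X (Sum.inr i))) := by
    rw [map_kerMat]
    simp only [PowerSeries.map_X, PowerSeries.map_C, hρl, hρr, hρC]
  rw [kerDet]
  conv_lhs => rw [h]
  rw [map_mul, RingHom.map_det, RingHom.map_det, RingHom.mapMatrix_apply,
    RingHom.mapMatrix_apply, hv, hk]

/-- Self-adjointness of `D(X)`: its action on the kernel is the same in `x` as in `y`. `macOp`
already contains the Vandermonde determinant in `x`, so the one in `y` is added to make the
expression symmetric. -/
theorem rename_swap_macOp_kerDeg [CharZero K] {q : K} (hq : ∀ k : ℕ+, q ^ (k : ℕ) ≠ 1) (t X : K)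
    (d : ℕ) :
    rename Sum.swap (vanderOp K Sum.inr (macOp q t X Sum.inl (kerDeg q t n d))) =
      vanderOp K Sum.inr (macOp q t X Sum.inl (kerDeg q t n d)) := by
  let ρ : MvPolynomial (Fin n ⊕ Fin n) K →+* MvPolynomial (Fin n ⊕ Fin n) K :=
    (rename Sum.swap : _ →ₐ[K] MvPolynomial (Fin n ⊕ Fin n) K).toRingHom
  have hρl : ∀ i : Fin n, ρ (MvPolynomial.X (Sum.inl i)) = MvPolynomial.X (Sum.inr i) :=
    fun i => rename_X _ _
  have hρr : ∀ i : Fin n, ρ (MvPolynomial.X (Sum.inr i)) = MvPolynomial.X (Sum.inl i) :=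
    fun i => rename_X _ _
  have hρC : ∀ a : K, ρ (C a) = C a := fun a => rename_C _ _
  let V : PowerSeries (MvPolynomial (Fin n ⊕ Fin n) K) :=
    PowerSeries.C (Matrix.vandermonde fun i : Fin n => (MvPolynomial.X (Sum.inr i) :
      MvPolynomial (Fin n ⊕ Fin n) K)).det
  have hV : V = (Matrix.vandermonde fun i : Fin n => PowerSeries.C (MvPolynomial.X (Sum.inr i) :
      MvPolynomial (Fin n ⊕ Fin n) K)).det := by
    rw [Matrix.det_vandermonde]
    simp only [V, Matrix.det_vandermonde, map_prod, map_sub]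
  have hdet : PowerSeries.map ρ (kerDet t X n * V) = kerDet t X n * V := by
    rw [hV]
    exact map_kerDet_mul t X hρl hρr hρC
  have hfac : PowerSeries.map ρ (∏ i : Fin n, kerFactor t i) = ∏ i : Fin n, kerFactor t i := by
    simp only [kerFactor]
    rw [map_prod]
    conv_rhs => rw [Finset.prod_comm]
    refine Finset.prod_congr rfl fun i _ => ?_
    rw [map_prod]
    refine Finset.prod_congr rfl fun j _ => ?_
    simp only [map_sub, map_one, map_mul, PowerSeries.map_X, PowerSeries.map_C, hρl, hρr, hρC]
    rw [mul_right_comm (PowerSeries.C (C t))]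
  have hker : PowerSeries.map ρ (kerSeries q t n) = kerSeries q t n := by
    ext1 d
    rw [PowerSeries.coeff_map, kerSeries, PowerSeries.coeff_mk]
    exact rename_swap_kerDeg q t d
  have key := prod_kerFactor_mul_opSeries (n := n) hq t X
  have main : PowerSeries.map ρ (opSeries q t X n * V) = opSeries q t X n * V :=
    mul_map_eq key (prod_kerFactor_ne_zero (n := n) t) hfac hker hdet
  have := congrArg (PowerSeries.coeff d) main
  rw [PowerSeries.coeff_map, PowerSeries.coeff_mul_C, opSeries, PowerSeries.coeff_mk,
    mul_comm] at this
  exact this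

/-- The factor `u ^ n` in `kerMat_neg_one_det` becomes the drop of the degree from `d` to `d - n`.
-/
theorem macOp_neg_one_kerDeg [CharZero K] {q : K} (hq : ∀ k : ℕ+, q ^ (k : ℕ) ≠ 1) (t : K)
    (d : ℕ) :
    macOp q t (-1) Sum.inl (kerDeg q t n d) = if n ≤ d then
      (∏ i : Fin n, X (Sum.inl i)) * (∏ i : Fin n, X (Sum.inr i)) *
        macOp q t (-t) Sum.inl (kerDeg q t n (d - n)) else 0 := by
  have key := prod_kerFactor_mul_opSeries (n := n) hq t (-1)
  have key' := prod_kerFactor_mul_opSeries (n := n) hq t (-t)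
  have hdet : kerDet t (-1) n = PowerSeries.X ^ n * (PowerSeries.C
      ((∏ i : Fin n, X (Sum.inl i)) * (∏ i : Fin n, X (Sum.inr i))) * kerDet t (-t) n) := by
    rw [kerDet, map_neg, map_neg, C_1, map_one, kerMat_neg_one_det, kerDet, map_neg, map_neg,
      map_mul, map_prod, map_prod, mul_assoc, mul_assoc, mul_assoc]
  have main : opSeries q t (-1) n = PowerSeries.X ^ n * (PowerSeries.C
      ((∏ i : Fin n, X (Sum.inl i)) * (∏ i : Fin n, X (Sum.inr i))) * opSeries q t (-t) n) := by
    refine mul_left_cancel₀ (prod_kerFactor_ne_zero (n := n) t) ?_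
    rw [key, hdet]
    exact (mul_eq_mul_of_mul_eq _ _ key').symm
  have := congrArg (PowerSeries.coeff d) main
  rw [PowerSeries.coeff_X_pow_mul', PowerSeries.coeff_C_mul] at this
  simpa only [opSeries, PowerSeries.coeff_mk] using this

end Kernel

/-! ### Multiplicatively independent parameters -/

section MulIndep

variable {K : Type*} [Field K] {q t : K}

/-- The monomials in `q` and `t` are pairwise distinct. -/
def MulIndep (q t : K) : Prop :=
  ∀ a b c e : ℕ, q ^ a * t ^ b = q ^ c * t ^ e → a = c ∧ b = e

theorem mulIndep_of_algebraicIndependent [CharZero K] (h : AlgebraicIndependent ℚ ![q, t]) :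
    MulIndep q t := fun a b c e habce => by
  have hinj := algebraicIndependent_iff_injective_aeval.1 h
  have key : (MvPolynomial.X 0 ^ a * MvPolynomial.X 1 ^ b : MvPolynomial (Fin 2) ℚ) =
      MvPolynomial.X 0 ^ c * MvPolynomial.X 1 ^ e := hinj (by simpa using habce)
  have h2 : ∀ a b : ℕ, (MvPolynomial.X 0 ^ a * MvPolynomial.X 1 ^ b : MvPolynomial (Fin 2) ℚ) =
      MvPolynomial.monomial (Finsupp.single 0 a + Finsupp.single 1 b) 1 := fun a b => by
    rw [MvPolynomial.X_pow_eq_monomial, MvPolynomial.X_pow_eq_monomial,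
      MvPolynomial.monomial_mul, one_mul]
  rw [h2, h2] at key
  have := (MvPolynomial.monomial_left_inj (one_ne_zero)).1 key
  have h0 := DFunLike.congr_fun this 0
  have h1 := DFunLike.congr_fun this 1
  simp at h0 h1
  exact ⟨h0, h1⟩

theorem MulIndep.one_sub_ne_zero (h : MulIndep q t) {a b : ℕ} (hab : a ≠ 0 ∨ b ≠ 0) :
    1 - q ^ a * t ^ b ≠ 0 := fun h0 => by
  have := h a b 0 0 (by rw [pow_zero, pow_zero, mul_one]; exact (sub_eq_zero.1 h0).symm)
  omega

theorem MulIndep.q_ne_zero (h : MulIndep q t) : q ≠ 0 := fun h0 => by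
  have := h 1 0 2 0 (by simp [h0])
  omega

theorem MulIndep.t_ne_zero (h : MulIndep q t) : t ≠ 0 := fun h0 => by
  have := h 0 1 0 2 (by simp [h0])
  omega

theorem MulIndep.q_pow_ne_one (h : MulIndep q t) (k : ℕ+) : q ^ (k : ℕ) ≠ 1 := fun h0 => by
  have := h.one_sub_ne_zero (a := k) (b := 0) (Or.inl k.ne_zero)
  simp [h0] at this

theorem MulIndep.t_pow_ne_one (h : MulIndep q t) (k : ℕ+) : t ^ (k : ℕ) ≠ 1 := fun h0 => by
  have := h.one_sub_ne_zero (a := 0) (b := k) (Or.inr k.ne_zero)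
  simp [h0] at this

theorem MulIndep.powerSumNorm_ne_zero [CharZero K] (h : MulIndep q t) (α : ℕ+ →₀ ℕ) :
    powerSumNorm q t α ≠ 0 := by
  rw [powerSumNorm, Finsupp.prod]
  refine Finset.prod_ne_zero_iff.2 fun k _ => mul_ne_zero (mul_ne_zero (pow_ne_zero _ ?_) ?_)
    (pow_ne_zero _ (div_ne_zero ?_ ?_))
  · exact Nat.cast_ne_zero.2 k.ne_zero
  · exact Nat.cast_ne_zero.2 (Nat.factorial_ne_zero _)
  · exact sub_ne_zero.2 (h.q_pow_ne_one k).symm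
  · exact sub_ne_zero.2 (h.t_pow_ne_one k).symm

/-- The eigenvalue of Macdonald's operator as a polynomial in the parameter. -/
def eigenPoly (q t : K) (n : ℕ) (μ : YoungDiagram) : Polynomial K :=
  ∏ i : Fin n, (1 + Polynomial.X * Polynomial.C (t ^ (i : ℕ) * q ^ expo n μ i))

theorem eval_eigenPoly (X : K) (n : ℕ) (μ : YoungDiagram) :
    (eigenPoly q t n μ).eval X = eigenval q t X n μ := by
  simp [eigenPoly, eigenval, Polynomial.eval_prod, mul_assoc]

/-- The roots of `eigenPoly` in `X` are the numbers `-1 / (t^i q^{μ_i})`. By independence of `q` and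
`t` a root determines both `i` and the part, so the polynomial determines the partition. -/
theorem MulIndep.eigenPoly_ne (h : MulIndep q t) {n : ℕ} {μ ν : YoungDiagram}
    (hμ : μ.colLen 0 ≤ n) (hν : ν.colLen 0 ≤ n) (hne : μ ≠ ν) :
    eigenPoly q t n μ - eigenPoly q t n ν ≠ 0 := by
  have hex : ∃ i, expo n μ i ≠ expo n ν i := by
    by_contra! hcon
    exact hne (by rw [← shape_expo hμ, ← shape_expo hν, Finsupp.ext hcon])
  obtain ⟨i, hi⟩ := hex
  intro h0
  let a : ℕ → Fin n → K := fun k j => t ^ (j : ℕ) * q ^ k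
  have ha : a (expo n μ i) i ≠ 0 := mul_ne_zero (pow_ne_zero _ h.t_ne_zero)
    (pow_ne_zero _ h.q_ne_zero)
  have h1 := congrArg (Polynomial.eval (-(a (expo n μ i) i)⁻¹)) h0
  rw [Polynomial.eval_sub, eval_eigenPoly, eval_eigenPoly, Polynomial.eval_zero] at h1
  have h2 : eigenval q t (-(a (expo n μ i) i)⁻¹) n μ = 0 := by
    refine Finset.prod_eq_zero (Finset.mem_univ i) ?_
    rw [mul_assoc, neg_mul, inv_mul_cancel₀ ha]
    ring
  rw [h2, zero_sub, neg_eq_zero, eigenval, Finset.prod_eq_zero_iff] at h1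
  obtain ⟨j, -, hj⟩ := h1
  have h3 : a (expo n ν j) j = a (expo n μ i) i := by
    rw [mul_assoc, neg_mul, ← sub_eq_add_neg, sub_eq_zero] at hj
    rw [eq_comm, ← mul_one (a _ i), hj, ← mul_assoc, mul_inv_cancel₀ ha, one_mul]
  have h4 := h _ _ _ _ ((mul_comm _ _).trans (h3.trans (mul_comm _ _)))
  rw [Fin.ext h4.2] at h4
  exact hi h4.1.symm

/-- A value of `X` avoiding the roots of the finitely many nonzero differences of eigenvalue
polynomials. -/
theorem MulIndep.exists_eigenval_ne [Infinite K] (h : MulIndep q t) (n d : ℕ) :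
    ∃ X : K, ∀ μ ∈ partitionsLE n d, ∀ ν ∈ partitionsLE n d, μ ≠ ν →
      eigenval q t X n μ ≠ eigenval q t X n ν := by
  classical
  let F : Polynomial K := ∏ p ∈ (partitionsLE n d ×ˢ partitionsLE n d).filter (fun p => p.1 ≠ p.2),
    (eigenPoly q t n p.1 - eigenPoly q t n p.2)
  have hF : F ≠ 0 := Finset.prod_ne_zero_iff.2 fun p hp => by
    simp only [Finset.mem_filter, Finset.mem_product, mem_partitionsLE] at hp
    exact h.eigenPoly_ne hp.1.1.2 hp.1.2.2 hp.2
  have hX : ∃ X : K, F.eval X ≠ 0 := by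
    by_contra! hcon
    exact hF (Polynomial.funext fun X => by rw [hcon X, Polynomial.eval_zero])
  obtain ⟨X, hX⟩ := hX
  refine ⟨X, fun μ hμ ν hν hne heq => hX ?_⟩
  rw [Polynomial.eval_prod]
  refine Finset.prod_eq_zero (i := (μ, ν)) (by simp [hne, mem_partitionsLE.1 hμ,
    mem_partitionsLE.1 hν]) ?_
  rw [Polynomial.eval_sub, eval_eigenPoly, eval_eigenPoly, heq, sub_self]

end MulIndep

/-! ### Triangular families of symmetric functions -/

section SymTriangular

open MvPolynomial

variable {K : Type*} [Field K]

/-- The strict dominance order. -/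
def DominanceLT (μ ν : YoungDiagram) : Prop := DominanceLE μ ν ∧ μ ≠ ν

theorem DominanceLT.trans (i j k : YoungDiagram) (h : DominanceLT i j) (h' : DominanceLT j k) :
    DominanceLT i k :=
  ⟨h.1.trans h'.1, fun he => h.2 (h.1.antisymm (he ▸ h'.1))⟩

theorem DominanceLT.rank_lt (i j : YoungDiagram) (h : DominanceLT i j) :
    dominanceRank i < dominanceRank j :=
  dominanceRank_lt h.1 h.2

theorem isHomogeneous_mono (n : ℕ) (μ : YoungDiagram) : (mono K n μ).IsHomogeneous μ.card := by
  classical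
  intro α hα
  rw [coeff_mono] at hα
  have : shape α = μ := by
    by_contra hne
    exact hα (if_neg hne)
  rw [← this, card_shape, Finsupp.degree_eq_weight_one]
  rfl

variable [CharZero K]

theorem exists_toSeries_eq_monomialSymm (μ : YoungDiagram) : ∃ f : SymFun K,
    IsWeightedHomogeneous pwt f μ.card ∧ toSeries f = monomialSymm K μ := by
  obtain ⟨f, hf, hf'⟩ := exists_homogeneous_ev_eq
    (isSymmetric_of_coeffSymm (coeffSymm_mono (K := K) (n := μ.card) μ)) (isHomogeneous_mono _ μ)
  refine ⟨f, hf, ?_⟩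
  have := toSeries_eq_of_ev_eq (u := 0) hf rfl (by simp) (by simpa using hf')
  simpa using this

/-- The monomial symmetric functions as elements of `SymFun K`. -/
def mSym (K : Type*) [Field K] [CharZero K] (μ : YoungDiagram) : SymFun K :=
  (exists_toSeries_eq_monomialSymm μ).choose

theorem isWeightedHomogeneous_mSym (μ : YoungDiagram) :
    IsWeightedHomogeneous pwt (mSym K μ) μ.card :=
  (exists_toSeries_eq_monomialSymm μ).choose_spec.1

theorem toSeries_mSym (μ : YoungDiagram) : toSeries (mSym K μ) = monomialSymm K μ :=
  (exists_toSeries_eq_monomialSymm μ).choose_spec.2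

theorem ev_mSym (n : ℕ) (μ : YoungDiagram) : ev K n (mSym K μ) = mono K n μ := by
  have := ev_eq_of_toSeries_eq (f := mSym K μ) (ν := μ) (u := 0) (by simp [toSeries_mSym]) n
  simpa using this

theorem linearIndependent_mSym : LinearIndependent K (mSym K) := by
  classical
  rw [linearIndependent_iff']
  intro s c hc μ hμ
  have h := congrArg (fun f => (ev K (μ.colLen 0) f).coeff (expo (μ.colLen 0) μ)) hc
  simp only [map_sum, map_smul, ev_mSym, coeff_sum, coeff_smul, coeff_expo_mono le_rfl,
    map_zero, coeff_zero] at h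
  simpa [hμ] using h

theorem toSeries_add_finsupp_sum (ν : YoungDiagram) (u : YoungDiagram →₀ K) :
    toSeries (mSym K ν + u.sum fun μ a => a • mSym K μ) =
      monomialSymm K ν + u.sum fun μ a => a • monomialSymm K μ := by
  rw [toSeries, map_add, Finsupp.sum, map_sum, Finsupp.sum]
  congr 1
  · exact toSeries_mSym ν
  · refine Finset.sum_congr rfl fun μ _ => ?_
    rw [map_smul]
    congr 1
    exact toSeries_mSym μ

/-- Transfers the triangularity condition of `IsMacdonaldFamily` from power series to `SymFun K`,
where linear algebra is available. -/
theorem triangular_iff {f : SymFun K} {ν : YoungDiagram} :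
    (∃ u : YoungDiagram →₀ K, (∀ μ ∈ u.support, DominanceLE μ ν ∧ μ ≠ ν) ∧
      toSeries f = monomialSymm K ν + u.sum fun μ a => a • monomialSymm K μ) ↔
    f - mSym K ν ∈ lowSpan K DominanceLT (mSym K) ν := by
  rw [lowSpan, Finsupp.mem_span_image_iff_linearCombination]
  constructor
  · rintro ⟨u, hu, h⟩
    refine ⟨u, hu, ?_⟩
    rw [← toSeries_add_finsupp_sum] at h
    rw [toSeries_injective h, add_sub_cancel_left]
    rfl
  · rintro ⟨u, hu, h⟩
    refine ⟨u, hu, ?_⟩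
    rw [← toSeries_add_finsupp_sum]
    congr 1
    rw [eq_add_of_sub_eq' h.symm]
    rfl

theorem eq_sum_mSym {f : SymFun K} {d : ℕ} (hf : IsWeightedHomogeneous pwt f d) :
    f = ∑ μ ∈ partitionsOf d, (ev K d f).coeff (expo d μ) • mSym K μ := by
  rw [← sub_eq_zero]
  refine ev_eq_zero_of_homogeneous le_rfl (d := d) ?_ ?_
  · rw [← mem_weightedHomogeneousSubmodule] at hf ⊢
    refine Submodule.sub_mem _ hf (Submodule.sum_mem _ fun μ hμ => Submodule.smul_mem _ _ ?_)
    rw [mem_weightedHomogeneousSubmodule, ← mem_partitionsOf.1 hμ]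
    exact isWeightedHomogeneous_mSym μ
  · rw [map_sub, map_sum, sub_eq_zero]
    have h := (coeffSymm_ev f).eq_sum_mono (isHomogeneous_ev (n := d) hf)
    have hp : partitionsLE d d = partitionsOf d := by
      ext μ
      simp only [mem_partitionsLE, mem_partitionsOf, and_iff_left_iff_imp]
      rintro rfl
      exact colLen_zero_le_card μ
    rw [hp] at h
    conv_lhs => rw [h]
    simp only [map_smul, ev_mSym]

variable {P : YoungDiagram → SymFun K}

theorem lowSpan_mSym_le_weighted (ν : YoungDiagram) :
    lowSpan K DominanceLT (mSym K) ν ≤ weightedHomogeneousSubmodule K pwt ν.card :=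
  lowSpan_le fun μ hμ => by
    rw [mem_weightedHomogeneousSubmodule, ← hμ.1.1]
    exact isWeightedHomogeneous_mSym μ

theorem isWeightedHomogeneous_of_triangular {f : SymFun K} {ν : YoungDiagram}
    (h : f - mSym K ν ∈ lowSpan K DominanceLT (mSym K) ν) :
    IsWeightedHomogeneous pwt f ν.card := by
  have := Submodule.add_mem _ (lowSpan_mSym_le_weighted ν h)
    ((mem_weightedHomogeneousSubmodule K pwt _ _).2 (isWeightedHomogeneous_mSym (K := K) ν))
  rwa [sub_add_cancel] at this

theorem exists_eq_sum_of_triangular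
    (hP : ∀ ν, P ν - mSym K ν ∈ lowSpan K DominanceLT (mSym K) ν) {f : SymFun K} {d : ℕ}
    (hf : IsWeightedHomogeneous pwt f d) :
    ∃ c : YoungDiagram → K, f = ∑ μ ∈ partitionsOf d, c μ • P μ := by
  have hm : ∀ μ ∈ partitionsOf d, mSym K μ ∈ Submodule.span K (P '' (partitionsOf d)) :=
    fun μ hμ => by
    have h1 := sub_mem_lowSpan_symm DominanceLT.trans DominanceLT.rank_lt hP μ
    have h2 : lowSpan K DominanceLT P μ ≤ Submodule.span K (P '' (partitionsOf d)) :=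
      lowSpan_le fun ν hν => Submodule.subset_span
        ⟨ν, by simp [hν.1.1, mem_partitionsOf.1 hμ], rfl⟩
    have := Submodule.add_mem _ (h2 h1) (Submodule.subset_span ⟨μ, hμ, rfl⟩)
    rwa [sub_add_cancel] at this
  have hf' : f ∈ Submodule.span K (P '' (partitionsOf d)) := by
    rw [eq_sum_mSym hf]
    exact Submodule.sum_mem _ fun μ hμ => Submodule.smul_mem _ _ (hm μ hμ)
  obtain ⟨c, hc⟩ := (Submodule.mem_span_image_finset_iff_exists_fun K).1 hf'
  classical
  refine ⟨fun μ => if h : μ ∈ partitionsOf d then c ⟨μ, h⟩ else 0, ?_⟩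
  rw [← hc, ← Finset.sum_coe_sort (partitionsOf d)]
  exact Finset.sum_congr rfl fun μ _ => by simp

theorem linearIndependent_of_triangular_mSym
    (hP : ∀ ν, P ν - mSym K ν ∈ lowSpan K DominanceLT (mSym K) ν) : LinearIndependent K P :=
  linearIndependent_of_triangular DominanceLT.rank_lt linearIndependent_mSym hP

/-- The smaller partition is the longer one. Consequently, evaluation in `n` variables kills a
triangular `P_ν` with more than `n` parts, and preserves triangularity among the others. -/
theorem DominanceLE.colLen_le {μ ν : YoungDiagram} (h : DominanceLE μ ν) :
    ν.colLen 0 ≤ μ.colLen 0 := by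
  by_contra! hlt
  have h1 := h.2 (μ.colLen 0)
  rw [← card_eq_sum_rowLen μ le_rfl, h.1] at h1
  have h2 : ∑ i ∈ Finset.range (μ.colLen 0 + 1), ν.rowLen i ≤ ν.card := sum_rowLen_le_card _ _
  rw [Finset.sum_range_succ] at h2
  have h3 : ν.rowLen (μ.colLen 0) ≠ 0 := fun h0 => by
    rw [rowLen_eq_zero_iff] at h0
    omega
  omega

theorem ev_mem_of_mem_lowSpan {n : ℕ} {f : SymFun K} {ν : YoungDiagram} {S : Submodule K _}
    (hf : f ∈ lowSpan K DominanceLT (mSym K) ν)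
    (h : ∀ μ, DominanceLT μ ν → μ.colLen 0 ≤ n → mono K n μ ∈ S) : ev K n f ∈ S := by
  have : lowSpan K DominanceLT (mSym K) ν ≤ S.comap (ev K n).toLinearMap :=
    lowSpan_le fun μ hμ => by
      rw [Submodule.mem_comap, AlgHom.toLinearMap_apply, ev_mSym]
      by_cases hn : μ.colLen 0 ≤ n
      · exact h μ hμ hn
      · rw [mono_eq_zero (not_le.1 hn)]
        exact Submodule.zero_mem _
  exact this hf

theorem ev_eq_zero_of_triangular {n : ℕ} {f : SymFun K} {ν : YoungDiagram}
    (h : f - mSym K ν ∈ lowSpan K DominanceLT (mSym K) ν) (hn : n < ν.colLen 0) :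
    ev K n f = 0 := by
  have h1 := ev_mem_of_mem_lowSpan (n := n) (S := ⊥) h fun μ hμ hμn =>
    absurd (hμ.1.colLen_le) (by omega)
  rwa [map_sub, ev_mSym, mono_eq_zero hn, sub_zero, Submodule.mem_bot] at h1

theorem coeff_expo_ev_of_triangular {n : ℕ} {f : SymFun K} {ν : YoungDiagram}
    (h : f - mSym K ν ∈ lowSpan K DominanceLT (mSym K) ν) (hn : ν.colLen 0 ≤ n) :
    (ev K n f).coeff (expo n ν) = 1 := by
  classical
  have h1 := ev_mem_of_mem_lowSpan (n := n) (S := LinearMap.ker (lcoeff K (expo n ν))) h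
    fun μ hμ hμn => by
      rw [LinearMap.mem_ker, lcoeff_apply, coeff_expo_mono hn, if_neg hμ.2.symm]
  rw [LinearMap.mem_ker, lcoeff_apply, map_sub, ev_mSym, coeff_sub, coeff_expo_mono hn,
    if_pos rfl] at h1
  exact sub_eq_zero.1 h1

/-- In `n` variables, the members of a triangular family with at most `n` parts are linearly
independent. -/
theorem linearIndependent_ev_of_triangular (n : ℕ)
    (hP : ∀ ν, P ν - mSym K ν ∈ lowSpan K DominanceLT (mSym K) ν) :
    LinearIndependent K fun ν : PartLE n => ev K n (P ν.1) := by
  refine linearIndependent_of_triangular (lt := DomLT n) (r := fun i => dominanceRank i.1)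
    DomLT.rank_lt linearIndependent_monoFam fun ν => ?_
  have h1 := ev_mem_of_mem_lowSpan (n := n) (S := lowSpan K (DomLT n) (monoFam K n) ν) (hP ν.1)
    fun μ hμ hμn => mem_lowSpan (m := monoFam K n) (j := (⟨μ, hμn⟩ : PartLE n)) hμ
  rwa [map_sub, ev_mSym] at h1

end SymTriangular

/-! ### Products of polynomials in two sets of variables -/

section Tens

open MvPolynomial

variable {K : Type*} [Field K] {n : ℕ}

/-- The product `f(x) g(y)`. -/
def tens (K : Type*) [Field K] (n : ℕ) : MvPolynomial (Fin n) K →ₗ[K] MvPolynomial (Fin n) K →ₗ[K]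
    MvPolynomial (Fin n ⊕ Fin n) K :=
  (LinearMap.mul K (MvPolynomial (Fin n ⊕ Fin n) K)).compl₁₂ (rename Sum.inl).toLinearMap
    (rename Sum.inr).toLinearMap

theorem tens_apply (f g : MvPolynomial (Fin n) K) :
    tens K n f g = rename Sum.inl f * rename Sum.inr g := rfl

theorem rename_swap_tens (f g : MvPolynomial (Fin n) K) :
    rename Sum.swap (tens K n f g) = tens K n g f := by
  rw [tens_apply, tens_apply, map_mul, rename_rename, rename_rename, mul_comm]
  rfl

theorem sumAlgEquiv_tens (f g : MvPolynomial (Fin n) K) :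
    sumAlgEquiv K (Fin n) (Fin n) (tens K n f g) = map C f * C g := by
  have h1 := DFunLike.congr_fun (sumAlgEquiv_comp_rename_inl (R := K) (S₁ := Fin n) (S₂ := Fin n)) f
  have h2 := DFunLike.congr_fun (sumAlgEquiv_comp_rename_inr (R := K) (S₁ := Fin n) (S₂ := Fin n)) g
  rw [tens_apply, map_mul]
  exact congrArg₂ (· * ·) h1 h2

theorem coeff_sumAlgEquiv_tens (f g : MvPolynomial (Fin n) K) (α : Fin n →₀ ℕ) :
    (sumAlgEquiv K (Fin n) (Fin n) (tens K n f g)).coeff α = f.coeff α • g := by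
  rw [sumAlgEquiv_tens, mul_comm, coeff_C_mul, coeff_map, smul_eq_C_mul, mul_comm]

/-- The relation is read as a polynomial in `x` with coefficients in the polynomials in `y`, and the
independence of `v` is used once for each set of variables. -/
theorem tens_indep {ι : Type*} {v : ι → MvPolynomial (Fin n) K} {s : Finset ι}
    (hv : LinearIndepOn K v s) {c : ι → ι → K}
    (h : ∑ i ∈ s, ∑ j ∈ s, c i j • tens K n (v i) (v j) = 0) :
    ∀ i ∈ s, ∀ j ∈ s, c i j = 0 := by
  rw [linearIndepOn_finset_iff] at hv
  intro i hi j hj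
  refine hv (fun i => c i j) ?_ i hi
  ext α
  have h1 := congrArg (fun f => (sumAlgEquiv K (Fin n) (Fin n) f).coeff α) h
  simp only [map_sum, map_smul, coeff_sum, coeff_smul, coeff_sumAlgEquiv_tens, map_zero,
    coeff_zero] at h1
  rw [Finset.sum_comm] at h1
  have h2 := hv (fun j => ∑ i ∈ s, c i j * (v i).coeff α) (by
    rw [← h1]
    refine Finset.sum_congr rfl fun j _ => ?_
    rw [Finset.sum_smul]
    exact Finset.sum_congr rfl fun i _ => by rw [smul_smul]) j hj
  simpa [coeff_sum] using h2

theorem tens_indep_diag {ι : Type*} [DecidableEq ι] {v : ι → MvPolynomial (Fin n) K} {s : Finset ι}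
    (hv : LinearIndepOn K v s) {c c' : ι → K}
    (h : ∑ i ∈ s, c i • tens K n (v i) (v i) = ∑ i ∈ s, c' i • tens K n (v i) (v i)) :
    ∀ i ∈ s, c i = c' i := by
  intro i hi
  have h1 := tens_indep hv (c := fun i j => if i = j then c i - c' i else 0) (by
    rw [← sub_eq_zero, ← Finset.sum_sub_distrib] at h
    rw [← h]
    refine Finset.sum_congr rfl fun i hi => ?_
    rw [Finset.sum_eq_single i (fun j _ hj => by rw [if_neg hj.symm, zero_smul])
      (fun h => absurd hi h), if_pos rfl, sub_smul]) i hi i hi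
  rw [if_pos rfl] at h1
  exact sub_eq_zero.1 h1

theorem shiftHom_rename_inl (q : K) (I : Finset (Fin n)) (f : MvPolynomial (Fin n) K) :
    shiftHom q Sum.inl I (rename Sum.inl f : MvPolynomial (Fin n ⊕ Fin n) K) =
      rename Sum.inl (shiftHom q id I f) := by
  classical
  have : (shiftHom q (Sum.inl : Fin n → Fin n ⊕ Fin n) I).comp (rename Sum.inl) =
      (rename Sum.inl).comp (shiftHom q id I) := by
    refine algHom_ext fun i => ?_
    rw [AlgHom.comp_apply, AlgHom.comp_apply, rename_X, shiftHom_X_inl, shiftHom, scaleHom, aeval_X,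
      map_mul, rename_X, rename_C]
    simp
  exact DFunLike.congr_fun this f

theorem shiftHom_rename_inr (q : K) (I : Finset (Fin n)) (f : MvPolynomial (Fin n) K) :
    shiftHom q Sum.inl I (rename Sum.inr f : MvPolynomial (Fin n ⊕ Fin n) K) =
      rename Sum.inr f := by
  have : (shiftHom q (Sum.inl : Fin n → Fin n ⊕ Fin n) I).comp (rename Sum.inr) =
      (rename Sum.inr) := by
    refine algHom_ext fun i => ?_
    rw [AlgHom.comp_apply, rename_X, shiftHom_X_inr]
  exact DFunLike.congr_fun this f

theorem macOp_tens (q t X : K) (f g : MvPolynomial (Fin n) K) :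
    macOp q t X Sum.inl (tens K n f g) = tens K n (macOp q t X id f) g := by
  rw [macOp_apply, macOp_apply, map_sum, LinearMap.sum_apply]
  refine Finset.sum_congr rfl fun w _ => ?_
  rw [map_smul, LinearMap.smul_apply]
  congr 1
  rw [tens_apply, tens_apply, map_mul, map_prod, map_sum, mul_assoc, Finset.sum_mul]
  congr 1
  · exact Finset.prod_congr rfl fun i _ => by rw [map_pow, rename_X]; rfl
  · refine Finset.sum_congr rfl fun I _ => ?_
    rw [map_mul, shiftHom_rename_inl, shiftHom_rename_inr, map_smul, smul_mul_assoc]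

theorem vanderOp_inr_tens (f g : MvPolynomial (Fin n) K) :
    vanderOp K Sum.inr (tens K n f g) = tens K n f (vanderOp K id g) := by
  rw [vanderOp, vanderOp, LinearMap.mulLeft_apply, LinearMap.mulLeft_apply, tens_apply, tens_apply,
    map_mul, mul_left_comm, Matrix.det_vandermonde, Matrix.det_vandermonde]
  simp [map_prod]

theorem vanderOp_injective {σ : Type*} {x : Fin n → σ} (hx : Function.Injective x) :
    Function.Injective (vanderOp K x) := by
  have h : (Matrix.vandermonde fun i => (MvPolynomial.X (x i) : MvPolynomial σ K)).det ≠ 0 :=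
    Matrix.det_vandermonde_ne_zero_iff.2 fun i j hij => hx (X_injective hij)
  exact fun f g hfg => mul_left_cancel₀ h hfg

theorem tens_vanderOp (f g : MvPolynomial (Fin n) K) :
    tens K n (vanderOp K id f) g = vanderOp K Sum.inl (tens K n f g) := by
  rw [← macOp_zero 0 0, ← macOp_zero 0 0, macOp_tens]

theorem kerDeg_eq (q t : K) (n d : ℕ) : kerDeg q t n d = ∑ α ∈ expsOf d, (powerSumNorm q t α)⁻¹ •
    tens K n (ev K n (monomial α 1)) (ev K n (monomial α 1)) := by
  rw [kerDeg, expCoeff]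
  refine Finset.sum_congr rfl fun α _ => ?_
  have hk : ∀ k : ℕ+, ∀ a : ℕ, ((a.factorial : K))⁻¹ • kerWeight q t n k ^ a =
      C ((((k : ℕ) : K) ^ a * (a.factorial : K) *
        ((1 - q ^ (k : ℕ)) / (1 - t ^ (k : ℕ))) ^ a)⁻¹) *
        (rename Sum.inl (psum (Fin n) K k) ^ a * rename Sum.inr (psum (Fin n) K k) ^ a) :=
    fun k a => by
    rw [kerWeight, smul_pow, smul_smul, smul_eq_C_mul, mul_pow (rename _ _)]
    congr 2
    rw [mul_inv, mul_inv, mul_pow, inv_pow, ← inv_pow (_ / _), inv_div]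
    ring
  simp only [expTerm, hk]
  rw [Finsupp.prod_mul, Finsupp.prod_mul, tens_apply, ev, aeval_monomial, map_one, one_mul,
    smul_eq_C_mul, powerSumNorm, Finsupp.prod, Finsupp.prod, Finsupp.prod, Finsupp.prod,
    ← Finset.prod_inv_distrib, map_prod, Finsupp.prod, map_prod, map_prod]
  simp only [map_pow]

end Tens

/-! ### Existence and uniqueness of Macdonald polynomials -/

section Existence

open MvPolynomial

variable {K : Type*} [Field K] {q t : K} {P : YoungDiagram → SymFun K}

theorem scalarProduct_eq_sum (q t : K) {f : SymFun K} {d : ℕ} (hf : IsWeightedHomogeneous pwt f d)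
    (g : SymFun K) :
    scalarProduct q t f g = ∑ α ∈ expsOf d, f.coeff α * g.coeff α * powerSumNorm q t α := by
  refine Finset.sum_subset (fun α hα => ?_) fun α _ hα => ?_
  · exact mem_expsOf.2 (hf (mem_support_iff.1 hα))
  · rw [notMem_support_iff.1 hα, zero_mul, zero_mul]

theorem scalarProduct_comm (q t : K) (f g : SymFun K) :
    scalarProduct q t f g = scalarProduct q t g f := by
  classical
  have h : ∀ f g : SymFun K, scalarProduct q t f g =
      ∑ α ∈ f.support ∪ g.support, f.coeff α * g.coeff α * powerSumNorm q t α := fun f g =>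
    Finset.sum_subset Finset.subset_union_left fun α _ hα => by
      rw [notMem_support_iff.1 hα, zero_mul, zero_mul]
  rw [h f g, h g f, Finset.union_comm]
  exact Finset.sum_congr rfl fun α _ => by rw [mul_comm (f.coeff α)]

theorem scalarProduct_eq_zero_of_homogeneous (q t : K) {f g : SymFun K} {d e : ℕ}
    (hf : IsWeightedHomogeneous pwt f d) (hg : IsWeightedHomogeneous pwt g e) (h : d ≠ e) :
    scalarProduct q t f g = 0 := by
  refine Finset.sum_eq_zero fun α hα => ?_
  have h1 := hf (mem_support_iff.1 hα)
  have h2 : g.coeff α = 0 := by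
    by_contra h0
    exact h (h1.symm.trans (hg h0))
  rw [h2, mul_zero, zero_mul]

/-- Macdonald's scalar product as a bilinear form. -/
def scalarForm (q t : K) : SymFun K →ₗ[K] SymFun K →ₗ[K] K :=
  LinearMap.mk₂ K (scalarProduct q t)
    (fun f f' g => by
      rw [scalarProduct_comm, scalarProduct_comm q t f, scalarProduct_comm q t f', scalarProduct,
        scalarProduct, scalarProduct, ← Finset.sum_add_distrib]
      exact Finset.sum_congr rfl fun α _ => by rw [coeff_add]; ring)
    (fun c f g => by
      rw [scalarProduct_comm, scalarProduct_comm q t f, scalarProduct, scalarProduct, smul_eq_mul,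
        Finset.mul_sum]
      exact Finset.sum_congr rfl fun α _ => by rw [coeff_smul, smul_eq_mul]; ring)
    (fun f g g' => by
      rw [scalarProduct, scalarProduct, scalarProduct, ← Finset.sum_add_distrib]
      exact Finset.sum_congr rfl fun α _ => by rw [coeff_add]; ring)
    (fun c f g => by
      rw [scalarProduct, scalarProduct, smul_eq_mul, Finset.mul_sum]
      exact Finset.sum_congr rfl fun α _ => by rw [coeff_smul, smul_eq_mul]; ring)

theorem scalarForm_apply (f g : SymFun K) : scalarForm q t f g = scalarProduct q t f g := rfl

theorem eq_sum_monomial {f : SymFun K} {d : ℕ} (hf : IsWeightedHomogeneous pwt f d) :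
    f = ∑ α ∈ expsOf d, f.coeff α • monomial α 1 := by
  conv_lhs => rw [f.as_sum]
  refine (Finset.sum_subset (fun α hα => mem_expsOf.2 (hf (mem_support_iff.1 hα)))
    fun α _ hα => by rw [notMem_support_iff.1 hα, map_zero]).trans ?_
  exact Finset.sum_congr rfl fun α _ => by rw [smul_monomial, smul_eq_mul, mul_one]

variable [CharZero K]

theorem macOp_ev_mSym_sub_mem (q t X : K) (n : ℕ) (ν : YoungDiagram) :
    macOp q t X id (ev K n (mSym K ν)) - eigenval q t X n ν • vanderOp K id (ev K n (mSym K ν)) ∈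
      (lowSpan K DominanceLT (mSym K) ν).map ((vanderOp K id).comp (ev K n).toLinearMap) := by
  rw [ev_mSym]
  by_cases hn : ν.colLen 0 ≤ n
  · have h := macOp_mono_sub_mem (K := K) q t X (⟨ν, hn⟩ : PartLE n)
    rw [Submodule.map_comp]
    refine Submodule.map_mono (lowSpan_le fun μ hμ => ?_) h
    exact ⟨mSym K μ.1, mem_lowSpan (m := mSym K) hμ, ev_mSym n μ.1⟩
  · rw [mono_eq_zero (not_le.1 hn), map_zero, map_zero, smul_zero, sub_zero]
    exact Submodule.zero_mem _

theorem macOp_ev_sub_mem (X : K) (n : ℕ)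
    (hP : ∀ ν, P ν - mSym K ν ∈ lowSpan K DominanceLT (mSym K) ν) (ν : YoungDiagram) :
    macOp q t X id (ev K n (P ν)) - eigenval q t X n ν • vanderOp K id (ev K n (P ν)) ∈
      (lowSpan K DominanceLT P ν).map ((vanderOp K id).comp (ev K n).toLinearMap) := by
  rw [lowSpan_eq DominanceLT.trans DominanceLT.rank_lt hP]
  let J : SymFun K →ₗ[K] MvPolynomial (Fin n) K := (vanderOp K id).comp (ev K n).toLinearMap
  let D : SymFun K →ₗ[K] MvPolynomial (Fin n) K := (macOp q t X id).comp (ev K n).toLinearMap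
  have hlow : lowSpan K DominanceLT (mSym K) ν ≤
      ((lowSpan K DominanceLT (mSym K) ν).map J).comap D := lowSpan_le fun μ hμ => by
    have h1 := Submodule.map_mono (f := J) (lowSpan_mono DominanceLT.trans hμ)
      (macOp_ev_mSym_sub_mem q t X n μ)
    have h2 : eigenval q t X n μ • J (mSym K μ) ∈ (lowSpan K DominanceLT (mSym K) ν).map J :=
      Submodule.smul_mem _ _ (Submodule.mem_map_of_mem (mem_lowSpan hμ))
    have h3 := Submodule.add_mem _ h1 h2
    rw [LinearMap.comp_apply, AlgHom.toLinearMap_apply, sub_add_cancel] at h3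
    exact h3
  have h1 := macOp_ev_mSym_sub_mem q t X n ν
  have h2 := hlow (hP ν)
  have h3 : eigenval q t X n ν • J (P ν - mSym K ν) ∈ (lowSpan K DominanceLT (mSym K) ν).map J :=
    Submodule.smul_mem _ _ (Submodule.mem_map_of_mem (hP ν))
  have h4 := Submodule.sub_mem _ (Submodule.add_mem _ h1 h2) h3
  convert h4 using 1
  simp only [D, J, LinearMap.comp_apply, AlgHom.toLinearMap_apply, map_sub, smul_sub]
  abel

/-- Degree `d` is treated in `d` variables with one separating `X`; all other `n` and `X` are
recovered later in `IsKernelFamily.macOp_ev`. -/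
theorem exists_triangular_eigenfamily (h : MulIndep q t) : ∃ P : YoungDiagram → SymFun K,
    (∀ ν, P ν - mSym K ν ∈ lowSpan K DominanceLT (mSym K) ν) ∧
    ∀ d, ∃ X : K, (∀ μ ∈ partitionsOf d, ∀ ν ∈ partitionsOf d, μ ≠ ν →
      eigenval q t X d μ ≠ eigenval q t X d ν) ∧
      ∀ ν ∈ partitionsOf d, macOp q t X id (ev K d (P ν)) =
        eigenval q t X d ν • vanderOp K id (ev K d (P ν)) := by
  have hp : ∀ d, ∀ μ ∈ partitionsOf d, μ ∈ partitionsLE d d := fun d μ hμ => by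
    rw [mem_partitionsOf] at hμ
    exact mem_partitionsLE.2 ⟨hμ, hμ ▸ colLen_zero_le_card μ⟩
  choose X hX using fun d => h.exists_eigenval_ne d d
  have hex := fun ν : YoungDiagram => exists_eigenvector DominanceLT.trans DominanceLT.rank_lt
    (m := mSym K) (J := (vanderOp K id).comp (ev K ν.card).toLinearMap)
    (D := (macOp q t (X ν.card) id).comp (ev K ν.card).toLinearMap)
    (macOp_ev_mSym_sub_mem q t (X ν.card) ν.card) ν fun μ hμ =>
      hX _ μ (hp _ _ (mem_partitionsOf.2 hμ.1.1)) ν (hp _ _ (mem_partitionsOf.2 rfl)) hμ.2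
  choose P hP hP' using hex
  refine ⟨P, hP, fun d => ⟨X d, fun μ hμ ν hν => hX d μ (hp d μ hμ) ν (hp d ν hν), ?_⟩⟩
  intro ν hν
  rw [← mem_partitionsOf.1 hν]
  exact hP' ν

/-- The power sums are expanded in the `P_μ` before evaluation, so the coefficients do not depend on
the number `n` of variables. -/
theorem exists_kerDeg_eq (q t : K)
    (hP : ∀ ν, P ν - mSym K ν ∈ lowSpan K DominanceLT (mSym K) ν) (d : ℕ) :
    ∃ c : YoungDiagram → YoungDiagram → K, (∀ μ ν, c μ ν = c ν μ) ∧
      ∀ n, kerDeg q t n d = ∑ μ ∈ partitionsOf d, ∑ ν ∈ partitionsOf d,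
        c μ ν • tens K n (ev K n (P μ)) (ev K n (P ν)) := by
  choose a ha using fun α : ℕ+ →₀ ℕ => exists_eq_sum_of_triangular hP
    (isWeightedHomogeneous_monomial pwt α (1 : K) rfl)
  refine ⟨fun μ ν => ∑ α ∈ expsOf d, (powerSumNorm q t α)⁻¹ * (a α μ * a α ν),
    fun μ ν => Finset.sum_congr rfl fun α _ => by ring, fun n => ?_⟩
  · rw [kerDeg_eq]
    have h1 : ∀ α ∈ expsOf d, (powerSumNorm q t α)⁻¹ •
        tens K n (ev K n (monomial α 1)) (ev K n (monomial α 1)) =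
        ∑ μ ∈ partitionsOf d, ∑ ν ∈ partitionsOf d,
          ((powerSumNorm q t α)⁻¹ * (a α μ * a α ν)) •
            tens K n (ev K n (P μ)) (ev K n (P ν)) := fun α hα => by
      rw [ha α, mem_expsOf.1 hα]
      simp only [map_sum, map_smul, LinearMap.sum_apply, LinearMap.smul_apply, Finset.smul_sum,
        smul_smul]
      rw [Finset.sum_comm]
      exact Finset.sum_congr rfl fun μ _ => Finset.sum_congr rfl fun ν _ => by
        congr 1; ring
    rw [Finset.sum_congr rfl h1, Finset.sum_comm]
    refine Finset.sum_congr rfl fun μ hμ => ?_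
    rw [Finset.sum_comm]
    refine Finset.sum_congr rfl fun ν hν => ?_
    rw [Finset.sum_smul]

theorem linearIndepOn_ev_of_triangular (n d : ℕ)
    (hP : ∀ ν, P ν - mSym K ν ∈ lowSpan K DominanceLT (mSym K) ν) :
    LinearIndepOn K (fun ν => ev K n (P ν)) (partitionsLE n d) := by
  have h : LinearIndepOn K (fun ν => ev K n (P ν)) {ν | ν.colLen 0 ≤ n} :=
    linearIndependent_ev_of_triangular n hP
  exact h.mono fun _ hν => (mem_partitionsLE.1 hν).2

theorem sum_partitionsOf_eq {n d : ℕ} {M : Type*} [AddCommMonoid M] {F : YoungDiagram → M}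
    (hF : ∀ ν, n < ν.colLen 0 → F ν = 0) :
    ∑ ν ∈ partitionsOf d, F ν = ∑ ν ∈ partitionsLE n d, F ν := by
  refine (Finset.sum_subset (fun ν hν => mem_partitionsOf.2 (mem_partitionsLE.1 hν).1)
    fun ν hν hν' => hF ν ?_).symm
  rw [mem_partitionsLE, not_and, not_le] at hν'
  exact hν' (mem_partitionsOf.1 hν)

theorem partitionsLE_self (d : ℕ) : partitionsLE d d = partitionsOf d := by
  ext μ
  simp only [mem_partitionsLE, mem_partitionsOf, and_iff_left_iff_imp]
  rintro rfl
  exact colLen_zero_le_card μ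

/-- Self-adjointness of Macdonald's operator, in coordinates. -/
theorem coeff_mul_symm (h : MulIndep q t) {n d : ℕ} {s : Finset YoungDiagram}
    (hs : LinearIndepOn K (fun ν => ev K n (P ν)) s) {X : K} {c D : YoungDiagram → YoungDiagram → K}
    (hker : kerDeg q t n d = ∑ μ ∈ s, ∑ ν ∈ s, c μ ν • tens K n (ev K n (P μ)) (ev K n (P ν)))
    (hD : ∀ μ ∈ s, macOp q t X id (ev K n (P μ)) =
      ∑ ρ ∈ s, D μ ρ • vanderOp K id (ev K n (P ρ))) {ρ ν : YoungDiagram} (hρ : ρ ∈ s)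
    (hν : ν ∈ s) : ∑ μ ∈ s, c μ ν * D μ ρ = ∑ μ ∈ s, c μ ρ * D μ ν := by
  have h1 : vanderOp K Sum.inr (macOp q t X Sum.inl (kerDeg q t n d)) =
      ∑ ρ ∈ s, ∑ ν ∈ s, (∑ μ ∈ s, c μ ν * D μ ρ) •
        tens K n (vanderOp K id (ev K n (P ρ))) (vanderOp K id (ev K n (P ν))) := by
    rw [hker]
    simp only [map_sum, map_smul, macOp_tens, vanderOp_inr_tens]
    have h2 : ∀ μ ∈ s, ∀ ν, c μ ν • tens K n (macOp q t X id (ev K n (P μ)))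
        (vanderOp K id (ev K n (P ν))) = ∑ ρ ∈ s, (c μ ν * D μ ρ) •
        tens K n (vanderOp K id (ev K n (P ρ))) (vanderOp K id (ev K n (P ν))) := fun μ hμ ν => by
      rw [hD μ hμ]
      simp only [map_sum, map_smul, LinearMap.sum_apply, LinearMap.smul_apply, Finset.smul_sum,
        smul_smul]
    rw [Finset.sum_congr rfl fun μ hμ => (Finset.sum_congr rfl fun ν _ => h2 μ hμ ν).trans
      Finset.sum_comm, Finset.sum_comm]
    refine Finset.sum_congr rfl fun ρ _ => ?_
    rw [Finset.sum_comm]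
    exact Finset.sum_congr rfl fun ν _ => (Finset.sum_smul ..).symm
  -- Exchanging the two sets of variables transposes the coefficient matrix of the image of the
  -- kernel, which must therefore be symmetric.
  have h2 := rename_swap_macOp_kerDeg (n := n) h.q_pow_ne_one t X d
  rw [h1, map_sum] at h2
  simp only [map_sum, map_smul, rename_swap_tens] at h2
  rw [Finset.sum_comm, ← sub_eq_zero, ← Finset.sum_sub_distrib] at h2
  simp only [← Finset.sum_sub_distrib, ← sub_smul] at h2
  have hJ : LinearIndepOn K (fun ν => vanderOp K id (ev K n (P ν))) s := by
    rw [linearIndepOn_finset_iff] at hs ⊢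
    intro f hf
    refine hs f (vanderOp_injective (K := K) (x := (id : Fin n → Fin n)) Function.injective_id ?_)
    simpa only [map_sum, map_smul, map_zero] using hf
  exact sub_eq_zero.1 ((Finset.sum_sub_distrib ..).symm.trans (tens_indep hJ h2 ν hν ρ hρ))

/-- Self-adjointness gives `c_{μν} (e_μ - e_ν) = 0` with distinct eigenvalues. The off-diagonal
coefficients are shown to vanish in `d` variables, and this is enough for every `n`. -/
theorem ker_diagonal_of_eigenfamily (h : MulIndep q t) {d : ℕ}
    (hP : ∀ ν, P ν - mSym K ν ∈ lowSpan K DominanceLT (mSym K) ν) {X : K}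
    (hX : ∀ μ ∈ partitionsOf d, ∀ ν ∈ partitionsOf d, μ ≠ ν →
      eigenval q t X d μ ≠ eigenval q t X d ν)
    (hD : ∀ ν ∈ partitionsOf d, macOp q t X id (ev K d (P ν)) =
        eigenval q t X d ν • vanderOp K id (ev K d (P ν))) :
    ∃ b : YoungDiagram → K, ∀ n, kerDeg q t n d =
      ∑ μ ∈ partitionsOf d, b μ • tens K n (ev K n (P μ)) (ev K n (P μ)) := by
  classical
  obtain ⟨c, hc, hker⟩ := exists_kerDeg_eq q t hP d
  have hdiag : ∀ μ ∈ partitionsOf d, ∀ ν ∈ partitionsOf d, μ ≠ ν → c μ ν = 0 := by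
    intro μ hμ ν hν hne
    have h1 := coeff_mul_symm h (n := d) (d := d) (P := P) (s := partitionsOf d) (X := X) (c := c)
      (D := fun μ ρ => if μ = ρ then eigenval q t X d μ else 0)
      (by rw [← partitionsLE_self]; exact linearIndepOn_ev_of_triangular d d hP) (hker d)
      (fun μ hμ => by
        rw [hD μ hμ, Finset.sum_eq_single μ (fun ν _ hν => by rw [if_neg hν.symm, zero_smul])
          (fun h => absurd hμ h), if_pos rfl]) hμ hν
    simp only [mul_ite, mul_zero, Finset.sum_ite_eq', hμ, hν, if_true] at h1
    rw [hc ν μ, ← sub_eq_zero, ← mul_sub] at h1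
    exact (mul_eq_zero.1 h1).resolve_right (sub_ne_zero.2 (hX μ hμ ν hν hne))
  refine ⟨fun μ => c μ μ, fun n => ?_⟩
  rw [hker]
  refine Finset.sum_congr rfl fun μ hμ => ?_
  exact Finset.sum_eq_single μ (fun ν hν hne => by rw [hdiag μ hμ ν hν hne.symm, zero_smul])
    (fun h => absurd hμ h)

theorem linearIndepOn_ev_monomial (d : ℕ) :
    LinearIndepOn K (fun α : ℕ+ →₀ ℕ => ev K d (monomial α 1)) (expsOf d) := by
  classical
  rw [linearIndepOn_finset_iff]
  intro f hf α hα
  have h0 : ∑ α ∈ expsOf d, f α • (monomial α 1 : SymFun K) = 0 := by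
    refine ev_eq_zero_of_homogeneous (d := d) le_rfl ?_ (by simpa only [map_sum, map_smul] using hf)
    rw [← mem_weightedHomogeneousSubmodule]
    exact Submodule.sum_mem _ fun α hα => Submodule.smul_mem _ _
      ((mem_weightedHomogeneousSubmodule _ _ _ _).2
        (isWeightedHomogeneous_monomial pwt α 1 (mem_expsOf.1 hα)))
  have h1 := congrArg (coeff α) h0
  simp only [coeff_sum, coeff_smul, coeff_monomial, coeff_zero, smul_eq_mul, mul_ite, mul_one,
    mul_zero, Finset.sum_ite_eq', hα, if_true] at h1
  exact h1

/-- The coefficients of a diagonal form of the kernel are the inverses of the norms. -/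
theorem mul_scalarProduct_of_ker_diagonal [DecidableEq YoungDiagram] (h : MulIndep q t) {d : ℕ}
    (hP : ∀ ν, P ν - mSym K ν ∈ lowSpan K DominanceLT (mSym K) ν) {b : YoungDiagram → K}
    (hb : kerDeg q t d d = ∑ μ ∈ partitionsOf d, b μ • tens K d (ev K d (P μ)) (ev K d (P μ)))
    {μ ν : YoungDiagram} (hμ : μ ∈ partitionsOf d) (hν : ν ∈ partitionsOf d) :
    b ν * scalarProduct q t (P μ) (P ν) = if μ = ν then 1 else 0 := by
  classical
  have hhom : ∀ μ ∈ partitionsOf d, IsWeightedHomogeneous pwt (P μ) d := fun μ hμ => by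
    rw [← mem_partitionsOf.1 hμ]
    exact isWeightedHomogeneous_of_triangular (hP μ)
  -- Both forms of the kernel are compared in the basis of power sum products: if `C` is the
  -- coefficient matrix of the `P_μ`, then `Cᵀ diag(b) C = diag(z⁻¹)`.
  have h1 : ∀ α ∈ expsOf d, ∀ β ∈ expsOf d, ∑ μ ∈ partitionsOf d,
      b μ * ((P μ).coeff α * (P μ).coeff β) -
        (if α = β then (powerSumNorm q t α)⁻¹ else 0) = 0 := by
    refine tens_indep (linearIndepOn_ev_monomial d) ?_
    have h2 : ∀ μ ∈ partitionsOf d, b μ • tens K d (ev K d (P μ)) (ev K d (P μ)) =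
        ∑ α ∈ expsOf d, ∑ β ∈ expsOf d, (b μ * ((P μ).coeff α * (P μ).coeff β)) •
          tens K d (ev K d (monomial α 1)) (ev K d (monomial β 1)) := fun μ hμ => by
      conv_lhs => rw [eq_sum_monomial (hhom μ hμ)]
      simp only [map_sum, map_smul, LinearMap.sum_apply, LinearMap.smul_apply, Finset.smul_sum,
        smul_smul]
      rw [Finset.sum_comm]
      exact Finset.sum_congr rfl fun μ _ => Finset.sum_congr rfl fun ν _ => by
        congr 1; ring
    rw [kerDeg_eq, Finset.sum_congr rfl h2, Finset.sum_comm] at hb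
    rw [← sub_eq_zero.2 hb.symm, ← Finset.sum_sub_distrib]
    refine Finset.sum_congr rfl fun α hα => ?_
    rw [Finset.sum_comm]
    simp only [sub_smul, Finset.sum_sub_distrib, Finset.sum_smul, ite_smul, zero_smul,
      Finset.sum_ite_eq, hα, if_true]
  -- The kernel reproduces every function under the scalar product; linear independence of the `P_ν`
  -- then reads off the pairings.
  have h3 : ∀ μ ∈ partitionsOf d, ∑ ν ∈ partitionsOf d,
      (b ν * scalarProduct q t (P μ) (P ν)) • P ν = P μ := fun μ hμ => by
    ext β
    by_cases hβ : β ∈ expsOf d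
    · simp only [coeff_sum, coeff_smul, smul_eq_mul, scalarProduct_eq_sum q t (hhom μ hμ),
        Finset.mul_sum, Finset.sum_mul]
      rw [Finset.sum_comm]
      have h4 : ∀ α ∈ expsOf d, ∑ ν ∈ partitionsOf d,
          b ν * ((P μ).coeff α * (P ν).coeff α * powerSumNorm q t α) * (P ν).coeff β =
          if α = β then (P μ).coeff α else 0 := fun α hα => by
        have h5 := sub_eq_zero.1 (h1 α hα β hβ)
        calc _ = (P μ).coeff α * powerSumNorm q t α * ∑ ν ∈ partitionsOf d,
              b ν * ((P ν).coeff α * (P ν).coeff β) := by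
              rw [Finset.mul_sum]
              exact Finset.sum_congr rfl fun ν _ => by ring
          _ = _ := by
              rw [h5]
              split_ifs
              · rw [mul_assoc, mul_inv_cancel₀ (h.powerSumNorm_ne_zero α), mul_one]
              · rw [mul_zero]
      rw [Finset.sum_congr rfl h4, Finset.sum_ite_eq', if_pos hβ]
    · have h0 : ∀ ν ∈ partitionsOf d, (P ν).coeff β = 0 := fun ν hν => by
        by_contra hne
        exact hβ (mem_expsOf.2 (hhom ν hν hne))
      rw [h0 μ hμ, coeff_sum]
      exact Finset.sum_eq_zero fun ν hν => by rw [coeff_smul, h0 ν hν, smul_zero]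
  have h4 := h3 μ hμ
  have hli := (linearIndependent_iff'.1 (linearIndependent_of_triangular_mSym hP))
    (partitionsOf d) (fun ν => b ν * scalarProduct q t (P μ) (P ν) - if μ = ν then 1 else 0)
    (by simp only [sub_smul, Finset.sum_sub_distrib, h4, ite_smul, one_smul, zero_smul,
          Finset.sum_ite_eq, hμ, if_true, sub_self]) ν hν
  exact sub_eq_zero.1 hli

/-- The difference `P' ν - P ν` is a combination of lower `P μ`. By induction `P μ = P' μ`, which is
orthogonal to `P' ν`, while `P μ` is orthogonal to `P ν`; as the norms do not vanish, all
coefficients are zero. -/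
theorem triangular_family_unique {P' : YoungDiagram → SymFun K}
    (hP : ∀ ν, P ν - mSym K ν ∈ lowSpan K DominanceLT (mSym K) ν)
    (hP' : ∀ ν, P' ν - mSym K ν ∈ lowSpan K DominanceLT (mSym K) ν)
    (ho : ∀ ν μ, ν ≠ μ → scalarProduct q t (P ν) (P μ) = 0)
    (ho' : ∀ ν μ, ν ≠ μ → scalarProduct q t (P' ν) (P' μ) = 0)
    (hn : ∀ ν, scalarProduct q t (P ν) (P ν) ≠ 0) (ν : YoungDiagram) : P' ν = P ν := by
  induction hν : dominanceRank ν using Nat.strong_induction_on generalizing ν with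
  | _ k ih =>
    subst hν
    have h1 : P' ν - P ν ∈ lowSpan K DominanceLT P ν := by
      rw [lowSpan_eq DominanceLT.trans DominanceLT.rank_lt hP, ← sub_sub_sub_cancel_right _ _
        (mSym K ν)]
      exact Submodule.sub_mem _ (hP' ν) (hP ν)
    rw [lowSpan, Finsupp.mem_span_image_iff_linearCombination] at h1
    obtain ⟨u, hu, h1⟩ := h1
    have h2 : u = 0 := by
      ext μ
      by_contra hμ
      have hμν := hu (Finsupp.mem_support_iff.2 hμ)
      have h3 := congrArg (scalarForm q t (P μ)) h1
      rw [Finsupp.linearCombination_apply, Finsupp.sum, map_sum, map_sub, Finset.sum_eq_single μ,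
        map_smul, scalarForm_apply, scalarForm_apply, scalarForm_apply, ho μ ν hμν.2,
        ← ih _ (DominanceLT.rank_lt _ _ hμν) μ rfl, ho' μ ν hμν.2, sub_zero,
        ih _ (DominanceLT.rank_lt _ _ hμν) μ rfl, smul_eq_mul] at h3
      · exact (mul_ne_zero hμ (hn μ)) h3
      · intro ρ _ hρ
        rw [map_smul, scalarForm_apply, ho μ ρ hρ.symm, smul_zero]
      · intro h
        exact absurd (Finsupp.mem_support_iff.2 hμ) h
    rw [h2, map_zero] at h1
    exact (sub_eq_zero.1 h1.symm)

/-- The properties of Macdonald polynomials that come from the self-adjointness of Macdonald's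
operators. -/
structure IsKernelFamily (q t : K) (P : YoungDiagram → SymFun K) (b : YoungDiagram → K) : Prop where
  triangular : ∀ ν, P ν - mSym K ν ∈ lowSpan K DominanceLT (mSym K) ν
  kernel : ∀ n d, kerDeg q t n d =
    ∑ μ ∈ partitionsOf d, b μ • tens K n (ev K n (P μ)) (ev K n (P μ))
  orthogonal : ∀ ν μ, ν ≠ μ → scalarProduct q t (P ν) (P μ) = 0
  norm : ∀ ν, b ν * scalarProduct q t (P ν) (P ν) = 1

theorem exists_isKernelFamily (h : MulIndep q t) :
    ∃ (P : YoungDiagram → SymFun K) (b : YoungDiagram → K), IsKernelFamily q t P b := by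
  classical
  obtain ⟨P, hP, hX⟩ := exists_triangular_eigenfamily h
  choose X hX hD using hX
  choose b hb using fun d => ker_diagonal_of_eigenfamily h hP (hX d) (hD d)
  have hb' : ∀ n d, kerDeg q t n d =
      ∑ μ ∈ partitionsOf d, b μ.card μ • tens K n (ev K n (P μ)) (ev K n (P μ)) := fun n d => by
    rw [hb d n]
    exact Finset.sum_congr rfl fun μ hμ => by rw [mem_partitionsOf.1 hμ]
  have hs : ∀ ν μ, μ.card = ν.card →
      b ν.card ν * scalarProduct q t (P μ) (P ν) = if μ = ν then 1 else 0 := fun ν μ hc =>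
    mul_scalarProduct_of_ker_diagonal (b := fun ν => b ν.card ν) h hP (hb' ν.card ν.card)
      (mem_partitionsOf.2 hc) (mem_partitionsOf.2 rfl)
  have hn : ∀ ν, b ν.card ν * scalarProduct q t (P ν) (P ν) = 1 := fun ν => by
    rw [hs ν ν rfl, if_pos rfl]
  refine ⟨P, fun μ => b μ.card μ, hP, hb', fun ν μ hne => ?_, hn⟩
  by_cases hc : ν.card = μ.card
  · have h1 := hs μ ν hc
    rw [if_neg hne] at h1
    exact (mul_eq_zero.1 h1).resolve_left (left_ne_zero_of_mul_eq_one (hn μ))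
  · exact scalarProduct_eq_zero_of_homogeneous q t (isWeightedHomogeneous_of_triangular (hP ν))
      (isWeightedHomogeneous_of_triangular (hP μ)) hc

/-- Existence makes the choice in `macP` meaningful, and uniqueness identifies it with the
constructed family. -/
theorem exists_isKernelFamily_macP (h : MulIndep q t) :
    ∃ b : YoungDiagram → K, IsKernelFamily q t (macP q t) b := by
  obtain ⟨P, b, hP⟩ := exists_isKernelFamily h
  have hM : IsMacdonaldFamily q t (macP q t) := Classical.epsilon_spec
    (⟨P, fun ν => triangular_iff.2 (hP.triangular ν), hP.orthogonal⟩ :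
      ∃ P, IsMacdonaldFamily q t P)
  have heq : macP q t = P := funext fun ν =>
    triangular_family_unique hP.triangular (fun ν => triangular_iff.1 (hM.triangular ν))
      hP.orthogonal hM.orthogonal (fun ν => right_ne_zero_of_mul_eq_one (hP.norm ν)) ν
  exact ⟨b, heq ▸ hP⟩

end Existence

/-! ### The norm formula -/

section Norm

open MvPolynomial

variable {K : Type*} [Field K] {q t : K} {P : YoungDiagram → SymFun K}
  {b : YoungDiagram → K} {n : ℕ}

theorem IsKernelFamily.ne_zero [CharZero K] (hP : IsKernelFamily q t P b) (ν : YoungDiagram) :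
    b ν ≠ 0 :=
  left_ne_zero_of_mul_eq_one (hP.norm ν)

theorem IsKernelFamily.kerDeg_eq_sum [CharZero K] (hP : IsKernelFamily q t P b) (n d : ℕ) :
    kerDeg q t n d = ∑ μ ∈ partitionsLE n d, b μ • tens K n (ev K n (P μ)) (ev K n (P μ)) := by
  rw [hP.kernel]
  refine sum_partitionsOf_eq fun ν hν => ?_
  rw [ev_eq_zero_of_triangular (hP.triangular ν) hν, map_zero, smul_zero]

/-- No separation of eigenvalues is needed. The matrix `D` of the operator is triangular for
dominance, and self-adjointness reads `b_ν D_{νρ} = b_ρ D_{ρν}`; a nonzero off-diagonal entry would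
give both `ρ < ν` and `ν < ρ`. -/
theorem IsKernelFamily.macOp_ev [CharZero K] (hP : IsKernelFamily q t P b) (h : MulIndep q t)
    (X : K) (n : ℕ) (ν : YoungDiagram) :
    macOp q t X id (ev K n (P ν)) = eigenval q t X n ν • vanderOp K id (ev K n (P ν)) := by
  classical
  by_cases hn : n < ν.colLen 0
  · rw [ev_eq_zero_of_triangular (hP.triangular ν) hn, map_zero, map_zero, smul_zero]
  rw [not_lt] at hn
  have hex : ∀ μ, ∃ D : YoungDiagram → K, (∀ ρ, D ρ ≠ 0 → DominanceLE ρ μ) ∧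
      D μ = eigenval q t X n μ ∧ (∀ d, μ ∈ partitionsLE n d → macOp q t X id (ev K n (P μ)) =
        ∑ ρ ∈ partitionsLE n d, D ρ • vanderOp K id (ev K n (P ρ))) := fun μ => by
    obtain ⟨f, hf, hf'⟩ := macOp_ev_sub_mem (q := q) (t := t) X n hP.triangular μ
    rw [lowSpan, SetLike.mem_coe, Finsupp.mem_span_image_iff_linearCombination] at hf
    obtain ⟨u, hu, rfl⟩ := hf
    have hu' : ∀ ρ, u ρ ≠ 0 → DominanceLT ρ μ := fun ρ hρ => hu (Finsupp.mem_support_iff.2 hρ)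
    have hμ : u μ = 0 := by
      by_contra h0
      exact (hu' μ h0).2 rfl
    refine ⟨fun ρ => u ρ + if ρ = μ then eigenval q t X n μ else 0, fun ρ hρ => ?_, ?_, ?_⟩
    · by_cases h0 : u ρ = 0
      · by_cases hρμ : ρ = μ
        · rw [hρμ]; exact dominanceLE_refl μ
        · simp [h0, hρμ] at hρ
      · exact (hu' ρ h0).1
    · simp [hμ]
    · intro d hd
      simp only [add_smul, ite_smul, zero_smul, Finset.sum_add_distrib, Finset.sum_ite_eq', hd,
        if_true]
      rw [← sub_eq_iff_eq_add, ← hf', Finsupp.linearCombination_apply, Finsupp.sum, map_sum]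
      have h1 : ∑ ρ ∈ u.support, ((vanderOp K id).comp (ev K n).toLinearMap) (u ρ • P ρ) =
          ∑ ρ ∈ partitionsOf d, u ρ • vanderOp K id (ev K n (P ρ)) := by
        simp only [map_smul]
        refine Finset.sum_subset (fun ρ hρ => ?_) fun ρ _ hρ => ?_
        · rw [mem_partitionsOf, (hu hρ).1.1]
          exact (mem_partitionsLE.1 hd).1
        · rw [Finsupp.notMem_support_iff.1 hρ, zero_smul]
      rw [h1]
      refine sum_partitionsOf_eq fun ρ hρ => ?_
      rw [ev_eq_zero_of_triangular (hP.triangular ρ) hρ, map_zero, smul_zero]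
  choose D hD hDe hDs using hex
  have hν : ν ∈ partitionsLE n ν.card := mem_partitionsLE.2 ⟨rfl, hn⟩
  rw [hDs ν _ hν, ← hDe ν]
  refine Finset.sum_eq_single ν (fun ρ hρ hne => ?_) (fun h => absurd hν h)
  have hsymm := coeff_mul_symm h (n := n) (d := ν.card) (P := P) (s := partitionsLE n ν.card)
    (X := X) (c := fun μ ν => if μ = ν then b μ else 0) (D := D)
    (linearIndepOn_ev_of_triangular n _ hP.triangular) (by
      rw [hP.kerDeg_eq_sum]
      simp only [ite_smul, zero_smul]
      exact Finset.sum_congr rfl fun μ hμ => by rw [Finset.sum_ite_eq, if_pos hμ])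
    (fun μ hμ => hDs μ _ hμ) hρ hν
  simp only [ite_mul, zero_mul, Finset.sum_ite_eq', hρ, hν, if_true] at hsymm
  by_cases h0 : D ν ρ = 0
  · rw [h0, zero_smul]
  · have h1 : D ρ ν ≠ 0 := fun h1 => by
      rw [h1, mul_zero] at hsymm
      exact mul_ne_zero (hP.ne_zero ν) h0 hsymm
    exact absurd ((hD ν ρ h0).antisymm (hD ρ ν h1)) hne

/-- The exponent vector `(1, …, 1)`. -/
def onesExpo (n : ℕ) : Fin n →₀ ℕ := Finsupp.equivFunOnFinite.symm fun _ => 1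

@[simp]
theorem onesExpo_apply (i : Fin n) : onesExpo n i = 1 := rfl

/-- The partition `μ + (1 ^ n)`. -/
def addCol (n : ℕ) (μ : YoungDiagram) : YoungDiagram := shape (expo n μ + onesExpo n)

theorem expo_addCol (n : ℕ) (μ : YoungDiagram) : expo n (addCol n μ) = expo n μ + onesExpo n :=
  expo_shape_of_monotone fun i j hij => by
    simpa using monotone_expo n μ hij

theorem colLen_addCol_le (n : ℕ) (μ : YoungDiagram) : (addCol n μ).colLen 0 ≤ n :=
  colLen_shape_le _

theorem card_addCol {μ : YoungDiagram} (hμ : μ.colLen 0 ≤ n) : (addCol n μ).card = μ.card + n := by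
  rw [addCol, card_shape, map_add, degree_expo hμ]
  simp [Finsupp.degree_eq_sum]

theorem addCol_injective {μ ν : YoungDiagram} (hμ : μ.colLen 0 ≤ n) (hν : ν.colLen 0 ≤ n)
    (h : addCol n μ = addCol n ν) : μ = ν := by
  have h1 := congrArg (expo n) h
  rw [expo_addCol, expo_addCol, add_left_inj] at h1
  rw [← shape_expo hμ, ← shape_expo hν, h1]

theorem exists_addCol_eq (ν : YoungDiagram) :
    ∃ μ : YoungDiagram, μ.colLen 0 ≤ ν.colLen 0 ∧ addCol (ν.colLen 0) μ = ν := by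
  set n := ν.colLen 0 with hn
  have hmono : Monotone ⇑(expo n ν - onesExpo n) := fun i j hij => by
    have := monotone_expo n ν hij
    simp only [Finsupp.tsub_apply, onesExpo_apply]
    omega
  refine ⟨shape (expo n ν - onesExpo n), colLen_shape_le _, ?_⟩
  rw [addCol, expo_shape_of_monotone hmono, tsub_add_cancel_of_le, shape_expo le_rfl]
  intro i
  rw [onesExpo_apply, expo_apply, Nat.one_le_iff_ne_zero]
  intro h0
  rw [rowLen_eq_zero_iff] at h0
  have := i.rev.isLt
  omega

theorem eigenval_addCol (q t X : K) (n : ℕ) (μ : YoungDiagram) :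
    eigenval q t X n (addCol n μ) = eigenval q t (q * X) n μ := by
  rw [eigenval, eigenval, expo_addCol]
  refine Finset.prod_congr rfl fun i _ => ?_
  rw [Finsupp.add_apply, onesExpo_apply, pow_succ]
  ring

theorem prod_X_eq_monomial : (∏ i : Fin n, X i : MvPolynomial (Fin n) K) =
    monomial (onesExpo n) 1 := by
  rw [monomial_eq, C_1, one_mul, Finsupp.prod_fintype _ _ (fun i => pow_zero _)]
  simp

theorem shiftHom_prod_X (q : K) (I : Finset (Fin n)) :
    shiftHom q id I (∏ i, X i) = C (q ^ I.card) * ∏ i : Fin n, X i := by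
  classical
  rw [map_prod]
  have h1 : ∀ i : Fin n, shiftHom q id I (X i) = C (if i ∈ I then q else 1) * X i := fun i => by
    rw [shiftHom, scaleHom, aeval_X]
    simp
  simp only [h1]
  rw [Finset.prod_mul_distrib, ← map_prod, Finset.prod_ite_mem, Finset.univ_inter,
    Finset.prod_const]

/-- Each shifted variable contributes a factor `q` from the product of all variables, which is
absorbed in the parameter. -/
theorem macOp_prod_X_mul (q t Y : K) (f : MvPolynomial (Fin n) K) :
    macOp q t Y id ((∏ i, X i) * f) = (∏ i, X i) * macOp q t (q * Y) id f := by
  rw [macOp_apply, macOp_apply, Finset.mul_sum]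
  refine Finset.sum_congr rfl fun w _ => ?_
  suffices H : ∑ I : Finset (Fin n), (Y ^ I.card * t ^ (∑ i ∈ I, (w i : ℕ))) •
      shiftHom q id I ((∏ i, X i) * f) = (∏ i, X i) * ∑ I : Finset (Fin n),
      ((q * Y) ^ I.card * t ^ (∑ i ∈ I, (w i : ℕ))) • shiftHom q id I f by
    rw [H, mul_left_comm, mul_smul_comm]
  rw [Finset.mul_sum]
  refine Finset.sum_congr rfl fun I _ => ?_
  rw [map_mul, shiftHom_prod_X, mul_smul_comm, mul_assoc, ← smul_eq_C_mul, smul_smul]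
  congr 1
  ring

theorem vanderOp_mul {σ : Type*} (x : Fin n → σ) (f g : MvPolynomial σ K) :
    vanderOp K x (f * g) = f * vanderOp K x g := by
  rw [vanderOp, LinearMap.mulLeft_apply, LinearMap.mulLeft_apply, mul_left_comm]

theorem isHomogeneous_prod_X (n : ℕ) :
    (∏ i : Fin n, X i : MvPolynomial (Fin n) K).IsHomogeneous n := by
  have := IsHomogeneous.prod (Finset.univ : Finset (Fin n))
    (fun i => (X i : MvPolynomial (Fin n) K)) (fun _ => 1) fun i _ => isHomogeneous_X _ _
  simpa using this

theorem card_eq_zero_iff (μ : YoungDiagram) : μ.card = 0 ↔ μ = ⊥ := by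
  rw [YoungDiagram.card, Finset.card_eq_zero, ← YoungDiagram.cells_bot]
  exact ⟨fun h => YoungDiagram.ext h, fun h => by rw [h]⟩

theorem rowLen_addCol {μ : YoungDiagram} {i : ℕ} (hi : i < n) :
    (addCol n μ).rowLen i = μ.rowLen i + 1 := by
  have := DFunLike.congr_fun (expo_addCol n μ) (Fin.rev ⟨i, hi⟩)
  simpa using this

theorem rowLen_addCol_of_le {μ : YoungDiagram} {i : ℕ} (hi : n ≤ i) :
    (addCol n μ).rowLen i = 0 :=
  rowLen_eq_zero_iff.2 ((colLen_addCol_le n μ).trans hi)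

theorem mem_addCol_succ {μ : YoungDiagram} (hμ : μ.colLen 0 ≤ n) {i j : ℕ} :
    (i, j + 1) ∈ addCol n μ ↔ (i, j) ∈ μ := by
  rw [YoungDiagram.mem_iff_lt_rowLen, YoungDiagram.mem_iff_lt_rowLen]
  rcases lt_or_ge i n with hi | hi
  · rw [rowLen_addCol hi]; omega
  · rw [rowLen_addCol_of_le hi, rowLen_eq_zero_iff.2 (hμ.trans hi)]; omega

theorem mem_addCol_zero {μ : YoungDiagram} {i : ℕ} : (i, 0) ∈ addCol n μ ↔ i < n := by
  rw [YoungDiagram.mem_iff_lt_rowLen]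
  rcases lt_or_ge i n with hi | hi
  · rw [rowLen_addCol hi]; omega
  · rw [rowLen_addCol_of_le hi]; omega

theorem colLen_addCol_zero (n : ℕ) (μ : YoungDiagram) : (addCol n μ).colLen 0 = n :=
  eq_of_forall_lt_iff fun i => by rw [← YoungDiagram.mem_iff_lt_colLen, mem_addCol_zero]

theorem colLen_addCol_succ {μ : YoungDiagram} (hμ : μ.colLen 0 ≤ n) (j : ℕ) :
    (addCol n μ).colLen (j + 1) = μ.colLen j :=
  eq_of_forall_lt_iff fun i => by
    rw [← YoungDiagram.mem_iff_lt_colLen, mem_addCol_succ hμ, YoungDiagram.mem_iff_lt_colLen]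

/-- The new column stands on the left, so the old boxes keep their arms and legs, and the box in row
`i` of the new column has arm `μ_i` and leg `n - (i + 1)`. -/
theorem prod_cells_addCol {μ : YoungDiagram} (hμ : μ.colLen 0 ≤ n) (F : ℕ → ℕ → K) :
    ∏ s ∈ (addCol n μ).cells, F (arm (addCol n μ) s) (leg (addCol n μ) s) =
      (∏ i ∈ Finset.range n, F (μ.rowLen i) (n - (i + 1))) *
        ∏ s ∈ μ.cells, F (arm μ s) (leg μ s) := by
  classical
  rw [← Finset.prod_filter_mul_prod_filter_not _ (fun s => s.2 = 0)]
  congr 1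
  · refine Finset.prod_bij' (fun s _ => s.1) (fun i _ => (i, 0)) ?_ ?_ ?_ ?_ ?_
    · rintro ⟨i, j⟩ hs
      simp only [Finset.mem_filter, YoungDiagram.mem_cells] at hs
      obtain ⟨hs, rfl⟩ := hs
      exact Finset.mem_range.2 (mem_addCol_zero.1 hs)
    · intro i hi
      simp [mem_addCol_zero, Finset.mem_range.1 hi]
    · rintro ⟨i, j⟩ hs
      simp only [Finset.mem_filter] at hs
      simp [hs.2]
    · intro i _
      rfl
    · rintro ⟨i, j⟩ hs
      simp only [Finset.mem_filter, YoungDiagram.mem_cells] at hs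
      obtain ⟨hs, rfl⟩ := hs
      simp only [arm, leg, rowLen_addCol (mem_addCol_zero.1 hs), colLen_addCol_zero]
      simp
  · refine Finset.prod_bij' (fun s _ => (s.1, s.2 - 1)) (fun s _ => (s.1, s.2 + 1)) ?_ ?_ ?_ ?_ ?_
    · rintro ⟨i, j⟩ hs
      simp only [Finset.mem_filter, YoungDiagram.mem_cells] at hs
      obtain ⟨j, rfl⟩ := Nat.exists_eq_succ_of_ne_zero hs.2
      exact (YoungDiagram.mem_cells _).2 ((mem_addCol_succ hμ).1 hs.1)
    · rintro ⟨i, j⟩ hs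
      simp only [Finset.mem_filter, YoungDiagram.mem_cells] at hs ⊢
      exact ⟨(mem_addCol_succ hμ).2 hs, by simp⟩
    · rintro ⟨i, j⟩ hs
      simp only [Finset.mem_filter] at hs
      simp only [Prod.mk.injEq, true_and]
      omega
    · rintro ⟨i, j⟩ hs
      rfl
    · rintro ⟨i, j⟩ hs
      simp only [Finset.mem_filter, YoungDiagram.mem_cells] at hs
      obtain ⟨j, rfl⟩ := Nat.exists_eq_succ_of_ne_zero hs.2
      have hi : i < n := by
        by_contra hcon
        have := YoungDiagram.mem_iff_lt_rowLen.1 hs.1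
        rw [rowLen_addCol_of_le (not_lt.1 hcon)] at this
        omega
      simp only [arm, leg, rowLen_addCol hi, Nat.succ_eq_add_one, colLen_addCol_succ hμ,
        Nat.add_sub_cancel]
      congr 1
      omega

theorem eigenval_eq_prod_range (q t X : K) (n : ℕ) (μ : YoungDiagram) :
    eigenval q t X n μ =
      ∏ i ∈ Finset.range n, (1 + X * t ^ (n - (i + 1)) * q ^ μ.rowLen i) := by
  rw [eigenval, Finset.prod_range, ← Equiv.prod_comp Fin.revPerm]
  refine Finset.prod_congr rfl fun i _ => ?_
  simp [Fin.val_rev]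

/-- The numerators of the new column multiply to the eigenvalue at `X = -t` of `μ`, its denominators
to the eigenvalue at `X = -1` of the enlarged partition. -/
theorem macb_addCol (h : MulIndep q t) {μ : YoungDiagram} (hμ : μ.colLen 0 ≤ n) :
    macb q t (addCol n μ) * eigenval q t (-1) n (addCol n μ) =
      macb q t μ * eigenval q t (-t) n μ := by
  have hne : eigenval q t (-1) n (addCol n μ) ≠ 0 := by
    rw [eigenval_eq_prod_range]
    refine Finset.prod_ne_zero_iff.2 fun i hi => ?_
    rw [rowLen_addCol (Finset.mem_range.1 hi)]
    have := h.one_sub_ne_zero (a := μ.rowLen i + 1) (b := n - (i + 1)) (Or.inl (Nat.succ_ne_zero _))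
    convert this using 1
    ring
  have h1 : ∏ i ∈ Finset.range n, (1 - q ^ μ.rowLen i * t ^ (n - (i + 1) + 1)) =
      eigenval q t (-t) n μ := by
    rw [eigenval_eq_prod_range]
    exact Finset.prod_congr rfl fun i _ => by rw [pow_succ]; ring
  have h2 : ∏ i ∈ Finset.range n, (1 - q ^ (μ.rowLen i + 1) * t ^ (n - (i + 1))) =
      eigenval q t (-1) n (addCol n μ) := by
    rw [eigenval_eq_prod_range]
    exact Finset.prod_congr rfl fun i hi => by
      rw [rowLen_addCol (Finset.mem_range.1 hi)]; ring
  rw [macb, macb, prod_cells_addCol hμ fun a l => 1 - q ^ a * t ^ (l + 1),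
    prod_cells_addCol hμ fun a l => 1 - q ^ (a + 1) * t ^ l, h1, h2, mul_div_mul_comm,
    mul_comm, ← mul_assoc, mul_div_cancel₀ _ hne, mul_comm]

/-! ### Adding a column to a Macdonald polynomial -/

variable [CharZero K]

/-- By `macOp_prod_X_mul` the left side is an eigenvector of `D(Y)` for every `Y`, with the
eigenvalue of `addCol n μ`. Separation of eigenvalues makes it a multiple of the right side, and the
leading coefficients are both `1`. -/
theorem IsKernelFamily.prod_X_mul_ev (hP : IsKernelFamily q t P b) (h : MulIndep q t)
    {μ : YoungDiagram} (hμ : μ.colLen 0 ≤ n) :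
    (∏ i, X i) * ev K n (P μ) = ev K n (P (addCol n μ)) := by
  classical
  set f := (∏ i, X i) * ev K n (P μ) with hf
  have hsymm : f.IsSymmetric := by
    refine IsSymmetric.mul (fun w => ?_) (isSymmetric_ev _)
    rw [map_prod]
    simp only [rename_X]
    exact Equiv.prod_comp w fun i => (X i : MvPolynomial (Fin n) K)
  have hhom : f.IsHomogeneous (μ.card + n) := by
    rw [add_comm]
    exact (isHomogeneous_prod_X n).mul
      (isHomogeneous_ev (isWeightedHomogeneous_of_triangular (hP.triangular μ)))
  obtain ⟨g, hg, hg'⟩ := exists_homogeneous_ev_eq hsymm hhom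
  obtain ⟨a, ha⟩ := exists_eq_sum_of_triangular hP.triangular hg
  have hfa : f = ∑ ν ∈ partitionsLE n (μ.card + n), a ν • ev K n (P ν) := by
    rw [← hg', ha, map_sum]
    simp only [map_smul]
    refine sum_partitionsOf_eq fun ρ hρ => ?_
    rw [ev_eq_zero_of_triangular (hP.triangular ρ) hρ, smul_zero]
  obtain ⟨Y, hY⟩ := h.exists_eigenval_ne n (μ.card + n)
  have hmem : addCol n μ ∈ partitionsLE n (μ.card + n) :=
    mem_partitionsLE.2 ⟨card_addCol hμ, colLen_addCol_le n μ⟩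
  have h1 : macOp q t Y id f = eigenval q t Y n (addCol n μ) • vanderOp K id f := by
    rw [hf, macOp_prod_X_mul, hP.macOp_ev h, vanderOp_mul, mul_smul_comm, eigenval_addCol]
  have h2 : ∀ ν ∈ partitionsLE n (μ.card + n),
      a ν * (eigenval q t Y n ν - eigenval q t Y n (addCol n μ)) = 0 := by
    refine linearIndepOn_finset_iff.1
      (linearIndepOn_ev_of_triangular n (μ.card + n) hP.triangular) _ ?_
    refine vanderOp_injective (K := K) (x := (id : Fin n → Fin n)) Function.injective_id ?_
    rw [hfa] at h1
    simp only [map_sum, map_smul, hP.macOp_ev h, Finset.smul_sum] at h1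
    rw [map_zero, ← sub_eq_zero.2 h1, map_sum, ← Finset.sum_sub_distrib]
    refine Finset.sum_congr rfl fun ν _ => ?_
    rw [map_smul, mul_sub, sub_smul, smul_smul, smul_smul,
      mul_comm (a ν) (eigenval q t Y n (addCol n μ))]
  have h3 : f = a (addCol n μ) • ev K n (P (addCol n μ)) := by
    rw [hfa]
    refine Finset.sum_eq_single _ (fun ν hν hne => ?_) (fun h => absurd hmem h)
    rw [(mul_eq_zero.1 (h2 ν hν)).resolve_right (sub_ne_zero.2 (hY ν hν _ hmem hne)), zero_smul]
  have h4 := congrArg (coeff (expo n (addCol n μ))) h3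
  rw [coeff_smul, coeff_expo_ev_of_triangular (hP.triangular _) (colLen_addCol_le n μ), hf,
    expo_addCol, prod_X_eq_monomial, add_comm, coeff_monomial_mul,
    coeff_expo_ev_of_triangular (hP.triangular _) hμ, smul_eq_mul, mul_one, mul_one] at h4
  rw [h3, ← h4, one_smul]

/-- Both sides of `macOp_neg_one_kerDeg` are expanded in the products `P_ρ(x) P_ρ(y)`, and the
coefficients at `ρ = addCol n μ` are compared. -/
theorem IsKernelFamily.mul_eigenval_addCol (hP : IsKernelFamily q t P b) (h : MulIndep q t)
    {μ : YoungDiagram} (hμ : μ.colLen 0 ≤ n) :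
    b (addCol n μ) * eigenval q t (-1) n (addCol n μ) = b μ * eigenval q t (-t) n μ := by
  classical
  have h1 := macOp_neg_one_kerDeg (n := n) h.q_pow_ne_one t (μ.card + n)
  rw [if_pos (Nat.le_add_left _ _), Nat.add_sub_cancel, hP.kerDeg_eq_sum, hP.kerDeg_eq_sum] at h1
  simp only [map_sum, map_smul, macOp_tens, hP.macOp_ev h, LinearMap.smul_apply, tens_vanderOp,
    smul_smul, Finset.mul_sum, mul_smul_comm] at h1
  have h2 : ∀ ν ∈ partitionsLE n μ.card, (b ν * eigenval q t (-t) n ν) •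
      ((∏ i : Fin n, X (Sum.inl i)) * (∏ i : Fin n, X (Sum.inr i)) *
        vanderOp K Sum.inl (tens K n (ev K n (P ν)) (ev K n (P ν)))) =
      (b ν * eigenval q t (-t) n ν) • vanderOp K Sum.inl
        (tens K n (ev K n (P (addCol n ν))) (ev K n (P (addCol n ν)))) := fun ν hν => by
    rw [← vanderOp_mul, ← hP.prod_X_mul_ev h (mem_partitionsLE.1 hν).2, tens_apply, tens_apply,
      map_mul (rename Sum.inl), map_mul (rename Sum.inr), map_prod, map_prod,
      mul_mul_mul_comm (∏ i : Fin n, X (Sum.inl i))]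
    simp only [rename_X]
  have h3 : ∑ ν ∈ partitionsLE n μ.card, (b ν * eigenval q t (-t) n ν) • vanderOp K Sum.inl
        (tens K n (ev K n (P (addCol n ν))) (ev K n (P (addCol n ν)))) =
      ∑ ρ ∈ partitionsLE n (μ.card + n), (∑ ν ∈ partitionsLE n μ.card,
        if addCol n ν = ρ then b ν * eigenval q t (-t) n ν else 0) • vanderOp K Sum.inl
        (tens K n (ev K n (P ρ)) (ev K n (P ρ))) := by
    simp only [Finset.sum_smul, ite_smul, zero_smul]
    rw [Finset.sum_comm]
    refine Finset.sum_congr rfl fun ν hν => ?_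
    rw [mem_partitionsLE] at hν
    rw [Finset.sum_ite_eq, if_pos (mem_partitionsLE.2 ⟨by rw [card_addCol hν.2, hν.1],
      colLen_addCol_le n ν⟩)]
  rw [Finset.sum_congr rfl h2, h3] at h1
  have h4 := tens_indep_diag (linearIndepOn_ev_of_triangular n (μ.card + n) hP.triangular)
    (c := fun ρ => b ρ * eigenval q t (-1) n ρ) (c' := fun ρ => ∑ ν ∈ partitionsLE n μ.card,
        if addCol n ν = ρ then b ν * eigenval q t (-t) n ν else 0)
    (vanderOp_injective (K := K) (x := (Sum.inl : Fin n → Fin n ⊕ Fin n)) Sum.inl_injective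
      (by simpa only [map_sum, map_smul] using h1)) (addCol n μ)
    (mem_partitionsLE.2 ⟨card_addCol hμ, colLen_addCol_le n μ⟩)
  rw [h4, Finset.sum_eq_single μ, if_pos rfl]
  · intro ν hν hne
    rw [if_neg fun he => hne (addCol_injective (mem_partitionsLE.1 hν).2 hμ he)]
  · intro hn
    exact absurd (mem_partitionsLE.2 ⟨rfl, hμ⟩) hn

/-- The first column is removed, with `n` the exact number of parts: all parts are then positive, so
the eigenvalue at `X = -1` is nonzero and can be cancelled in the common recursion. -/
theorem IsKernelFamily.eq_macb (hP : IsKernelFamily q t P b) (h : MulIndep q t)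
    (ν : YoungDiagram) : b ν = macb q t ν := by
  induction hν : ν.card using Nat.strong_induction_on generalizing ν with
  | _ k ih =>
    subst hν
    obtain ⟨μ, hμ, hμν⟩ := exists_addCol_eq ν
    rcases Nat.eq_zero_or_pos (ν.colLen 0) with h0 | h0
    · have hbot : ν = ⊥ := by
        exact (card_eq_zero_iff ν).1 (by rw [card_eq_sum_rowLen ν h0.le]; simp)
      subst hbot
      -- The empty partition is read off from the degree `0` part of the kernel in no variables.
      have h1 := hP.kerDeg_eq_sum 0 0
      have hp : partitionsLE 0 0 = {⊥} := by
        ext ρ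
        simp only [mem_partitionsLE, card_eq_zero_iff, Finset.mem_singleton,
          and_iff_left_iff_imp]
        rintro rfl
        exact h0.le
      have hev : ev K 0 (P ⊥) = 1 := by
        rw [eq_C_of_isEmpty (ev K 0 (P ⊥)), ← C_1]
        congr 1
        rw [← coeff_expo_ev_of_triangular (hP.triangular ⊥) h0.le]
        exact congrArg (fun α => coeff α (ev K 0 (P ⊥))) (Subsingleton.elim _ _)
      rw [hp, Finset.sum_singleton, kerDeg, expCoeff_zero, hev, tens_apply, map_one, map_one,
        mul_one, smul_eq_C_mul, mul_one, ← C_1] at h1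
      rw [← C_injective _ _ h1]
      simp [macb]
    · have hne : eigenval q t (-1) (ν.colLen 0) ν ≠ 0 := by
        rw [eigenval_eq_prod_range]
        refine Finset.prod_ne_zero_iff.2 fun i hi => ?_
        have hr : ν.rowLen i ≠ 0 := fun hr => by
          rw [rowLen_eq_zero_iff] at hr
          rw [Finset.mem_range] at hi
          omega
        have := h.one_sub_ne_zero (a := ν.rowLen i) (b := ν.colLen 0 - (i + 1)) (Or.inl hr)
        convert this using 1
        ring
      have hcard := card_addCol hμ
      rw [hμν] at hcard
      have h1 := hP.mul_eigenval_addCol h hμ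
      have h2 := macb_addCol h hμ
      rw [ih μ.card (by omega) μ rfl, ← h2, hμν] at h1
      exact mul_right_cancel₀ hne h1

end Norm

/-! ### Skew Macdonald polynomials and the trace -/

section Skew

open MvPolynomial

variable {K : Type*} [Field K] {q t : K}

theorem scalarProduct_monomial (q t : K) (f : SymFun K) (α : ℕ+ →₀ ℕ) :
    scalarProduct q t f (monomial α 1) = f.coeff α * powerSumNorm q t α := by
  classical
  rw [scalarProduct]
  simp only [coeff_monomial, mul_ite, mul_one, mul_zero, ite_mul, zero_mul]
  rw [Finset.sum_ite_eq]
  split_ifs with h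
  · rfl
  · rw [notMem_support_iff.1 h, zero_mul]

variable {ι κ : Type*}

theorem evalAt_eq_sum (Z : ℕ+ → Ser K ι κ) {f : SymFun K} {d : ℕ}
    (hf : IsWeightedHomogeneous pwt f d) :
    evalAt Z f = ∑ α ∈ expsOf d, f.coeff α • evalAt Z (monomial α 1) := by
  conv_lhs => rw [eq_sum_monomial hf]
  simp only [evalAt, map_sum, map_smul]

variable [CharZero K]

theorem isKernelFamily_macP (h : MulIndep q t) : IsKernelFamily q t (macP q t) (macb q t) := by
  obtain ⟨b, hb⟩ := exists_isKernelFamily_macP h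
  have : b = macb q t := funext fun ν => hb.eq_macb h ν
  exact this ▸ hb

variable {P : YoungDiagram → SymFun K} {b : YoungDiagram → K}

theorem IsKernelFamily.isWeightedHomogeneous (hP : IsKernelFamily q t P b) (ν : YoungDiagram) :
    IsWeightedHomogeneous pwt (P ν) ν.card :=
  isWeightedHomogeneous_of_triangular (hP.triangular ν)

theorem IsKernelFamily.eq_sum (hP : IsKernelFamily q t P b) {f : SymFun K} {d : ℕ}
    (hf : IsWeightedHomogeneous pwt f d) :
    f = ∑ μ ∈ partitionsOf d, (b μ * scalarProduct q t f (P μ)) • P μ := by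
  obtain ⟨c, hc⟩ := exists_eq_sum_of_triangular hP.triangular hf
  have h1 : ∀ μ ∈ partitionsOf d, b μ * scalarProduct q t f (P μ) = c μ := fun μ hμ => by
    rw [hc, ← scalarForm_apply, map_sum, LinearMap.sum_apply, Finset.sum_eq_single μ, map_smul,
      LinearMap.smul_apply, scalarForm_apply, smul_eq_mul, mul_left_comm, hP.norm, mul_one]
    · intro ν _ hne
      rw [map_smul, LinearMap.smul_apply, scalarForm_apply, hP.orthogonal ν μ hne, smul_zero]
    · exact fun h => absurd hμ h
  rw [Finset.sum_congr rfl fun μ hμ => by rw [h1 μ hμ]]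
  exact hc

theorem IsKernelFamily.scalarProduct_eq (hP : IsKernelFamily q t P b) {f : SymFun K} {d : ℕ}
    (hf : IsWeightedHomogeneous pwt f d) (g : SymFun K) : scalarProduct q t f g =
      ∑ μ ∈ partitionsOf d, b μ * (scalarProduct q t f (P μ) * scalarProduct q t g (P μ)) := by
  have h1 := congrArg (fun f => scalarForm q t f g) (hP.eq_sum hf)
  simp only [map_sum, LinearMap.sum_apply, map_smul, LinearMap.smul_apply, scalarForm_apply,
    smul_eq_mul] at h1
  rw [h1]
  exact Finset.sum_congr rfl fun μ _ => by rw [scalarProduct_comm q t g, mul_assoc]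

/-- An expansion exists because the `P_ρ` span each degree; orthogonality then computes the chosen
coefficients. -/
theorem macf_eq (h : MulIndep q t) (μ ν ρ : YoungDiagram) : macf q t μ ν ρ =
    macb q t ρ * scalarProduct q t (macP q t μ * macP q t ν) (macP q t ρ) := by
  classical
  have hP := isKernelFamily_macP h
  have hex : ∃ f : YoungDiagram →₀ K,
      macP q t μ * macP q t ν = f.sum fun ρ a => a • macP q t ρ := by
    obtain ⟨c, hc⟩ := exists_eq_sum_of_triangular hP.triangular
      ((hP.isWeightedHomogeneous μ).mul (hP.isWeightedHomogeneous ν))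
    refine ⟨Finsupp.onFinset (partitionsOf (μ.card + ν.card))
      (fun ρ => if ρ ∈ partitionsOf (μ.card + ν.card) then c ρ else 0) (fun ρ hρ => ?_), ?_⟩
    · by_contra hn
      exact hρ (if_neg hn)
    · rw [hc, Finsupp.sum_of_support_subset _ Finsupp.support_onFinset_subset
        (fun ρ a => a • macP q t ρ) (fun _ _ => zero_smul _ _)]
      exact Finset.sum_congr rfl fun ρ hρ => by rw [Finsupp.onFinset_apply, if_pos hρ]
  have hspec : macP q t μ * macP q t ν = (macf q t μ ν).sum fun ρ a => a • macP q t ρ :=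
    Classical.epsilon_spec hex
  rw [hspec, ← scalarForm_apply, Finsupp.sum, map_sum, LinearMap.sum_apply,
    Finset.sum_eq_single ρ, map_smul, LinearMap.smul_apply, scalarForm_apply, smul_eq_mul,
    mul_left_comm, hP.norm, mul_one]
  · intro σ _ hne
    rw [map_smul, LinearMap.smul_apply, scalarForm_apply, hP.orthogonal σ ρ hne, smul_zero]
  · intro hn
    rw [Finsupp.notMem_support_iff.1 hn, zero_smul, map_zero, LinearMap.zero_apply]

theorem macf_eq_zero (h : MulIndep q t) {μ ν ρ : YoungDiagram} (hc : μ.card + ν.card ≠ ρ.card) :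
    macf q t μ ν ρ = 0 := by
  have hP := isKernelFamily_macP h
  rw [macf_eq h, scalarProduct_eq_zero_of_homogeneous q t
    ((hP.isWeightedHomogeneous μ).mul (hP.isWeightedHomogeneous ν))
    (hP.isWeightedHomogeneous ρ) hc, mul_zero]

theorem skewQ_eq_zero (h : MulIndep q t) {μ ρ : YoungDiagram} (hc : ρ.card < μ.card) :
    skewQ q t ρ μ = 0 :=
  finsum_eq_zero_of_forall_eq_zero fun ν => by
    rw [macf_eq_zero h (by omega), zero_smul]

theorem skewQ_eq_sum (h : MulIndep q t) {μ ρ : YoungDiagram} {e : ℕ} (hc : μ.card + e = ρ.card) :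
    skewQ q t ρ μ = ∑ ν ∈ partitionsOf e, macf q t μ ν ρ • macQ q t ν := by
  refine finsum_eq_sum_of_support_subset _ fun ν hν => ?_
  rw [Finset.mem_coe, mem_partitionsOf]
  by_contra hne
  exact hν (by simp only [macf_eq_zero h (show μ.card + ν.card ≠ ρ.card by omega), zero_smul])

theorem isWeightedHomogeneous_skewQ (h : MulIndep q t) {μ ρ : YoungDiagram} {e : ℕ}
    (hc : μ.card + e = ρ.card) : IsWeightedHomogeneous pwt (skewQ q t ρ μ) e := by
  rw [skewQ_eq_sum h hc, ← mem_weightedHomogeneousSubmodule]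
  refine Submodule.sum_mem _ fun ν hν => Submodule.smul_mem _ _ (Submodule.smul_mem _ _ ?_)
  rw [mem_weightedHomogeneousSubmodule, ← mem_partitionsOf.1 hν]
  exact (isKernelFamily_macP h).isWeightedHomogeneous ν

/-- Up to the factor `b_ρ`, pairing with `Q_{ρ/μ}` is pairing with `P_ρ` after multiplication by
`P_μ`; testing this adjunction on `p_α` gives the coefficient. -/
theorem coeff_skewQ (h : MulIndep q t) {μ ρ : YoungDiagram} {e : ℕ} (hc : μ.card + e = ρ.card)
    {α : ℕ+ →₀ ℕ} (hα : α ∈ expsOf e) : (skewQ q t ρ μ).coeff α =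
      macb q t ρ * scalarProduct q t (macP q t μ * monomial α 1) (macP q t ρ) *
        (powerSumNorm q t α)⁻¹ := by
  have hP := isKernelFamily_macP h
  rw [eq_mul_inv_iff_mul_eq₀ (h.powerSumNorm_ne_zero α), ← scalarProduct_monomial,
    skewQ_eq_sum h hc, ← scalarForm_apply, map_sum, LinearMap.sum_apply]
  have hmon : IsWeightedHomogeneous pwt (monomial α (1 : K)) e :=
    isWeightedHomogeneous_monomial pwt α 1 (mem_expsOf.1 hα)
  conv_rhs => rw [hP.eq_sum hmon]
  rw [← scalarForm_apply (macP q t μ * _), Finset.mul_sum, map_sum, LinearMap.sum_apply,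
    Finset.mul_sum]
  refine Finset.sum_congr rfl fun ν _ => ?_
  rw [map_smul, LinearMap.smul_apply, macQ, map_smul, LinearMap.smul_apply, mul_smul_comm, map_smul,
    LinearMap.smul_apply, scalarForm_apply, scalarForm_apply, macf_eq h,
    scalarProduct_comm q t (monomial α 1)]
  simp only [smul_eq_mul]
  ring

/-- Parseval's formula for the orthogonal basis `P_μ`, applied to two power sum products. -/
theorem IsKernelFamily.sum_mul_coeff [DecidableEq (ℕ+ →₀ ℕ)] (hP : IsKernelFamily q t P b)
    (h : MulIndep q t) {d : ℕ} {γ : ℕ+ →₀ ℕ} (hγ : γ ∈ expsOf d) (γ' : ℕ+ →₀ ℕ) :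
    ∑ μ ∈ partitionsOf d, b μ * ((P μ).coeff γ * (P μ).coeff γ') =
      if γ = γ' then (powerSumNorm q t γ)⁻¹ else 0 := by
  have h1 := hP.scalarProduct_eq (isWeightedHomogeneous_monomial pwt γ (1 : K) (mem_expsOf.1 hγ))
    (monomial γ' 1)
  have hz := h.powerSumNorm_ne_zero γ
  have hz' := h.powerSumNorm_ne_zero γ'
  rw [scalarProduct_monomial, coeff_monomial] at h1
  simp only [scalarProduct_comm q t (monomial _ (1 : K)), scalarProduct_monomial] at h1
  have h2 : ∑ μ ∈ partitionsOf d, b μ * ((P μ).coeff γ * (P μ).coeff γ') =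
      (powerSumNorm q t γ)⁻¹ * (powerSumNorm q t γ')⁻¹ *
      ((if γ = γ' then 1 else 0) * powerSumNorm q t γ') := by
    have h3 : (if γ = γ' then (1 : K) else 0) * powerSumNorm q t γ' =
        ∑ μ ∈ partitionsOf d, b μ * ((P μ).coeff γ * powerSumNorm q t γ *
          ((P μ).coeff γ' * powerSumNorm q t γ')) := by convert h1
    rw [h3, Finset.mul_sum]
    refine Finset.sum_congr rfl fun μ _ => ?_
    field_simp
  rw [h2]
  split_ifs
  · rw [one_mul, mul_assoc, inv_mul_cancel₀ hz', mul_one]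
  · rw [zero_mul, mul_zero]

/-- The trace is moved from the Macdonald basis to the power sums. Parseval removes the sum over
`ρ`, `sum_mul_coeff` the sum over `μ`, and what is left are the pairings of `p_γ p_α` with `p_γ
p_β`. -/
theorem sum_macb_mul_scalarProduct [DecidableEq (ℕ+ →₀ ℕ)] (h : MulIndep q t) {d e : ℕ}
    {α : ℕ+ →₀ ℕ} (hα : α ∈ expsOf e) (β : ℕ+ →₀ ℕ) :
    ∑ μ ∈ partitionsOf d, ∑ ρ ∈ partitionsOf (d + e), macb q t μ * macb q t ρ *
      (scalarProduct q t (macP q t μ * monomial α 1) (macP q t ρ) *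
        scalarProduct q t (macP q t μ * monomial β 1) (macP q t ρ)) =
    if α = β then ∑ γ ∈ expsOf d, powerSumNorm q t (γ + α) * (powerSumNorm q t γ)⁻¹ else 0 := by
  have hP := isKernelFamily_macP h
  have h1 : ∀ μ ∈ partitionsOf d, ∑ ρ ∈ partitionsOf (d + e), macb q t μ * macb q t ρ *
      (scalarProduct q t (macP q t μ * monomial α 1) (macP q t ρ) *
        scalarProduct q t (macP q t μ * monomial β 1) (macP q t ρ)) =
      ∑ γ ∈ expsOf d, ∑ γ' ∈ expsOf d, (macb q t μ * ((macP q t μ).coeff γ *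
        (macP q t μ).coeff γ')) * scalarProduct q t (monomial (γ + α) 1) (monomial (γ' + β) 1) := by
    intro μ hμ
    have hhom := hP.isWeightedHomogeneous μ
    rw [mem_partitionsOf.1 hμ] at hhom
    have h2 : ∀ ξ : ℕ+ →₀ ℕ, macP q t μ * monomial ξ 1 =
        ∑ γ ∈ expsOf d, (macP q t μ).coeff γ • monomial (γ + ξ) 1 := fun ξ => by
      conv_lhs => rw [eq_sum_monomial hhom]
      rw [Finset.sum_mul]
      exact Finset.sum_congr rfl fun γ _ => by rw [smul_mul_assoc, monomial_mul, one_mul]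
    have h3 := hP.scalarProduct_eq (hhom.mul (isWeightedHomogeneous_monomial pwt α (1 : K)
      (mem_expsOf.1 hα))) (macP q t μ * monomial β 1)
    simp only [mul_assoc (macb q t μ), ← Finset.mul_sum]
    rw [← h3, h2 α, h2 β, ← scalarForm_apply]
    simp only [map_sum, LinearMap.sum_apply, map_smul, LinearMap.smul_apply, scalarForm_apply,
      smul_eq_mul, Finset.mul_sum]
    rw [Finset.sum_comm]
    exact Finset.sum_congr rfl fun γ _ => Finset.sum_congr rfl fun γ' _ => by ring
  rw [Finset.sum_congr rfl h1, Finset.sum_comm]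
  have h4 : ∀ γ ∈ expsOf d, ∑ μ ∈ partitionsOf d, ∑ γ' ∈ expsOf d, (macb q t μ *
      ((macP q t μ).coeff γ * (macP q t μ).coeff γ')) *
        scalarProduct q t (monomial (γ + α) 1) (monomial (γ' + β) 1) =
      if α = β then powerSumNorm q t (γ + α) * (powerSumNorm q t γ)⁻¹ else 0 := fun γ hγ => by
    rw [Finset.sum_comm]
    simp only [← Finset.sum_mul, hP.sum_mul_coeff h hγ, ite_mul, zero_mul]
    rw [Finset.sum_ite_eq, if_pos hγ, scalarProduct_monomial, coeff_monomial]
    simp only [add_right_inj]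
    split_ifs with hab
    · rw [one_mul, hab, mul_comm]
    · rw [zero_mul, mul_zero]
  rw [Finset.sum_congr rfl h4]
  split_ifs
  · rfl
  · exact Finset.sum_const_zero

/-- The factor `b_ρ` from each skew function, together with the `b_μ / b_ρ` of `skewP`, leaves the
weight `b_μ b_ρ` that the trace formula requires. -/
theorem sum_cauchyTerm (h : MulIndep q t) (Z W : ℕ+ → Ser K ι κ) (d e : ℕ) :
    ∑ μ ∈ partitionsOf d, ∑ ρ ∈ partitionsOf (d + e), cauchyTerm q t Z W (μ, ρ) =
      ∑ α ∈ expsOf e, (∑ γ ∈ expsOf d, powerSumNorm q t (γ + α) * (powerSumNorm q t γ)⁻¹ *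
        (powerSumNorm q t α)⁻¹ * (powerSumNorm q t α)⁻¹) •
          (serA K ι κ ^ d * (evalAt Z (monomial α 1) * evalAt W (monomial α 1))) := by
  classical
  have h1 : ∀ μ ∈ partitionsOf d, ∀ ρ ∈ partitionsOf (d + e), cauchyTerm q t Z W (μ, ρ) =
      ∑ α ∈ expsOf e, ∑ β ∈ expsOf e, ((macb q t μ * macb q t ρ *
      (scalarProduct q t (macP q t μ * monomial α 1) (macP q t ρ) *
        scalarProduct q t (macP q t μ * monomial β 1) (macP q t ρ))) *
        ((powerSumNorm q t α)⁻¹ * (powerSumNorm q t β)⁻¹)) •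
          (serA K ι κ ^ d * (evalAt Z (monomial α 1) * evalAt W (monomial β 1))) := by
    intro μ hμ ρ hρ
    rw [mem_partitionsOf] at hμ hρ
    have hc : μ.card + e = ρ.card := by omega
    have hb : macb q t ρ ≠ 0 := (isKernelFamily_macP h).ne_zero ρ
    have hskew := isWeightedHomogeneous_skewQ h hc
    have hskewP : evalAt W (skewP q t ρ μ) = (macb q t μ / macb q t ρ) •
        evalAt W (skewQ q t ρ μ) := by
      rw [skewP, evalAt, map_smul, evalAt]
    simp only [cauchyTerm]
    rw [hskewP, evalAt_eq_sum Z hskew, evalAt_eq_sum W hskew, hμ, mul_smul_comm, mul_assoc,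
      Finset.sum_mul_sum, Finset.mul_sum, Finset.smul_sum]
    refine Finset.sum_congr rfl fun α hα => ?_
    rw [Finset.mul_sum, Finset.smul_sum]
    refine Finset.sum_congr rfl fun β hβ => ?_
    rw [coeff_skewQ h hc hα, coeff_skewQ h hc hβ, smul_mul_smul_comm, mul_smul_comm, smul_smul]
    congr 1
    field_simp
  rw [Finset.sum_congr rfl fun μ hμ => Finset.sum_congr rfl fun ρ hρ => h1 μ hμ ρ hρ]
  rw [Finset.sum_congr rfl fun μ _ => Finset.sum_comm, Finset.sum_comm]
  refine Finset.sum_congr rfl fun α hα => ?_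
  rw [Finset.sum_congr rfl fun μ _ => Finset.sum_comm, Finset.sum_comm]
  simp only [← Finset.sum_smul, ← Finset.sum_mul]
  rw [Finset.sum_congr rfl fun β _ => by rw [sum_macb_mul_scalarProduct h hα]]
  simp only [ite_mul, zero_mul, ite_smul, zero_smul]
  rw [Finset.sum_ite_eq, if_pos hα]
  simp only [mul_assoc, Finset.sum_mul]

end Skew

/-! ### Exponentials of power series in many variables -/

section MvExp

open MvPowerSeries

variable {σ K : Type*} [Field K]

/-- Agreement of the coefficients of degree at most `N`. -/
def EqUpTo (N : ℕ) (f g : MvPowerSeries σ K) : Prop :=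
  ∀ m : σ →₀ ℕ, m.degree ≤ N → coeff m f = coeff m g

theorem EqUpTo.mul {N : ℕ} {f g f' g' : MvPowerSeries σ K} (h : EqUpTo N f g)
    (h' : EqUpTo N f' g') : EqUpTo N (f * f') (g * g') := fun m hm => by
  classical
  rw [coeff_mul, coeff_mul]
  refine Finset.sum_congr rfl fun p hp => ?_
  rw [Finset.HasAntidiagonal.mem_antidiagonal] at hp
  have hd := congrArg Finsupp.degree hp
  rw [map_add] at hd
  rw [h p.1 (by omega), h' p.2 (by omega)]

theorem coeff_pow_eq_zero {f : MvPowerSeries σ K} (hf : constantCoeff f = 0) {m : σ →₀ ℕ} {j : ℕ}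
    (h : m.degree < j) : coeff m (f ^ j) = 0 :=
  coeff_eq_zero_of_constantCoeff_nilpotent (m := 1) (by rw [hf, pow_one]) (by omega)

/-- The Euler derivation for the weight `w`: the coefficient of a monomial is multiplied by its
weight. -/
def eulerD (w : σ → ℕ) : MvPowerSeries σ K →ₗ[K] MvPowerSeries σ K where
  toFun f := fun m => (Finsupp.weight w m : K) * coeff m f
  map_add' _ _ := funext fun _ => mul_add _ _ _
  map_smul' _ _ := funext fun _ => mul_left_comm _ _ _

theorem coeff_eulerD (w : σ → ℕ) (f : MvPowerSeries σ K) (m : σ →₀ ℕ) :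
    coeff m (eulerD w f) = (Finsupp.weight w m : K) * coeff m f := rfl

theorem eulerD_mul (w : σ → ℕ) (f g : MvPowerSeries σ K) :
    eulerD w (f * g) = eulerD w f * g + f * eulerD w g := by
  classical
  ext m
  rw [coeff_eulerD, map_add, coeff_mul, coeff_mul, coeff_mul, Finset.mul_sum,
    ← Finset.sum_add_distrib]
  refine Finset.sum_congr rfl fun p hp => ?_
  rw [Finset.HasAntidiagonal.mem_antidiagonal] at hp
  rw [coeff_eulerD, coeff_eulerD, ← hp, map_add, Nat.cast_add]
  ring

theorem eulerD_one (w : σ → ℕ) : eulerD w (1 : MvPowerSeries σ K) = 0 := by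
  classical
  ext m
  rw [coeff_eulerD, coeff_one, map_zero]
  split_ifs with h
  · rw [h, map_zero, Nat.cast_zero, zero_mul]
  · rw [mul_zero]

theorem eulerD_pow_succ (w : σ → ℕ) (f : MvPowerSeries σ K) (j : ℕ) :
    eulerD w (f ^ (j + 1)) = ((j + 1 : ℕ) : K) • (f ^ j * eulerD w f) := by
  induction j with
  | zero => simp
  | succ j ih =>
    rw [pow_succ, eulerD_mul, ih, smul_mul_assoc, mul_right_comm, ← pow_succ]
    push_cast
    module

/-- The many-variable analogue of `HasLogDeriv.unique`: a coefficient of positive weight is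
determined by those of smaller weight, since `C` has no part of weight `0`. -/
theorem eulerD_unique [CharZero K] (w : σ → ℕ) {F G C : MvPowerSeries σ K}
    (hF : eulerD w F = C * F) (hG : eulerD w G = C * G)
    (hC : ∀ m, Finsupp.weight w m = 0 → coeff m C = 0)
    (h0 : ∀ m, Finsupp.weight w m = 0 → coeff m F = coeff m G) : F = G := by
  classical
  ext m
  induction hm : Finsupp.weight w m using Nat.strong_induction_on generalizing m with
  | _ k ih =>
    subst hm
    by_cases hw : Finsupp.weight w m = 0
    · exact h0 m hw
    have hF' := congrArg (coeff m) hF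
    have hG' := congrArg (coeff m) hG
    rw [coeff_eulerD, coeff_mul] at hF' hG'
    have : ∑ p ∈ Finset.HasAntidiagonal.antidiagonal m, coeff p.1 C * coeff p.2 F =
        ∑ p ∈ Finset.HasAntidiagonal.antidiagonal m, coeff p.1 C * coeff p.2 G := by
      refine Finset.sum_congr rfl fun p hp => ?_
      rw [Finset.HasAntidiagonal.mem_antidiagonal] at hp
      have hd := congrArg (Finsupp.weight w) hp
      rw [map_add] at hd
      by_cases h1 : Finsupp.weight w p.1 = 0
      · rw [hC _ h1, zero_mul, zero_mul]
      · rw [ih _ (by omega) p.2 rfl]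
    rw [this, ← hG'] at hF'
    exact mul_left_cancel₀ (Nat.cast_ne_zero.2 hw) hF'

theorem EqUpTo.eulerD {N : ℕ} (w : σ → ℕ) {f g : MvPowerSeries σ K} (h : EqUpTo N f g) :
    EqUpTo N (eulerD w f) (eulerD w g) := fun m hm => by
  rw [coeff_eulerD, coeff_eulerD, h m hm]

theorem weight_one_eq_zero {m : σ →₀ ℕ} : Finsupp.weight (1 : σ → ℕ) m = 0 ↔ m = 0 := by
  have h := Finsupp.degree_eq_weight_one (σ := σ) (R := ℕ)
  rw [show Finsupp.weight (1 : σ → ℕ) m = Finsupp.degree m from (DFunLike.congr_fun h m).symm]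
  exact Finsupp.degree_eq_zero_iff m

theorem constantCoeff_eulerD (w : σ → ℕ) (f : MvPowerSeries σ K) :
    constantCoeff (eulerD w f) = 0 := by
  rw [← coeff_zero_eq_constantCoeff_apply, coeff_eulerD, map_zero, Nat.cast_zero, zero_mul]

/-- The series `∑ r > 0, z ^ r / r`, for `z` without constant term. -/
def negLog (z : MvPowerSeries σ K) : MvPowerSeries σ K := fun m =>
  -- The summand `r = 0` vanishes because the inverse of `0` is `0` in a field.
  ∑ r ∈ Finset.range (m.degree + 1), ((r : K))⁻¹ * coeff m (z ^ r)

theorem coeff_negLog {z : MvPowerSeries σ K} (hz : constantCoeff z = 0) {m : σ →₀ ℕ} {N : ℕ}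
    (hN : m.degree ≤ N) :
    coeff m (negLog z) = ∑ r ∈ Finset.range (N + 1), ((r : K))⁻¹ * coeff m (z ^ r) := by
  have h : coeff m (negLog z) =
    ∑ r ∈ Finset.range (m.degree + 1), ((r : K))⁻¹ * coeff m (z ^ r) := rfl
  rw [h]
  refine Finset.sum_subset (Finset.range_subset_range.2 (by omega)) fun r _ hr => ?_
  rw [Finset.mem_range] at hr
  rw [coeff_pow_eq_zero hz (by omega), mul_zero]

variable [CharZero K]

/-- The exponential of a power series without constant term. -/
def mvExp (f : MvPowerSeries σ K) : MvPowerSeries σ K := (PowerSeries.exp K).subst f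

theorem coeff_mvExp {f : MvPowerSeries σ K} (hf : constantCoeff f = 0) {m : σ →₀ ℕ} {N : ℕ}
    (hN : m.degree ≤ N) :
    coeff m (mvExp f) = ∑ j ∈ Finset.range (N + 1), ((j.factorial : K))⁻¹ * coeff m (f ^ j) := by
  rw [mvExp, PowerSeries.coeff_subst (PowerSeries.HasSubst.of_constantCoeff_zero hf),
    finsum_eq_sum_of_support_subset (s := Finset.range (N + 1))]
  · refine Finset.sum_congr rfl fun j _ => ?_
    rw [PowerSeries.coeff_exp, smul_eq_mul]
    simp
  · intro j hj
    rw [Finset.mem_coe, Finset.mem_range]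
    by_contra hcon
    refine hj ?_
    simp only
    rw [coeff_pow_eq_zero hf (by omega), smul_zero]

theorem eqUpTo_mvExp {f : MvPowerSeries σ K} (hf : constantCoeff f = 0) (N : ℕ) :
    EqUpTo N (mvExp f) (∑ j ∈ Finset.range (N + 1), ((j.factorial : K))⁻¹ • f ^ j) := fun m hm => by
  rw [coeff_mvExp hf hm, map_sum]
  rfl

theorem constantCoeff_mvExp {f : MvPowerSeries σ K} (hf : constantCoeff f = 0) :
    constantCoeff (mvExp f) = 1 := by
  rw [← coeff_zero_eq_constantCoeff_apply, coeff_mvExp hf (N := 0) (by simp)]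
  simp

theorem eulerD_mvExp (w : σ → ℕ) {f : MvPowerSeries σ K} (hf : constantCoeff f = 0) :
    eulerD w (mvExp f) = eulerD w f * mvExp f := by
  ext m
  have h1 := (eqUpTo_mvExp hf (m.degree + 1)).eulerD w m (by omega)
  have h2 : EqUpTo m.degree (eulerD w f) (eulerD w f) := fun _ _ => rfl
  rw [h1, h2.mul (eqUpTo_mvExp hf m.degree) m le_rfl]
  congr 1
  rw [Finset.sum_range_succ', pow_zero, map_add, map_smul, eulerD_one, smul_zero, add_zero, map_sum,
    Finset.mul_sum]
  refine Finset.sum_congr rfl fun j _ => ?_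
  rw [map_smul, eulerD_pow_succ, smul_smul, mul_smul_comm, mul_comm (f ^ j)]
  congr 1
  have : ((j + 1 : ℕ) : K) ≠ 0 := Nat.cast_ne_zero.2 (Nat.succ_ne_zero j)
  rw [Nat.factorial_succ, Nat.cast_mul, mul_inv, mul_right_comm, inv_mul_cancel₀ this, one_mul]

theorem eulerD_one_unique {F G C : MvPowerSeries σ K}
    (hF : eulerD 1 F = C * F) (hG : eulerD 1 G = C * G) (hC : constantCoeff C = 0)
    (h0 : constantCoeff F = constantCoeff G) : F = G :=
  eulerD_unique 1 hF hG (fun m hm => by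
    rw [weight_one_eq_zero.1 hm]; exact hC) (fun m hm => by
    rw [weight_one_eq_zero.1 hm]; exact h0)

theorem mvExp_add {f g : MvPowerSeries σ K} (hf : constantCoeff f = 0) (hg : constantCoeff g = 0) :
    mvExp (f + g) = mvExp f * mvExp g := by
  have hfg : constantCoeff (f + g) = 0 := by rw [map_add, hf, hg, add_zero]
  refine eulerD_one_unique (C := eulerD 1 (f + g)) (eulerD_mvExp 1 hfg) ?_
    (constantCoeff_eulerD _ _) ?_
  · rw [eulerD_mul, eulerD_mvExp 1 hf, eulerD_mvExp 1 hg, map_add]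
    ring
  · rw [map_mul, constantCoeff_mvExp hf, constantCoeff_mvExp hg, constantCoeff_mvExp hfg, mul_one]

theorem mvExp_zero : mvExp (0 : MvPowerSeries σ K) = 1 := by
  refine eulerD_one_unique (C := 0) ?_ ?_ (map_zero _) ?_
  · rw [eulerD_mvExp 1 (map_zero _), map_zero]
  · rw [eulerD_one, zero_mul]
  · rw [constantCoeff_mvExp (map_zero _), map_one]

theorem mvExp_sum {ι : Type*} (s : Finset ι) {f : ι → MvPowerSeries σ K}
    (hf : ∀ i, constantCoeff (f i) = 0) : mvExp (∑ i ∈ s, f i) = ∏ i ∈ s, mvExp (f i) := by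
  classical
  induction s using Finset.induction_on with
  | empty => simp [mvExp_zero]
  | insert i s hi ih =>
    rw [Finset.sum_insert hi, Finset.prod_insert hi, mvExp_add (hf i), ih]
    rw [map_sum]
    exact Finset.sum_eq_zero fun i _ => hf i

/-- A given coefficient of the exponential is a finite combination of coefficients of powers of its
argument, so it depends continuously on it. -/
theorem hasProd_mvExp [TopologicalSpace K] [IsTopologicalRing K] [T2Space K] {ι : Type*}
    {f : ι → MvPowerSeries σ K} {s : MvPowerSeries σ K} (hf : ∀ i, constantCoeff (f i) = 0)
    (h : HasSum f s) : HasProd (fun i => mvExp (f i)) (mvExp s) := by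
  have hs : constantCoeff s = 0 := by
    have := (WithPiTopology.hasSum_iff_hasSum_coeff.1 h) 0
    simp only [coeff_zero_eq_constantCoeff_apply, hf] at this
    exact (hasSum_zero.unique this).symm
  have h' : Filter.Tendsto (fun t : Finset ι => ∑ i ∈ t, f i) Filter.atTop (nhds s) := h
  have hfs : ∀ t : Finset ι, constantCoeff (∑ i ∈ t, f i) = 0 := fun t => by
    rw [map_sum]
    exact Finset.sum_eq_zero fun i _ => hf i
  have key : Filter.Tendsto (fun t : Finset ι => ∏ i ∈ t, mvExp (f i)) Filter.atTop
      (nhds (mvExp s)) := by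
    rw [WithPiTopology.tendsto_iff_coeff_tendsto]
    intro m
    simp only [← mvExp_sum _ hf, coeff_mvExp (hfs _) le_rfl, coeff_mvExp hs le_rfl]
    refine tendsto_finsetSum _ fun j _ => Filter.Tendsto.const_mul _ ?_
    exact ((WithPiTopology.continuous_coeff K m).tendsto _).comp (h'.pow j)
  exact key

theorem constantCoeff_negLog {z : MvPowerSeries σ K} (hz : constantCoeff z = 0) :
    constantCoeff (negLog z) = 0 := by
  rw [← coeff_zero_eq_constantCoeff_apply, coeff_negLog hz (N := 0) (by simp)]
  simp

theorem hasSum_negLog [TopologicalSpace K] {z : MvPowerSeries σ K} (hz : constantCoeff z = 0) :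
    HasSum (fun r : ℕ+ => (((r : ℕ) : K))⁻¹ • z ^ (r : ℕ)) (negLog z) := by
  rw [WithPiTopology.hasSum_iff_hasSum_coeff]
  intro m
  have h1 : HasSum (fun r : ℕ => ((r : K))⁻¹ * coeff m (z ^ r)) (coeff m (negLog z)) := by
    refine hasSum_sum_of_ne_finset_zero (s := Finset.range (m.degree + 1)) fun r hr => ?_
    rw [Finset.mem_range] at hr
    rw [coeff_pow_eq_zero hz (by omega), mul_zero]
  have h2 : (fun r : ℕ+ => coeff m ((((r : ℕ) : K))⁻¹ • z ^ (r : ℕ))) =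
      (fun r : ℕ => ((r : K))⁻¹ * coeff m (z ^ r)) ∘ ((↑) : ℕ+ → ℕ) := by
    funext r
    rw [coeff_smul]
    rfl
  rw [h2]
  refine (Function.Injective.hasSum_iff PNat.coe_injective ?_).2 h1
  intro r hr
  have : r = 0 := by
    by_contra h0
    exact hr ⟨⟨r, Nat.pos_of_ne_zero h0⟩, rfl⟩
  rw [this]
  simp

theorem eulerD_negLog (w : σ → ℕ) {z : MvPowerSeries σ K} (hz : constantCoeff z = 0) :
    eulerD w (negLog z) * (1 - z) = eulerD w z := by
  ext m
  have h1 : EqUpTo (m.degree + 1) (negLog z)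
      (∑ r ∈ Finset.range (m.degree + 1 + 1), ((r : K))⁻¹ • z ^ r) := fun m' hm' => by
    rw [coeff_negLog hz hm', map_sum]
    rfl
  have h2 : EqUpTo (m.degree + 1) (1 - z) (1 - z) := fun _ _ => rfl
  -- Up to the degree in question the logarithm is a finite sum; its Euler derivative is a finite
  -- geometric sum times that of `z`, and multiplication by `1 - z` telescopes it.
  rw [((h1.eulerD w).mul h2) m (by omega), Finset.sum_range_succ', map_add, map_smul, pow_zero,
    eulerD_one, smul_zero, add_zero, map_sum]
  have h3 : ∀ r ∈ Finset.range (m.degree + 1),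
      eulerD w ((((r + 1 : ℕ) : K))⁻¹ • z ^ (r + 1)) = z ^ r * eulerD w z := fun r _ => by
    rw [map_smul, eulerD_pow_succ, smul_smul,
      inv_mul_cancel₀ (Nat.cast_ne_zero.2 (Nat.succ_ne_zero r)), one_smul]
  rw [Finset.sum_congr rfl h3, ← Finset.sum_mul, mul_right_comm, geom_sum_mul_neg, sub_mul, one_mul,
    map_sub, sub_eq_self]
  classical
  rw [coeff_mul]
  refine Finset.sum_eq_zero fun p hp => ?_
  rw [Finset.HasAntidiagonal.mem_antidiagonal] at hp
  have hd := congrArg Finsupp.degree hp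
  rw [map_add] at hd
  rw [coeff_pow_eq_zero hz (by omega), zero_mul]

theorem mvExp_negLog {z : MvPowerSeries σ K} (hz : constantCoeff z = 0) :
    mvExp (negLog z) = (1 - z)⁻¹ := by
  have hu : constantCoeff (1 - z) ≠ 0 := by rw [map_sub, hz, map_one, sub_zero]; exact one_ne_zero
  have hinv : (1 - z) * (1 - z)⁻¹ = 1 := MvPowerSeries.mul_inv_cancel _ hu
  refine eulerD_one_unique (eulerD_mvExp 1 (constantCoeff_negLog hz)) ?_
    (constantCoeff_eulerD _ _) ?_
  · have h1 := congrArg (eulerD (1 : σ → ℕ)) hinv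
    rw [eulerD_mul, eulerD_one, map_sub, eulerD_one, zero_sub] at h1
    have h2 := eulerD_negLog (1 : σ → ℕ) hz
    linear_combination (1 - z)⁻¹ * h1 - (1 - z)⁻¹ * (1 - z)⁻¹ * h2 +
      ((1 - z)⁻¹ * eulerD 1 (negLog z) - eulerD 1 (1 - z)⁻¹) * hinv
  · rw [constantCoeff_mvExp (constantCoeff_negLog hz), constantCoeff_inv, map_sub, hz, map_one,
      sub_zero, inv_one]

end MvExp

/-! ### Homogeneous power series -/

section Homogeneous

open MvPowerSeries

variable {σ K : Type*} [Field K] {ω : σ → ℕ}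

/-- All monomials of `f` have weight `d`. -/
def HasWeight (ω : σ → ℕ) (f : MvPowerSeries σ K) (d : ℕ) : Prop :=
  ∀ m, Finsupp.weight ω m ≠ d → coeff m f = 0

theorem hasWeight_one : HasWeight ω (1 : MvPowerSeries σ K) 0 := fun m hm => by
  classical
  rw [coeff_one, if_neg]
  rintro rfl
  exact hm (map_zero _)

theorem HasWeight.mul {f g : MvPowerSeries σ K} {d e : ℕ} (hf : HasWeight ω f d)
    (hg : HasWeight ω g e) : HasWeight ω (f * g) (d + e) := fun m hm => by
  classical
  rw [coeff_mul]
  refine Finset.sum_eq_zero fun p hp => ?_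
  rw [Finset.HasAntidiagonal.mem_antidiagonal] at hp
  by_cases h1 : Finsupp.weight ω p.1 = d
  · rw [hg p.2 fun h2 => hm (by rw [← hp, map_add, h1, h2]), mul_zero]
  · rw [hf _ h1, zero_mul]

theorem HasWeight.smul {f : MvPowerSeries σ K} {d : ℕ} (c : K) (hf : HasWeight ω f d) :
    HasWeight ω (c • f) d := fun m hm => by rw [coeff_smul, hf m hm, mul_zero]

theorem HasWeight.pow {f : MvPowerSeries σ K} {d : ℕ} (hf : HasWeight ω f d) (j : ℕ) :
    HasWeight ω (f ^ j) (j * d) := by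
  induction j with
  | zero => simpa using hasWeight_one
  | succ j ih =>
    rw [pow_succ, Nat.succ_mul]
    exact ih.mul hf

theorem HasWeight.sum {ι : Type*} (s : Finset ι) {f : ι → MvPowerSeries σ K} {d : ℕ}
    (hf : ∀ i ∈ s, HasWeight ω (f i) d) : HasWeight ω (∑ i ∈ s, f i) d := fun m hm => by
  rw [map_sum]
  exact Finset.sum_eq_zero fun i hi => hf i hi m hm

theorem HasWeight.prod {ι : Type*} (s : Finset ι) {f : ι → MvPowerSeries σ K}
    {d : ι → ℕ} (hf : ∀ i ∈ s, HasWeight ω (f i) (d i)) :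
    HasWeight ω (∏ i ∈ s, f i) (∑ i ∈ s, d i) := by
  classical
  induction s using Finset.induction_on with
  | empty => simpa using hasWeight_one
  | insert i s hi ih =>
    rw [Finset.prod_insert hi, Finset.sum_insert hi]
    exact (hf i (Finset.mem_insert_self _ _)).mul
      (ih fun j hj => hf j (Finset.mem_insert_of_mem hj))

theorem hasWeight_X_pow (s : σ) (j : ℕ) :
    HasWeight ω (X s ^ j : MvPowerSeries σ K) (j * ω s) := fun m hm => by
  classical
  rw [coeff_X_pow, if_neg]
  rintro rfl
  exact hm (by rw [Finsupp.weight_single, smul_eq_mul])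

/-- Multiplication by a series of weight `0` commutes with taking parts of given weight. -/
theorem HasWeight.coeff_mul_congr {f : MvPowerSeries σ K}
    (hf : HasWeight ω f 0) {g h : MvPowerSeries σ K} {m : σ →₀ ℕ}
    (hgh : ∀ m', Finsupp.weight ω m' = Finsupp.weight ω m → coeff m' g = coeff m' h) :
    coeff m (f * g) = coeff m (f * h) := by
  classical
  rw [coeff_mul, coeff_mul]
  refine Finset.sum_congr rfl fun p hp => ?_
  rw [Finset.HasAntidiagonal.mem_antidiagonal] at hp
  have hd := congrArg (Finsupp.weight ω) hp
  rw [map_add] at hd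
  by_cases h1 : Finsupp.weight ω p.1 = 0
  · rw [hgh p.2 (by omega)]
  · rw [hf _ h1, zero_mul, zero_mul]

/-- The sum of a family of homogeneous series of weights `1, 2, …`. -/
def gradedSum (ω : σ → ℕ) (w : ℕ+ → MvPowerSeries σ K) : MvPowerSeries σ K := fun m =>
  if Finsupp.weight ω m = 0 then 0 else coeff m (w (Finsupp.weight ω m).toPNat')

theorem coeff_gradedSum_of_eq_zero {w : ℕ+ → MvPowerSeries σ K} {m : σ →₀ ℕ}
    (hm : Finsupp.weight ω m = 0) : coeff m (gradedSum ω w) = 0 := if_pos hm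

theorem coeff_gradedSum_of_eq {w : ℕ+ → MvPowerSeries σ K} {m : σ →₀ ℕ} {k : ℕ+}
    (hm : Finsupp.weight ω m = k) : coeff m (gradedSum ω w) = coeff m (w k) := by
  have h0 : Finsupp.weight ω m ≠ 0 := hm ▸ k.ne_zero
  have : coeff m (gradedSum ω w) = coeff m (w (Finsupp.weight ω m).toPNat') := if_neg h0
  rw [this, hm, PNat.coe_toPNat']

theorem constantCoeff_gradedSum (w : ℕ+ → MvPowerSeries σ K) :
    constantCoeff (gradedSum ω w) = 0 :=
  coeff_gradedSum_of_eq_zero (ω := ω) (w := w) (m := 0) (map_zero _)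

theorem hasSum_gradedSum [TopologicalSpace K] {w : ℕ+ → MvPowerSeries σ K}
    (hw : ∀ k, HasWeight ω (w k) k) : HasSum w (gradedSum ω w) := by
  rw [WithPiTopology.hasSum_iff_hasSum_coeff]
  intro m
  by_cases hm : Finsupp.weight ω m = 0
  · rw [coeff_gradedSum_of_eq_zero hm]
    convert hasSum_zero with k
    exact hw k m (hm ▸ k.ne_zero.symm)
  · obtain ⟨k, hk⟩ : ∃ k : ℕ+, Finsupp.weight ω m = k :=
      ⟨⟨_, Nat.pos_of_ne_zero hm⟩, rfl⟩
    rw [coeff_gradedSum_of_eq hk]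
    refine hasSum_single k fun j hj => hw j m ?_
    rw [hk]
    exact fun h => hj (PNat.coe_injective h).symm

variable [CharZero K]

/-- The part of weight `d` of the exponential is `expCoeff K w d`. The series glued from these parts
satisfies the Euler equation of the exponential, by `natCast_smul_expCoeff`, and uniqueness applies.
-/
theorem coeff_mvExp_gradedSum {w : ℕ+ → MvPowerSeries σ K}
    (hw : ∀ k, HasWeight ω (w k) k) (m : σ →₀ ℕ) :
    coeff m (mvExp (gradedSum ω w)) = coeff m (expCoeff K w (Finsupp.weight ω m)) := by
  classical
  set V := gradedSum ω w with hV
  let G : MvPowerSeries σ K := fun m => coeff m (expCoeff K w (Finsupp.weight ω m))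
  have hG : ∀ m, coeff m G = coeff m (expCoeff K w (Finsupp.weight ω m)) := fun m => rfl
  have hV0 : constantCoeff V = 0 := constantCoeff_gradedSum w
  have hθ : ∀ m, coeff m (eulerD ω V) =
      coeff m ((Finsupp.weight ω m : K) • w (Finsupp.weight ω m).toPNat') := fun m => by
    rw [coeff_eulerD, coeff_smul]
    by_cases hm : Finsupp.weight ω m = 0
    · rw [hm, Nat.cast_zero, zero_mul, zero_mul]
    · rw [hV, coeff_gradedSum_of_eq (k := (Finsupp.weight ω m).toPNat')]
      rw [Nat.toPNat'_coe, if_pos (Nat.pos_of_ne_zero hm)]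
  suffices h : mvExp V = G by rw [h, hG]
  refine eulerD_unique ω (eulerD_mvExp ω hV0) ?_ ?_ ?_
  · ext m
    rw [coeff_eulerD, hG, ← smul_eq_mul, ← map_smul, natCast_smul_expCoeff, map_sum, coeff_mul]
    simp only [coeff_mul]
    rw [Finset.sum_comm]
    refine Finset.sum_congr rfl fun p hp => ?_
    rw [Finset.HasAntidiagonal.mem_antidiagonal] at hp
    have hd := congrArg (Finsupp.weight ω) hp
    rw [map_add] at hd
    rw [Finset.sum_eq_single (Finsupp.weight ω p.1, Finsupp.weight ω p.2), hθ, hG]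
    · rintro ⟨i, j⟩ hij hne
      rw [Finset.HasAntidiagonal.mem_antidiagonal] at hij
      simp only at hij ⊢
      rw [coeff_smul]
      by_cases hi : i = 0
      · rw [hi, Nat.cast_zero, zero_mul, zero_mul]
      · rw [hw i.toPNat' p.1, mul_zero, zero_mul]
        rw [Nat.toPNat'_coe, if_pos (Nat.pos_of_ne_zero hi)]
        intro h
        exact hne (Prod.ext h.symm (by simp only; omega))
    · intro h
      exact absurd (Finset.HasAntidiagonal.mem_antidiagonal.2 hd) h
  · intro m hm
    rw [coeff_eulerD, hm, Nat.cast_zero, zero_mul]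
  · intro m hm
    rw [coeff_mvExp hV0 le_rfl, hG, hm, expCoeff_zero, Finset.sum_range_succ', pow_zero,
      Finset.sum_eq_zero, zero_add, Nat.factorial_zero, Nat.cast_one, inv_one, one_mul]
    intro j _
    rw [pow_succ', coeff_mul, Finset.sum_eq_zero, mul_zero]
    intro p hp
    rw [Finset.HasAntidiagonal.mem_antidiagonal] at hp
    have hd := congrArg (Finsupp.weight ω) hp
    rw [map_add] at hd
    rw [hV, coeff_gradedSum_of_eq_zero (by omega), zero_mul]

end Homogeneous

/-! ### Power series in the parameter `A` -/

section ParameterSeries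

open MvPowerSeries

variable {K : Type*} [Field K] {ι κ : Type*}

/-- The weight counting the exponent of `A`. -/
def wtA : Var ι κ → ℕ
  | Var.A => 1
  | _ => 0

/-- The weight counting the degree in the `x_i`. -/
def wtX : Var ι κ → ℕ
  | Var.x _ => 1
  | _ => 0

theorem hasWeight_serA_pow (d : ℕ) : HasWeight wtA (serA K ι κ ^ d) d := by
  simpa [wtA, serA] using hasWeight_X_pow (K := K) (ω := (wtA : Var ι κ → ℕ)) Var.A d

theorem hasWeight_serA_pow_wtX (d : ℕ) : HasWeight wtX (serA K ι κ ^ d) 0 := by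
  simpa [wtX, serA] using hasWeight_X_pow (K := K) (ω := (wtX : Var ι κ → ℕ)) Var.A d

theorem constantCoeff_serA_pow {d : ℕ} (hd : d ≠ 0) : constantCoeff (serA K ι κ ^ d) = 0 := by
  rw [map_pow, serA, constantCoeff_X, zero_pow hd]

theorem one_sub_serA_pow_mul_inv (k : ℕ+) :
    (1 - serA K ι κ ^ (k : ℕ)) * (1 - serA K ι κ ^ (k : ℕ))⁻¹ = 1 :=
  MvPowerSeries.mul_inv_cancel _ (by
    rw [map_sub, constantCoeff_serA_pow k.ne_zero, map_one, sub_zero]; exact one_ne_zero)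

variable (ι κ) in
/-- The series `∑ d, f d A ^ d`. -/
def serOfA (f : ℕ → K) : Ser K ι κ := fun m =>
  f (Finsupp.weight wtA m) * coeff m (serA K ι κ ^ Finsupp.weight wtA m)

theorem coeff_serOfA (f : ℕ → K) (m : Var ι κ →₀ ℕ) : coeff m (serOfA ι κ f) =
    f (Finsupp.weight wtA m) * coeff m (serA K ι κ ^ Finsupp.weight wtA m) := rfl

theorem serOfA_sub (f g : ℕ → K) : serOfA ι κ (f - g) = serOfA ι κ f - serOfA ι κ g := by
  ext m
  rw [map_sub, coeff_serOfA, coeff_serOfA, coeff_serOfA, Pi.sub_apply, sub_mul]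

theorem hasWeight_serOfA (f : ℕ → K) : HasWeight wtX (serOfA ι κ f) 0 := fun m hm => by
  rw [coeff_serOfA, hasWeight_serA_pow_wtX _ m hm, mul_zero]

section

variable [TopologicalSpace K]

theorem hasSum_serOfA (f : ℕ → K) :
    HasSum (fun d => f d • serA K ι κ ^ d) (serOfA ι κ f) := by
  rw [WithPiTopology.hasSum_iff_hasSum_coeff]
  intro m
  rw [coeff_serOfA, ← smul_eq_mul, ← map_smul]
  refine hasSum_single _ fun d hd => ?_
  rw [coeff_smul, hasWeight_serA_pow d m hd.symm, mul_zero]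

variable [IsTopologicalRing K] [T2Space K]

theorem coeff_serOfA_mul (f : ℕ → K) {g : Ser K ι κ} (hg : HasWeight wtA g 0)
    (m : Var ι κ →₀ ℕ) : coeff m (serOfA ι κ f * g) =
      f (Finsupp.weight wtA m) * coeff m (serA K ι κ ^ Finsupp.weight wtA m * g) := by
  have h := (hasSum_serOfA (ι := ι) (κ := κ) f).mul_right g
  rw [WithPiTopology.hasSum_iff_hasSum_coeff] at h
  refine (h m).unique ?_
  rw [← smul_eq_mul, ← map_smul, ← smul_mul_assoc]
  refine hasSum_single _ fun d hd => ?_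
  rw [smul_mul_assoc, coeff_smul,
    ((hasWeight_serA_pow d).mul hg) m (by rw [add_zero]; exact hd.symm), mul_zero]

theorem serA_pow_mul_serOfA (f : ℕ → K) (k : ℕ) : serA K ι κ ^ k * serOfA ι κ f =
    serOfA ι κ fun d => if k ≤ d then f (d - k) else 0 := by
  refine ((hasSum_serOfA f).mul_left (serA K ι κ ^ k)).unique ?_
  have h := hasSum_serOfA (ι := ι) (κ := κ) fun d => if k ≤ d then f (d - k) else 0
  rw [← Function.Injective.hasSum_iff (add_left_injective k)] at h
  · have h' : (fun d => serA K ι κ ^ k * f d • serA K ι κ ^ d) =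
        (fun d => (if k ≤ d then f (d - k) else 0) • serA K ι κ ^ d) ∘ fun x => x + k := by
      funext d
      rw [Function.comp_apply, if_pos (Nat.le_add_left k d), Nat.add_sub_cancel, mul_smul_comm,
        ← pow_add, add_comm]
    rw [h']
    exact h
  · intro d hd
    rw [if_neg, zero_smul]
    exact fun hk => hd ⟨d - k, Nat.sub_add_cancel hk⟩

end

/-- The series `∑ γ, f γ A ^ |γ|` over all exponent vectors. -/
def genA (ι κ : Type*) (f : (ℕ+ →₀ ℕ) → K) : Ser K ι κ := serOfA ι κ fun d => ∑ γ ∈ expsOf d, f γ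

/-- Exponent vectors with a part `k` correspond to arbitrary vectors of weight smaller by `k`. -/
theorem sum_expsOf_add_single {M : Type*} [AddCommMonoid M] {h : (ℕ+ →₀ ℕ) → M} {k : ℕ+}
    (hh : ∀ γ, γ k = 0 → h γ = 0) (d : ℕ) : ∑ γ ∈ expsOf d, h γ =
      if (k : ℕ) ≤ d then ∑ γ ∈ expsOf (d - k), h (γ + Finsupp.single k 1) else 0 := by
  classical
  have hle : ∀ γ : ℕ+ →₀ ℕ, γ k ≠ 0 → γ - Finsupp.single k 1 + Finsupp.single k 1 = γ := fun γ hγ =>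
    tsub_add_cancel_of_le (Finsupp.single_le_iff.2 (Nat.one_le_iff_ne_zero.2 hγ))
  have hw : ∀ γ : ℕ+ →₀ ℕ, γ k ≠ 0 → Finsupp.weight pwt γ =
      Finsupp.weight pwt (γ - Finsupp.single k 1) + k := fun γ hγ => by
    rw [← weight_add_single, hle γ hγ]
  have h1 : ∑ γ ∈ expsOf d, h γ = ∑ γ ∈ expsOf d with γ k ≠ 0, h γ := by
    rw [Finset.sum_filter]
    refine Finset.sum_congr rfl fun γ _ => ?_
    split_ifs with h0
    · rfl
    · exact hh γ (not_not.1 h0)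
  rw [h1]
  split_ifs with hd
  · refine Finset.sum_nbij' (fun γ => γ - Finsupp.single k 1) (fun γ => γ + Finsupp.single k 1)
      ?_ ?_ ?_ ?_ ?_
    · intro γ hγ
      rw [Finset.mem_filter, mem_expsOf] at hγ
      have := hw γ hγ.2
      rw [mem_expsOf]
      omega
    · intro γ hγ
      rw [mem_expsOf] at hγ
      rw [Finset.mem_filter, mem_expsOf, weight_add_single]
      exact ⟨by omega, by simp⟩
    · intro γ hγ
      exact hle γ (Finset.mem_filter.1 hγ).2
    · intro γ _
      exact add_tsub_cancel_right _ _
    · intro γ hγ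
      rw [hle γ (Finset.mem_filter.1 hγ).2]
  · refine Finset.sum_eq_zero fun γ hγ => ?_
    rw [Finset.mem_filter, mem_expsOf] at hγ
    have := hw γ hγ.2
    omega

variable [TopologicalSpace K] [IsTopologicalRing K] [T2Space K]

/-- Multiplication by `1 - A^k` is the difference operator in the `k`-th entry of `γ`. This turns
recursions such as Pascal's rule into identities of generating functions. -/
theorem one_sub_serA_pow_mul_genA {f g : (ℕ+ →₀ ℕ) → K} {k : ℕ+}
    (h1 : ∀ γ, f (γ + Finsupp.single k 1) = f γ + g (γ + Finsupp.single k 1))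
    (h0 : ∀ γ, γ k = 0 → f γ = g γ) :
    (1 - serA K ι κ ^ (k : ℕ)) * genA ι κ f = genA ι κ g := by
  rw [sub_mul, one_mul, genA, genA, serA_pow_mul_serOfA, ← serOfA_sub]
  congr 1
  funext d
  rw [Pi.sub_apply, sub_eq_iff_eq_add, ← sub_eq_iff_eq_add', ← Finset.sum_sub_distrib,
    sum_expsOf_add_single (k := k) fun γ hγ => by rw [h0 γ hγ, sub_self]]
  refine if_congr Iff.rfl (Finset.sum_congr rfl fun γ _ => ?_) rfl
  rw [h1, add_sub_cancel_right]

/-- Euler's generating function for partitions with all parts in `s`. -/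
theorem prod_inv_one_sub_serA_pow (s : Finset ℕ+) : ∏ k ∈ s, (1 - serA K ι κ ^ (k : ℕ))⁻¹ =
    genA ι κ fun γ => open Classical in if γ.support ⊆ s then 1 else 0 := by
  classical
  induction s using Finset.induction_on with
  | empty =>
    rw [Finset.prod_empty, genA]
    refine HasSum.unique ?_ (hasSum_serOfA (ι := ι) (κ := κ) _)
    convert hasSum_single (f := fun d => (∑ γ ∈ expsOf d,
      if γ.support ⊆ ∅ then (1 : K) else 0) • serA K ι κ ^ d) 0 ?_
    · rw [Finset.sum_eq_single 0]
      · simp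
      · intro γ _ hγ
        rw [if_neg]
        rwa [Finset.subset_empty, Finsupp.support_eq_empty]
      · intro h
        exact absurd (mem_expsOf.2 (map_zero _)) h
    · intro d hd
      rw [Finset.sum_eq_zero, zero_smul]
      intro γ hγ
      rw [if_neg]
      rw [Finset.subset_empty, Finsupp.support_eq_empty]
      rintro rfl
      exact hd (by rw [← mem_expsOf.1 hγ, map_zero])
  | insert k s hk ih =>
    rw [Finset.prod_insert hk, ih, ← one_sub_serA_pow_mul_genA (k := k)
      (f := fun γ => if γ.support ⊆ insert k s then (1 : K) else 0), ← mul_assoc,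
      mul_comm _ (1 - serA K ι κ ^ (k : ℕ)), one_sub_serA_pow_mul_inv, one_mul]
    · intro γ
      have h1 : (γ + Finsupp.single k 1).support = insert k γ.support := by
        ext j
        rw [Finset.mem_insert, Finsupp.mem_support_iff, Finsupp.mem_support_iff, Finsupp.add_apply,
          Finsupp.single_apply]
        split_ifs with hj
        · simp [hj]
        · simp [Ne.symm hj]
      rw [h1, if_neg (c := insert k γ.support ⊆ s) fun h => hk (h (Finset.mem_insert_self _ _)),
        add_zero]
      refine if_congr ⟨fun h => (Finset.subset_insert _ _).trans h, fun h =>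
        Finset.insert_subset (Finset.mem_insert_self _ _) h⟩ rfl rfl
    · intro γ hγ
      refine if_congr ?_ rfl rfl
      rw [Finset.subset_insert_iff_of_notMem (Finsupp.notMem_support_iff.2 hγ)]

theorem hasProd_inv_one_sub_serA_pow :
    HasProd (fun k : ℕ+ => (1 - serA K ι κ ^ (k : ℕ))⁻¹) (genA ι κ fun _ => 1) := by
  classical
  have key : Filter.Tendsto (fun s : Finset ℕ+ => ∏ k ∈ s, (1 - serA K ι κ ^ (k : ℕ))⁻¹)
      Filter.atTop (nhds (genA ι κ fun _ => 1)) := by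
    rw [WithPiTopology.tendsto_iff_coeff_tendsto]
    intro m
    refine tendsto_nhds_of_eventually_eq ?_
    -- A coefficient is stationary once `s` contains every part of every exponent vector whose
    -- weight is the exponent of `A`.
    filter_upwards [Filter.eventually_ge_atTop
      ((expsOf (Finsupp.weight wtA m)).biUnion Finsupp.support)] with s hs
    rw [prod_inv_one_sub_serA_pow, genA, genA, coeff_serOfA, coeff_serOfA]
    congr 1
    refine Finset.sum_congr rfl fun γ hγ => if_pos ?_
    exact (Finset.subset_biUnion_of_mem Finsupp.support hγ).trans hs
  exact key

end ParameterSeries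

/-! ### The generalised Cauchy identity -/

section Cauchy

open MvPowerSeries

variable {K : Type*} [Field K] {q t : K} {ι κ : Type*}

/-- The coefficient `(1 / n) (1 - t ^ n) / (1 - q ^ n)` of the exponent of the Cauchy kernel. -/
def kernelCoef (q t : K) (n : ℕ+) : K :=
  1 / ((n : ℕ) : K) * ((1 - t ^ (n : ℕ)) / (1 - q ^ (n : ℕ)))

/-- The summands of the exponent of the Cauchy kernel. -/
def kernelTerm (q t : K) (Z W : ℕ+ → Ser K ι κ) (n : ℕ+) : Ser K ι κ :=
  kernelCoef q t n • (Z n * W n)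

theorem inv_powerSumNorm (q t : K) (α : ℕ+ →₀ ℕ) :
    (powerSumNorm q t α)⁻¹ = expTerm K (kernelCoef q t) α := by
  rw [powerSumNorm, expTerm, Finsupp.prod, Finsupp.prod, ← Finset.prod_inv_distrib]
  refine Finset.prod_congr rfl fun k _ => ?_
  rw [kernelCoef, mul_inv, mul_inv, smul_eq_mul, mul_pow, one_div, ← inv_pow, ← inv_pow, inv_div]
  ring

theorem expTerm_kernelTerm (q t : K) (Z W : ℕ+ → Ser K ι κ) (α : ℕ+ →₀ ℕ) :
    expTerm K (kernelTerm q t Z W) α = (powerSumNorm q t α)⁻¹ •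
      (evalAt Z (MvPolynomial.monomial α 1) * evalAt W (MvPolynomial.monomial α 1)) := by
  rw [inv_powerSumNorm, evalAt, evalAt, MvPolynomial.aeval_monomial, MvPolynomial.aeval_monomial,
    map_one, one_mul, one_mul, expTerm, expTerm, Finsupp.prod, Finsupp.prod, Finsupp.prod,
    Finsupp.prod, ← Finset.prod_mul_distrib, Algebra.smul_def, map_prod, ← Finset.prod_mul_distrib]
  refine Finset.prod_congr rfl fun k _ => ?_
  rw [kernelTerm, ← Algebra.smul_def, smul_pow, smul_smul, mul_pow, smul_eq_mul]

/-- `z_{γ + α} / (z_γ z_α)`, for the norms `z` of the products of power sums. -/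
def normRatio (q t : K) (α γ : ℕ+ →₀ ℕ) : K :=
  powerSumNorm q t (γ + α) * (powerSumNorm q t γ)⁻¹ * (powerSumNorm q t α)⁻¹

section

variable [CharZero K]

theorem powerSumNorm_add_single (q t : K) (α : ℕ+ →₀ ℕ) (k : ℕ+) :
    powerSumNorm q t (α + Finsupp.single k 1) =
      powerSumNorm q t α * (((α k : K) + 1) * (kernelCoef q t k)⁻¹) := by
  have h := smul_expTerm_add_single (K := K) (kernelCoef q t) α k
  rw [← inv_powerSumNorm, ← inv_powerSumNorm, smul_eq_mul] at h
  have h1 : ((α k + 1 : ℕ) : K) ≠ 0 := Nat.cast_ne_zero.2 (Nat.succ_ne_zero _)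
  have h2 := congrArg (fun x => ((α k + 1 : ℕ) : K) * x⁻¹) h
  simp only [mul_inv, inv_inv] at h2
  rw [← mul_assoc, mul_inv_cancel₀ h1, one_mul] at h2
  rw [h2]
  push_cast
  ring

theorem MulIndep.kernelCoef_ne_zero (h : MulIndep q t) (k : ℕ+) : kernelCoef q t k ≠ 0 :=
  mul_ne_zero (one_div_ne_zero (Nat.cast_ne_zero.2 k.ne_zero))
    (div_ne_zero (sub_ne_zero.2 (h.t_pow_ne_one k).symm) (sub_ne_zero.2 (h.q_pow_ne_one k).symm))

theorem normRatio_zero (h : MulIndep q t) (γ : ℕ+ →₀ ℕ) : normRatio q t 0 γ = 1 := by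
  rw [normRatio, add_zero, mul_inv_cancel₀ (h.powerSumNorm_ne_zero γ), one_mul, powerSumNorm,
    Finsupp.prod_zero_index, inv_one]

/-- Pascal's rule: the factors involving `q` and `t` cancel, and `normRatio q t α γ` is the product
of the binomial coefficients of `γ_k + α_k` over `α_k`. -/
theorem normRatio_add_single (h : MulIndep q t) (α γ : ℕ+ →₀ ℕ) (k : ℕ+) :
    normRatio q t (α + Finsupp.single k 1) (γ + Finsupp.single k 1) =
      normRatio q t (α + Finsupp.single k 1) γ + normRatio q t α (γ + Finsupp.single k 1) := by
  have e1 : γ + Finsupp.single k 1 + (α + Finsupp.single k 1) =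
    γ + α + Finsupp.single k 1 + Finsupp.single k 1 := by abel
  have e2 : γ + (α + Finsupp.single k 1) = γ + α + Finsupp.single k 1 := by abel
  have e3 : γ + Finsupp.single k 1 + α = γ + α + Finsupp.single k 1 := by abel
  have hc := h.kernelCoef_ne_zero k
  have hα := h.powerSumNorm_ne_zero α
  have hγ := h.powerSumNorm_ne_zero γ
  have n1 : (α k : K) + 1 ≠ 0 := Nat.cast_add_one_ne_zero _
  have n2 : (γ k : K) + 1 ≠ 0 := Nat.cast_add_one_ne_zero _
  simp only [normRatio, e1, e2, e3, powerSumNorm_add_single, Finsupp.add_apply,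
    Finsupp.single_eq_same]
  push_cast
  field_simp
  ring

theorem normRatio_add_single_of_eq_zero (h : MulIndep q t) (α : ℕ+ →₀ ℕ) {γ : ℕ+ →₀ ℕ} {k : ℕ+}
    (hk : γ k = 0) : normRatio q t (α + Finsupp.single k 1) γ = normRatio q t α γ := by
  have e2 : γ + (α + Finsupp.single k 1) = γ + α + Finsupp.single k 1 := by abel
  have hc := h.kernelCoef_ne_zero k
  have hα := h.powerSumNorm_ne_zero α
  have hγ := h.powerSumNorm_ne_zero γ
  have n1 : (α k : K) + 1 ≠ 0 := Nat.cast_add_one_ne_zero _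
  simp only [normRatio, e2, powerSumNorm_add_single, Finsupp.add_apply, hk, zero_add]
  field_simp

end

theorem hasWeight_scale {Z : ℕ+ → Ser K ι κ} (hZ : ∀ n, HasWeight wtX (Z n) n) (k : ℕ) (n : ℕ+) :
    HasWeight wtX (scale k Z n) n := by
  rw [scale, ← pow_mul]
  simpa using (hasWeight_serA_pow_wtX (k * n)).mul (hZ n)

theorem hasWeight_kernelTerm {Z W : ℕ+ → Ser K ι κ} (hZ : ∀ n, HasWeight wtX (Z n) n)
    (hW : ∀ n, HasWeight wtX (W n) 0) (n : ℕ+) : HasWeight wtX (kernelTerm q t Z W n) n := by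
  simpa [kernelTerm] using ((hZ n).mul (hW n)).smul (kernelCoef q t n)

theorem HasWeight.evalAt {ω : Var ι κ → ℕ} {Z : ℕ+ → Ser K ι κ} {c : ℕ}
    (hZ : ∀ n : ℕ+, HasWeight ω (Z n) (n * c)) {f : SymFun K} {d : ℕ}
    (hf : MvPolynomial.IsWeightedHomogeneous pwt f d) : HasWeight ω (evalAt Z f) (d * c) := by
  rw [evalAt_eq_sum Z hf]
  refine HasWeight.sum _ fun α hα => HasWeight.smul _ ?_
  rw [Macdonald.evalAt, MvPolynomial.aeval_monomial, map_one, one_mul, ← mem_expsOf.1 hα,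
    Finsupp.weight_apply, Finsupp.sum, Finset.sum_mul, Finsupp.prod]
  refine HasWeight.prod _ fun k _ => ?_
  rw [smul_eq_mul, mul_assoc]
  exact (hZ k).pow (α k)

/-- The summands of the logarithm of the product of all kernels. -/
def traceTerm (q t : K) (Z W : ℕ+ → Ser K ι κ) (n : ℕ+) : Ser K ι κ :=
  (1 - serA K ι κ ^ (n : ℕ))⁻¹ * kernelTerm q t Z W n

/-- The `n`-th term of the exponent has degree `n` in the `x_i`, so each coefficient of the infinite
sum comes from at most one term. -/
theorem cauchyKernel_eq_mvExp [TopologicalSpace K] [T2Space K] [CharZero K]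
    {Z W : ℕ+ → Ser K ι κ} (hZ : ∀ n, HasWeight wtX (Z n) n)
    (hW : ∀ n, HasWeight wtX (W n) 0) :
    cauchyKernel q t Z W = mvExp (gradedSum wtX (kernelTerm q t Z W)) := by
  rw [← (hasSum_gradedSum (hasWeight_kernelTerm hZ hW)).tsum_eq]
  rfl

variable [TopologicalSpace K] [IsTopologicalRing K] [T2Space K] {Z W : ℕ+ → Ser K ι κ}

theorem hasWeight_inv_one_sub_serA_pow (n : ℕ+) :
    HasWeight wtX (1 - serA K ι κ ^ (n : ℕ))⁻¹ 0 := by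
  have h := prod_inv_one_sub_serA_pow (K := K) (ι := ι) (κ := κ) {n}
  rw [Finset.prod_singleton] at h
  rw [h]
  exact hasWeight_serOfA _

theorem hasSum_serA_pow_pow (n : ℕ+) :
    HasSum (fun k => (serA K ι κ ^ (n : ℕ)) ^ k) (1 - serA K ι κ ^ (n : ℕ))⁻¹ := by
  have h0 := constantCoeff_serA_pow (K := K) (ι := ι) (κ := κ) n.ne_zero
  have h1 := WithPiTopology.tsum_pow_mul_one_sub_of_constantCoeff_eq_zero h0
  have h2 := one_sub_serA_pow_mul_inv (K := K) (ι := ι) (κ := κ) n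
  have h3 : ∑' k, (serA K ι κ ^ (n : ℕ)) ^ k = (1 - serA K ι κ ^ (n : ℕ))⁻¹ := by
    linear_combination (1 - serA K ι κ ^ (n : ℕ))⁻¹ * h1 -
      (∑' k, (serA K ι κ ^ (n : ℕ)) ^ k) * h2
  exact h3 ▸ (WithPiTopology.summable_pow_of_constantCoeff_eq_zero h0).hasSum

theorem hasWeight_traceTerm (hZ : ∀ n, HasWeight wtX (Z n) n) (hW : ∀ n, HasWeight wtX (W n) 0)
    (n : ℕ+) : HasWeight wtX (traceTerm q t Z W n) n := by
  simpa [traceTerm] using (hasWeight_inv_one_sub_serA_pow n).mul (hasWeight_kernelTerm hZ hW n)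

/-- Scaling `Z` by `A^k` multiplies the `n`-th term by `A^(k n)`; the sum over `k` is a geometric
series in `A^n`. -/
theorem hasSum_gradedSum_kernelTerm_scale (q t : K) (Z W : ℕ+ → Ser K ι κ) :
    HasSum (fun k => gradedSum wtX (kernelTerm q t (scale k Z) W))
      (gradedSum wtX (traceTerm q t Z W)) := by
  rw [WithPiTopology.hasSum_iff_hasSum_coeff]
  intro m
  by_cases hm : Finsupp.weight wtX m = 0
  · simp only [coeff_gradedSum_of_eq_zero hm]
    exact hasSum_zero
  · obtain ⟨n, hn⟩ : ∃ n : ℕ+, Finsupp.weight wtX m = n := ⟨⟨_, Nat.pos_of_ne_zero hm⟩, rfl⟩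
    simp only [coeff_gradedSum_of_eq hn]
    have h := (hasSum_serA_pow_pow n).mul_right (kernelTerm q t Z W n)
    rw [WithPiTopology.hasSum_iff_hasSum_coeff] at h
    have h' : (fun k => coeff m (kernelTerm q t (scale k Z) W n)) =
        fun k => coeff m ((serA K ι κ ^ (n : ℕ)) ^ k * kernelTerm q t Z W n) := by
      funext k
      rw [kernelTerm, kernelTerm, scale, mul_smul_comm, mul_assoc, pow_right_comm]
    rw [h']
    exact h m

variable [CharZero K]

theorem hasProd_cauchyFactor (q t : K) (hZ : ∀ n, HasWeight wtX (Z n) n)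
    (hW : ∀ n, HasWeight wtX (W n) 0) : HasProd (cauchyFactor q t Z W)
      (genA ι κ (fun _ => 1) * mvExp (gradedSum wtX (traceTerm q t Z W))) := by
  have h1 : HasProd (fun k : ℕ => (1 - serA K ι κ ^ (k + 1))⁻¹) (genA ι κ fun _ => 1) :=
    Equiv.pnatEquivNat.symm.hasProd_iff.2 hasProd_inv_one_sub_serA_pow
  have h2 := hasProd_mvExp (fun k => constantCoeff_gradedSum _)
    (hasSum_gradedSum_kernelTerm_scale q t Z W)
  have h3 : cauchyFactor q t Z W = fun k => (1 - serA K ι κ ^ (k + 1))⁻¹ *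
      mvExp (gradedSum wtX (kernelTerm q t (scale k Z) W)) := by
    funext k
    rw [cauchyFactor, cauchyKernel_eq_mvExp (hasWeight_scale hZ k) hW]
  rw [h3]
  exact h1.mul h2

/-- Raising `α_k` by one puts a further factor `(1 - A^k)⁻¹` on the left, and by Pascal's rule it
does the same to the generating function of `normRatio` on the right. -/
theorem genA_mul_expTerm_traceTerm (h : MulIndep q t) (Z W : ℕ+ → Ser K ι κ) (α : ℕ+ →₀ ℕ) :
    genA ι κ (fun _ => 1) * expTerm K (traceTerm q t Z W) α =
      genA ι κ (normRatio q t α) * expTerm K (kernelTerm q t Z W) α := by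
  induction hd : Finsupp.degree α generalizing α with
  | zero =>
    rw [(Finsupp.degree_eq_zero_iff α).1 hd, expTerm, expTerm, Finsupp.prod_zero_index,
      Finsupp.prod_zero_index]
    simp only [funext (normRatio_zero h)]
  | succ d ih =>
    obtain ⟨k, hk⟩ : ∃ k, α k ≠ 0 := by
      by_contra hcon
      push Not at hcon
      rw [show α = 0 from Finsupp.ext hcon, map_zero] at hd
      omega
    obtain ⟨β, rfl⟩ : ∃ β, α = β + Finsupp.single k 1 :=
      ⟨α - Finsupp.single k 1, (tsub_add_cancel_of_le
        (Finsupp.single_le_iff.2 (Nat.one_le_iff_ne_zero.2 hk))).symm⟩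
    rw [map_add, Finsupp.degree_single] at hd
    have ih' := ih β (by omega)
    have h1 := smul_expTerm_add_single (K := K) (traceTerm q t Z W) β k
    have h2 := smul_expTerm_add_single (K := K) (kernelTerm q t Z W) β k
    have h3 := one_sub_serA_pow_mul_genA (ι := ι) (κ := κ) (k := k)
      (fun γ => normRatio_add_single h β γ k) (fun γ => normRatio_add_single_of_eq_zero h β)
    have hn : ((β k + 1 : ℕ) : K) ≠ 0 := Nat.cast_ne_zero.2 (Nat.succ_ne_zero _)
    refine smul_right_injective _ hn ?_
    simp only
    rw [← mul_smul_comm, ← mul_smul_comm, h1, h2, traceTerm]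
    have h4 := one_sub_serA_pow_mul_inv (K := K) (ι := ι) (κ := κ) k
    rw [← h3] at ih'
    linear_combination (1 - serA K ι κ ^ (k : ℕ))⁻¹ * kernelTerm q t Z W k * ih' +
      genA ι κ (normRatio q t (β + Finsupp.single k 1)) * kernelTerm q t Z W k *
        expTerm K (kernelTerm q t Z W) β * h4

theorem hasSum_cauchyTerm (h : MulIndep q t) (hZ : ∀ n, HasWeight wtX (Z n) n)
    (hZA : ∀ n, HasWeight wtA (Z n) 0) (hW : ∀ n, HasWeight wtX (W n) 0)
    (hWA : ∀ n, HasWeight wtA (W n) 0) : HasSum (cauchyTerm q t Z W)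
      (genA ι κ (fun _ => 1) * mvExp (gradedSum wtX (traceTerm q t Z W))) := by
  classical
  rw [WithPiTopology.hasSum_iff_hasSum_coeff]
  intro m
  set d := Finsupp.weight wtA m with hd
  set e := Finsupp.weight wtX m with he
  -- A monomial of degree `d` in `A` and `e` in the `x_i` only sees the pairs with `|μ| = d` and
  -- `|ρ| = d + e`. The factor `genA` has degree `0` in the `x_i`, so the exponential may be
  -- replaced by its part of degree `e`.
  have h1 : coeff m (genA ι κ (fun _ => 1) * mvExp (gradedSum wtX (traceTerm q t Z W))) =
      coeff m (∑ p ∈ partitionsOf d ×ˢ partitionsOf (d + e), cauchyTerm q t Z W p) := by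
    rw [HasWeight.coeff_mul_congr (f := genA ι κ fun _ => 1) (hasWeight_serOfA _)
      (h := expCoeff K (traceTerm q t Z W) e)
      fun m' hm' => by rw [coeff_mvExp_gradedSum (hasWeight_traceTerm hZ hW), hm'],
      Finset.sum_product, sum_cauchyTerm h, expCoeff, Finset.mul_sum, map_sum, map_sum]
    refine Finset.sum_congr rfl fun α hα => ?_
    have hA : HasWeight wtA (expTerm K (kernelTerm q t Z W) α) 0 := by
      have hα' := MvPolynomial.isWeightedHomogeneous_monomial pwt α (1 : K) (mem_expsOf.1 hα)
      rw [expTerm_kernelTerm]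
      simpa using ((HasWeight.evalAt (c := 0) (by simpa using hZA) hα').mul
        (HasWeight.evalAt (c := 0) (by simpa using hWA) hα')).smul (powerSumNorm q t α)⁻¹
    rw [genA_mul_expTerm_traceTerm h, genA, coeff_serOfA_mul _ hA, expTerm_kernelTerm,
      mul_smul_comm, coeff_smul, coeff_smul, ← hd, ← mul_assoc, Finset.sum_mul]
    rfl
  rw [h1, map_sum]
  refine hasSum_sum_of_ne_finset_zero ?_
  rintro ⟨μ, ρ⟩ hp
  rw [Finset.mem_product, mem_partitionsOf, mem_partitionsOf] at hp
  simp only at hp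
  rw [cauchyTerm]
  rcases lt_or_ge ρ.card μ.card with hc | hc
  · rw [skewQ_eq_zero h hc, evalAt, map_zero, mul_zero, zero_mul, map_zero]
  obtain ⟨e', he'⟩ : ∃ e', μ.card + e' = ρ.card := ⟨_, Nat.add_sub_cancel' hc⟩
  have hQ := isWeightedHomogeneous_skewQ h he'
  have hP : MvPolynomial.IsWeightedHomogeneous pwt (skewP q t ρ μ) e' := by
    rw [skewP, ← MvPolynomial.mem_weightedHomogeneousSubmodule]
    exact Submodule.smul_mem _ _ hQ
  have wX : HasWeight wtX (serA K ι κ ^ μ.card * evalAt Z (skewQ q t ρ μ) *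
      evalAt W (skewP q t ρ μ)) e' := by
    simpa using ((hasWeight_serA_pow_wtX μ.card).mul
      (HasWeight.evalAt (c := 1) (by simpa using hZ) hQ)).mul
      (HasWeight.evalAt (c := 0) (by simpa using hW) hP)
  have wA : HasWeight wtA (serA K ι κ ^ μ.card * evalAt Z (skewQ q t ρ μ) *
      evalAt W (skewP q t ρ μ)) μ.card := by
    simpa using ((hasWeight_serA_pow μ.card).mul
      (HasWeight.evalAt (c := 0) (by simpa using hZA) hQ)).mul
      (HasWeight.evalAt (c := 0) (by simpa using hWA) hP)
  by_cases h2 : d = μ.card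
  · refine wX m fun h3 => hp ⟨h2.symm, ?_⟩
    omega
  · exact wA m h2

end Cauchy

/-! ### The kernels as infinite products -/

section Products

open MvPowerSeries

variable {ι κ : Type*}

section

variable {K : Type*} [Field K]

theorem coeff_powerSum_ne_zero {ι' σ : Type*} {v : ι' → σ} {n : ℕ+} {m : σ →₀ ℕ}
    (h : coeff m (powerSum K v n) ≠ 0) : ∃ i, m = Finsupp.single (v i) (n : ℕ) := by
  by_contra hcon
  exact h (if_neg hcon)

theorem hasWeight_powerSum {ι' σ : Type*} {v : ι' → σ} {ω : σ → ℕ} {c : ℕ}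
    (hv : ∀ i, ω (v i) = c) (n : ℕ+) : HasWeight ω (powerSum K v n) (n * c) := fun m hm => by
  by_contra h
  obtain ⟨i, rfl⟩ := coeff_powerSum_ne_zero h
  exact hm (by rw [Finsupp.weight_single, smul_eq_mul, hv])

theorem hasWeight_alphX (n : ℕ+) : HasWeight wtX (alphX K ι κ n) n := by
  simpa [alphX] using hasWeight_powerSum (K := K) (ω := (wtX : Var ι κ → ℕ)) (v := Var.x) (c := 1)
    (fun _ => rfl) n

theorem hasWeight_alphX_wtA (n : ℕ+) : HasWeight wtA (alphX K ι κ n) 0 := by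
  simpa [alphX] using hasWeight_powerSum (K := K) (ω := (wtA : Var ι κ → ℕ)) (v := Var.x) (c := 0)
    (fun _ => rfl) n

theorem hasWeight_alphY (n : ℕ+) : HasWeight wtX (alphY K ι κ n) 0 := by
  simpa [alphY] using hasWeight_powerSum (K := K) (ω := (wtX : Var ι κ → ℕ)) (v := Var.y) (c := 0)
    (fun _ => rfl) n

theorem hasWeight_alphY_wtA (n : ℕ+) : HasWeight wtA (alphY K ι κ n) 0 := by
  simpa [alphY] using hasWeight_powerSum (K := K) (ω := (wtA : Var ι κ → ℕ)) (v := Var.y) (c := 0)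
    (fun _ => rfl) n

theorem HasWeight.pleth {ω : Var ι κ → ℕ} {Z : ℕ+ → Ser K ι κ} {d : ℕ+ → ℕ}
    (hZ : ∀ n, HasWeight ω (Z n) (d n)) (t : K) (n : ℕ+) : HasWeight ω (pleth t Z n) (d n) :=
  (hZ n).smul _

theorem hasSum_powerSum [TopologicalSpace K] {ι' σ : Type*} {v : ι' → σ}
    (hv : Function.Injective v) (n : ℕ+) :
    HasSum (fun i => (X (v i) : MvPowerSeries σ K) ^ (n : ℕ)) (powerSum K v n) := by
  classical
  rw [WithPiTopology.hasSum_iff_hasSum_coeff]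
  intro m
  simp only [coeff_X_pow]
  by_cases h : ∃ i, m = Finsupp.single (v i) (n : ℕ)
  · obtain ⟨i, hi⟩ := h
    have h1 : coeff m (powerSum K v n) = 1 := if_pos ⟨i, hi⟩
    have h2 : (fun j => if m = Finsupp.single (v j) (n : ℕ) then (1 : K) else 0) =
        fun j => if j = i then 1 else 0 := by
      funext j
      rw [hi]
      exact if_congr ((Finsupp.single_left_inj n.ne_zero).trans (hv.eq_iff.trans eq_comm)) rfl rfl
    rw [h1, h2]
    exact hasSum_ite_eq i 1
  · have h1 : coeff m (powerSum K v n) = 0 := if_neg h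
    rw [h1]
    convert hasSum_zero with i
    exact if_neg fun hi => h ⟨i, hi⟩

/-- The exponent of the monomial `A ^ k x_i y_j`. -/
def expAXY (k : ℕ) (p : ι × κ) : Var ι κ →₀ ℕ :=
  Finsupp.single Var.A k + Finsupp.single (Var.x p.1) 1 + Finsupp.single (Var.y p.2) 1

theorem monAXY_pow (c : K) (k : ℕ) (i : ι) (j : κ) (n : ℕ) :
    monAXY c k i j ^ n = c ^ n • monomial (n • expAXY k (i, j)) 1 := by
  rw [monAXY, smul_pow, serA, X_pow_eq, X_def, X_def, monomial_mul_monomial, monomial_mul_monomial,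
    monomial_pow, expAXY]
  simp

theorem constantCoeff_monAXY (c : K) (k : ℕ) (i : ι) (j : κ) :
    constantCoeff (monAXY c k i j) = 0 := by
  rw [monAXY, ← coeff_zero_eq_constantCoeff_apply, coeff_smul, coeff_zero_eq_constantCoeff_apply,
    map_mul, constantCoeff_X, mul_zero, mul_zero]

theorem nsmul_expAXY_injective (k : ℕ) {n : ℕ} (hn : n ≠ 0) :
    Function.Injective fun p : ι × κ => n • expAXY k p := by
  classical
  rintro ⟨i, j⟩ ⟨i', j'⟩ h
  have hx := DFunLike.congr_fun h (Var.x i)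
  have hy := DFunLike.congr_fun h (Var.y j)
  simp only [expAXY, Finsupp.smul_apply, Finsupp.add_apply, Finsupp.single_apply, smul_eq_mul,
    reduceCtorEq, if_false, if_true, Var.x.injEq, Var.y.injEq, zero_add, add_zero, mul_one,
    mul_ite, mul_zero] at hx hy
  rw [eq_comm, ite_eq_left_iff] at hx hy
  refine Prod.ext ?_ ?_
  · by_contra hne
    exact hn (hx fun h => hne h.symm).symm
  · by_contra hne
    exact hn (hy fun h => hne h.symm).symm

theorem weight_wtX_nsmul_expAXY (k n : ℕ) (p : ι × κ) :
    Finsupp.weight wtX (n • expAXY k p) = n := by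
  rw [map_nsmul, expAXY, map_add, map_add, Finsupp.weight_single, Finsupp.weight_single,
    Finsupp.weight_single]
  simp [wtX]

theorem hasWeight_monomial_expAXY (k n : ℕ) (p : ι × κ) :
    HasWeight wtX (monomial (n • expAXY k p) (1 : K)) n := fun m hm => by
  classical
  rw [coeff_monomial, if_neg]
  rintro rfl
  exact hm (weight_wtX_nsmul_expAXY k n p)

theorem hasSum_monomial_expAXY [TopologicalSpace K] [IsTopologicalRing K] [T2Space K] (k : ℕ)
    (n : ℕ+) : HasSum (fun p : ι × κ => monomial ((n : ℕ) • expAXY k p) (1 : K))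
      (scale k (alphX K ι κ) n * alphY K ι κ n) := by
  classical
  have hM : ∀ p : ι × κ, monomial ((n : ℕ) • expAXY k p) (1 : K) = (serA K ι κ ^ k) ^ (n : ℕ) *
      (X (Var.x p.1) ^ (n : ℕ) * X (Var.y p.2) ^ (n : ℕ)) := fun p => by
    rw [serA, X_pow_eq, X_pow_eq, X_pow_eq, monomial_pow, monomial_mul_monomial,
      monomial_mul_monomial, expAXY]
    simp [add_assoc]
  have hM0 : ∀ p : ι × κ, (X (Var.x p.1) ^ (n : ℕ) * X (Var.y p.2) ^ (n : ℕ) : Ser K ι κ) =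
      monomial ((n : ℕ) • expAXY 0 p) (1 : K) := fun p => by
    rw [X_pow_eq, X_pow_eq, monomial_mul_monomial, expAXY]
    simp
  have hs : Summable fun p : ι × κ =>
      (X (Var.x p.1) ^ (n : ℕ) * X (Var.y p.2) ^ (n : ℕ) : Ser K ι κ) := by
    rw [WithPiTopology.summable_iff_summable_coeff]
    intro m
    refine summable_of_hasFiniteSupport (Set.Subsingleton.finite ?_)
    have : ∀ p : ι × κ,
        coeff m (X (Var.x p.1) ^ (n : ℕ) * X (Var.y p.2) ^ (n : ℕ) : Ser K ι κ) ≠ 0 →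
        m = (n : ℕ) • expAXY 0 p := fun p hp => by
      rw [hM0, coeff_monomial] at hp
      by_contra h
      exact hp (if_neg h)
    intro p hp p' hp'
    exact nsmul_expAXY_injective 0 n.ne_zero ((this p hp).symm.trans (this p' hp'))
  have h := (HasSum.mul (hasSum_powerSum (K := K) (σ := Var ι κ) (v := Var.x)
    (fun _ _ h => Var.x.inj h) n) (hasSum_powerSum (K := K) (σ := Var ι κ) (v := Var.y)
    (fun _ _ h => Var.y.inj h) n) hs).mul_left ((serA K ι κ ^ k) ^ (n : ℕ))
  simp only [hM]
  rw [scale, mul_assoc]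
  exact h

/-- A monomial of `x`-degree `n` is `(A^k x_i y_j)^n` for at most one pair `(i, j)`, so each
coefficient involves only the scalar sum over `L`, whatever the size of the alphabets. -/
theorem hasSum_gradedSum_expAXY [TopologicalSpace K] [IsTopologicalRing K] [T2Space K] {L : Type*}
    {φ : ℕ+ → L → K} {Φ : ℕ+ → K} (hφ : ∀ n, HasSum (φ n) (Φ n)) (k : ℕ) :
    HasSum (fun s : (ι × κ) × L =>
        gradedSum wtX fun n => φ n s.2 • monomial ((n : ℕ) • expAXY k s.1) (1 : K))
      (gradedSum wtX fun n => Φ n • (scale k (alphX K ι κ) n * alphY K ι κ n)) := by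
  classical
  rw [WithPiTopology.hasSum_iff_hasSum_coeff]
  intro m
  by_cases hm : Finsupp.weight wtX m = 0
  · simp only [coeff_gradedSum_of_eq_zero hm]
    exact hasSum_zero
  obtain ⟨n, hn⟩ : ∃ n : ℕ+, Finsupp.weight wtX m = n := ⟨⟨_, Nat.pos_of_ne_zero hm⟩, rfl⟩
  simp only [coeff_gradedSum_of_eq hn, coeff_smul]
  have h := WithPiTopology.hasSum_iff_hasSum_coeff.1
    (hasSum_monomial_expAXY (K := K) (ι := ι) (κ := κ) k n) m
  simp only [coeff_monomial] at h ⊢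
  by_cases hp : ∃ p : ι × κ, m = (n : ℕ) • expAXY k p
  · obtain ⟨p, rfl⟩ := hp
    have hinj : ∀ p' : ι × κ, (n : ℕ) • expAXY k p = (n : ℕ) • expAXY k p' ↔ p = p' :=
      fun p' => (nsmul_expAXY_injective k n.ne_zero).eq_iff
    simp only [hinj] at h ⊢
    have h1 : coeff ((n : ℕ) • expAXY k p) (scale k (alphX K ι κ) n * alphY K ι κ n) = 1 :=
      h.unique (by
        simpa using hasSum_single (f := fun p' : ι × κ => if p = p' then (1 : K) else 0) p
          fun p' hp' => if_neg hp'.symm)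
    rw [h1, mul_one, ← Function.Injective.hasSum_iff (Prod.mk_right_injective p)]
    · simpa [Function.comp_def] using hφ n
    · rintro ⟨p', l⟩ hl
      rw [if_neg, mul_zero]
      rintro rfl
      exact hl ⟨l, rfl⟩
  · have h0 : ∀ p : ι × κ, (if m = (n : ℕ) • expAXY k p then (1 : K) else 0) = 0 := fun p =>
      if_neg fun h => hp ⟨p, h⟩
    simp only [h0, mul_zero] at h ⊢
    rw [h.unique hasSum_zero, mul_zero]
    exact hasSum_zero

variable [CharZero K]

theorem negLog_monAXY [TopologicalSpace K] [T2Space K] (c : K) (k : ℕ) (p : ι × κ) :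
    negLog (monAXY c k p.1 p.2) = gradedSum wtX fun n =>
      (((n : ℕ) : K)⁻¹ * c ^ (n : ℕ)) • monomial ((n : ℕ) • expAXY k p) (1 : K) := by
  refine (hasSum_negLog (constantCoeff_monAXY c k p.1 p.2)).unique ?_
  simp only [monAXY_pow, smul_smul]
  exact hasSum_gradedSum fun n => (hasWeight_monomial_expAXY k n p).smul _

theorem mvExp_neg {σ : Type*} {f : MvPowerSeries σ K} (hf : constantCoeff f = 0) :
    mvExp (-f) * mvExp f = 1 := by
  rw [← mvExp_add (by rw [map_neg, hf, neg_zero]) hf, neg_add_cancel, mvExp_zero]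

theorem mvExp_neg_negLog {σ : Type*} {z : MvPowerSeries σ K} (hz : constantCoeff z = 0) :
    mvExp (-negLog z) = 1 - z := by
  have h := mvExp_neg (constantCoeff_negLog hz)
  rw [mvExp_negLog hz] at h
  have h2 : (1 - z) * (1 - z)⁻¹ = 1 := MvPowerSeries.mul_inv_cancel _ (by
    rw [map_sub, hz, map_one, sub_zero]; exact one_ne_zero)
  linear_combination (1 - z) * h - mvExp (-negLog z) * h2

end

variable {K : Type*} [NormedField K] {q t : K}

theorem norm_pow_lt_one {x : K} (hx : ‖x‖ < 1) (n : ℕ+) : ‖x ^ (n : ℕ)‖ < 1 := by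
  rw [norm_pow]
  exact pow_lt_one₀ (norm_nonneg _) hx n.ne_zero

variable [CharZero K]

/-- Taking logarithms, the coefficient of `(A^k x_i y_j)^n` is `(1/n) ∑_l (q^(l n) - t^n q^(l n))`,
a geometric series with sum `kernelCoef q t n`. -/
theorem hasProd_cauchyKernel (hq : ‖q‖ < 1) (t : K) (k : ℕ) :
    HasProd (fun s : (ι × κ) × ℕ =>
        (1 - monAXY (t * q ^ s.2) k s.1.1 s.1.2) * (1 - monAXY (q ^ s.2) k s.1.1 s.1.2)⁻¹)
      (cauchyKernel q t (scale k (alphX K ι κ)) (alphY K ι κ)) := by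
  have hφ : ∀ n : ℕ+, HasSum
      (fun l : ℕ => ((n : ℕ) : K)⁻¹ * ((q ^ l) ^ (n : ℕ) - (t * q ^ l) ^ (n : ℕ)))
      (kernelCoef q t n) := fun n => by
    have h := (hasSum_geometric_of_norm_lt_one (norm_pow_lt_one hq n)).mul_left
      (((n : ℕ) : K)⁻¹ * (1 - t ^ (n : ℕ)))
    have e1 : (fun l : ℕ => ((n : ℕ) : K)⁻¹ * ((q ^ l) ^ (n : ℕ) - (t * q ^ l) ^ (n : ℕ))) =
        fun l => ((n : ℕ) : K)⁻¹ * (1 - t ^ (n : ℕ)) * (q ^ (n : ℕ)) ^ l := by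
      funext l
      rw [mul_pow, pow_right_comm]
      ring
    have e2 : kernelCoef q t n = ((n : ℕ) : K)⁻¹ * (1 - t ^ (n : ℕ)) * (1 - q ^ (n : ℕ))⁻¹ := by
      rw [kernelCoef]
      ring
    rw [e1, e2]
    exact h
  have h := hasProd_mvExp (fun _ => constantCoeff_gradedSum _)
    (hasSum_gradedSum_expAXY (ι := ι) (κ := κ) hφ k)
  rw [cauchyKernel_eq_mvExp (hasWeight_scale hasWeight_alphX k) hasWeight_alphY]
  refine Eq.subst (motive := fun f => HasProd f _) (funext fun s => ?_) h
  symm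
  have hz := constantCoeff_monAXY (q ^ s.2) k s.1.1 s.1.2
  have hz' := constantCoeff_monAXY (t * q ^ s.2) k s.1.1 s.1.2
  rw [← mvExp_negLog hz, ← mvExp_neg_negLog hz', ← mvExp_add
    (by rw [map_neg, constantCoeff_negLog hz', neg_zero]) (constantCoeff_negLog hz),
    negLog_monAXY, negLog_monAXY]
  congr 1
  ext m
  rw [map_add, map_neg]
  by_cases hm : Finsupp.weight wtX m = 0
  · simp only [coeff_gradedSum_of_eq_zero hm, neg_zero, add_zero]
  obtain ⟨n, hn⟩ : ∃ n : ℕ+, Finsupp.weight wtX m = n := ⟨⟨_, Nat.pos_of_ne_zero hm⟩, rfl⟩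
  simp only [coeff_gradedSum_of_eq hn, coeff_smul]
  ring

/-- Of the two factors `1 / (1 - t^n)` coming from the substitution one cancels the numerator of the
kernel. What remains, `1 / ((1 - q^n) (1 - t^n))`, is a double geometric series. -/
theorem hasProd_cauchyKernel_pleth [CompleteSpace K] (hq : ‖q‖ < 1) (ht : ‖t‖ < 1) (k : ℕ) :
    HasProd (fun s : (ι × κ) × (ℕ × ℕ) => (1 - monAXY (q ^ s.2.1 * t ^ s.2.2) k s.1.1 s.1.2)⁻¹)
      (cauchyKernel q t (scale k (pleth t (alphX K ι κ))) (pleth t (alphY K ι κ))) := by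
  have hφ : ∀ n : ℕ+, HasSum
      (fun l : ℕ × ℕ => ((n : ℕ) : K)⁻¹ * (q ^ l.1 * t ^ l.2) ^ (n : ℕ))
      (((n : ℕ) : K)⁻¹ * ((1 - q ^ (n : ℕ))⁻¹ * (1 - t ^ (n : ℕ))⁻¹)) := fun n => by
    have hq' := norm_pow_lt_one hq n
    have ht' := norm_pow_lt_one ht n
    have h := ((hasSum_geometric_of_norm_lt_one hq').mul (hasSum_geometric_of_norm_lt_one ht')
      (summable_mul_of_summable_norm (summable_norm_geometric_of_norm_lt_one hq')
        (summable_norm_geometric_of_norm_lt_one ht'))).mul_left (((n : ℕ) : K)⁻¹)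
    have e1 : (fun l : ℕ × ℕ => ((n : ℕ) : K)⁻¹ * (q ^ l.1 * t ^ l.2) ^ (n : ℕ)) =
        fun l => ((n : ℕ) : K)⁻¹ * ((q ^ (n : ℕ)) ^ l.1 * (t ^ (n : ℕ)) ^ l.2) := by
      funext l
      rw [mul_pow, pow_right_comm, pow_right_comm t]
    rw [e1]
    exact h
  have h := hasProd_mvExp (fun _ => constantCoeff_gradedSum _)
    (hasSum_gradedSum_expAXY (ι := ι) (κ := κ) hφ k)
  rw [cauchyKernel_eq_mvExp (hasWeight_scale (HasWeight.pleth hasWeight_alphX t) k)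
    (HasWeight.pleth hasWeight_alphY t)]
  have hk : kernelTerm q t (scale k (pleth t (alphX K ι κ))) (pleth t (alphY K ι κ)) =
      fun n : ℕ+ =>
      (((n : ℕ) : K)⁻¹ * ((1 - q ^ (n : ℕ))⁻¹ * (1 - t ^ (n : ℕ))⁻¹)) •
        (scale k (alphX K ι κ) n * alphY K ι κ n) := by
    funext n
    have ht0 : 1 - t ^ (n : ℕ) ≠ 0 := fun h0 => by
      have := norm_pow_lt_one ht n
      rw [← sub_eq_zero.1 h0, norm_one] at this
      exact lt_irrefl _ this
    rw [kernelTerm, scale, scale, pleth, pleth, mul_smul_comm, mul_smul_comm, smul_mul_assoc,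
      smul_smul, smul_smul, kernelCoef]
    congr 1
    field_simp
  rw [hk]
  refine Eq.subst (motive := fun f => HasProd f _) (funext fun s => ?_) h
  symm
  rw [← mvExp_negLog (constantCoeff_monAXY _ k s.1.1 s.1.2), negLog_monAXY]

end Products

end Macdonald

end

/-! ### The generalised Cauchy identities and the product formulas -/

open Macdonald in
theorem mainTheorem1 {K : Type*} [NormedField K] [CompleteSpace K] [CharZero K] (ι κ : Type*)
    (q t : K) (hqt : AlgebraicIndependent ℚ ![q, t]) :
    -- the generalised Cauchy identity
    (Multipliable (cauchyFactor q t (alphX K ι κ) (alphY K ι κ)) ∧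
      HasSum (cauchyTerm q t (alphX K ι κ) (alphY K ι κ))
        (∏' k : ℕ, cauchyFactor q t (alphX K ι κ) (alphY K ι κ) k)) ∧
    -- its plethystically substituted form
    (Multipliable (cauchyFactor q t (pleth t (alphX K ι κ)) (pleth t (alphY K ι κ))) ∧
      HasSum (cauchyTerm q t (pleth t (alphX K ι κ)) (pleth t (alphY K ι κ)))
        (∏' k : ℕ, cauchyFactor q t (pleth t (alphX K ι κ)) (pleth t (alphY K ι κ)) k)) ∧
    -- the kernels as infinite products
    (‖q‖ < 1 → ∀ k : ℕ,
      HasProd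
        (fun s : (ι × κ) × ℕ =>
          (1 - monAXY (t * q ^ s.2) k s.1.1 s.1.2) * (1 - monAXY (q ^ s.2) k s.1.1 s.1.2)⁻¹)
        (cauchyKernel q t (scale k (alphX K ι κ)) (alphY K ι κ))) ∧
    (‖q‖ < 1 → ‖t‖ < 1 → ∀ k : ℕ,
      HasProd
        (fun s : (ι × κ) × (ℕ × ℕ) =>
          (1 - monAXY (q ^ s.2.1 * t ^ s.2.2) k s.1.1 s.1.2)⁻¹)
        (cauchyKernel q t (scale k (pleth t (alphX K ι κ))) (pleth t (alphY K ι κ)))) := by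
  have h := mulIndep_of_algebraicIndependent hqt
  have key : ∀ {Z W : ℕ+ → Ser K ι κ}, (∀ n, HasWeight wtX (Z n) n) →
      (∀ n, HasWeight wtA (Z n) 0) → (∀ n, HasWeight wtX (W n) 0) →
      (∀ n, HasWeight wtA (W n) 0) → Multipliable (cauchyFactor q t Z W) ∧
        HasSum (cauchyTerm q t Z W) (∏' k : ℕ, cauchyFactor q t Z W k) := by
    intro Z W hZ hZA hW hWA
    have hp := hasProd_cauchyFactor q t hZ hW
    exact ⟨hp.multipliable, hp.tprod_eq ▸ hasSum_cauchyTerm h hZ hZA hW hWA⟩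
  exact ⟨key hasWeight_alphX hasWeight_alphX_wtA hasWeight_alphY hasWeight_alphY_wtA,
    key (HasWeight.pleth hasWeight_alphX t) (HasWeight.pleth hasWeight_alphX_wtA t)
      (HasWeight.pleth hasWeight_alphY t) (HasWeight.pleth hasWeight_alphY_wtA t),
    fun hq k => hasProd_cauchyKernel hq t k,
    fun hq ht k => hasProd_cauchyKernel_pleth hq ht k⟩
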